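/- Let $\mathbb K$ be a field and let $\mathcal A$ be a small $\mathbb K$-linear monoidal category (the tensor product is $\mathbb K$-linear in each variable). Let $\mathcal X$ be a small $\mathbb K$-linear right $\mathcal A$-module category and $\mathcal Y$ a small $\mathbb K$-linear left $\mathcal A$-module category, with action functors $\triangleleft : \mathcal X \times \mathcal A \to \mathcal X$ and $\triangleright : \mathcal A \times \mathcal Y \to \mathcal Y$ that are $\mathbb K$-linear in each variable, and with coherent associators and unitors. For a small $\mathbb K$-linear category $\mathcal Z$, the free cocompletion $\widehat{\mathcal Z}$ is the category of $\mathbb K$-linear functors $\mathcal Z^{\mathrm{op}} \to \mathrm{Vect}_{\mathbb K}$. By Day convolution, $(F \circledast G)(d) = \int^{b,c} \operatorname{Hom}(d, b\otimes c) \otimes_{\mathbb K} F(b) \otimes_{\mathbb K} G(c)$, and similarly with $\triangleleft$ or $\triangleright$ in place of $\otimes$, $\widehat{\mathcal A}$ is a monoidal category, $\widehat{\mathcal X}$ is a right $\widehat{\mathcal A}$-module and $\widehat{\mathcal Y}$ is a left $\widehat{\mathcal A}$-module. The naive tensor product $\mathcal X \otimes_{\mathbb K} \mathcal Y$ has object set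 $\mathrm{ob}(\mathcal X) \times \mathrm{ob}(\mathcal Y)$ and morphism spaces $\operatorname{Hom}((x,y),(x',y')) = \operatorname{Hom}(x,x') \otimes_{\mathbb K} \operatorname{Hom}(y,y')$. The naive balanced tensor product $\mathcal X \otimes_{\mathcal A} \mathcal Y$ is the $\mathbb K$-linear category with the same objects obtained from $\mathcal X \otimes_{\mathbb K} \mathcal Y$ by freely adjoining isomorphisms $\alpha_{x,a,y} : (x \triangleleft a, y) \to (x, a \triangleright y)$, subject to naturality in $(x,a,y)$, the pentagon relation $\alpha_{x,a,b\triangleright y} \circ \alpha_{x \triangleleft a, b, y} = \alpha_{x, a \otimes b, y}$ and the unit relation $\alpha_{x,\mathbf 1,y} = \mathrm{id}$ (both up to the associators and unitors of $\mathcal X$ and $\mathcal Y$). If $\mathcal C$ is a monoidal category, $\mathcal M$ a right and $\mathcal N$ a left $\mathcal C$-module, with $\mathcal M,\mathcal N$ $\mathbb K$-linear, a balanced functor to a $\mathbb K$-linear category $\mathcal E$ is a functor $P : \mathcal M \times \mathcal N \to \mathcal E$, $\mathbb K$-linear and cocontinuous in each variable, with an isomorphism $P(m \triangleleft c, n) \cong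 P(m, c \triangleright n)$, natural in $m,c,n$ and satisfying the pentagon and triangle equations; morphisms are the natural transformations compatible with these isomorphisms. A balanced tensor product $\mathcal M \boxtimes_{\mathcal C} \mathcal N$ is a cocomplete $\mathbb K$-linear category $\mathcal W$ with a balanced functor $P : \mathcal M \times \mathcal N \to \mathcal W$ that is universal: for every cocomplete $\mathbb K$-linear category $\mathcal E$, composition with $P$ is an equivalence from the category of $\mathbb K$-linear cocontinuous functors $\mathcal W \to \mathcal E$ to the category of balanced functors $\mathcal M \times \mathcal N \to \mathcal E$. Then free cocompletion takes naive balanced tensor products to balanced tensor products: $$ \widehat{\mathcal X \otimes_{\mathcal A} \mathcal Y} \simeq \widehat{\mathcal X} \boxtimes_{\widehat{\mathcal A}} \widehat{\mathcal Y}. $$ That is, there is a balanced functor $P : \widehat{\mathcal X} \times \widehat{\mathcal Y} \to \widehat{\mathcal X \otimes_{\mathcal A} \mathcal Y}$ that makes $\widehat{\mathcal X \otimes_{\mathcal A} \mathcal Y}$ a balanced tensor product of $\widehat{\mathcal X}$ and $\widehat{\mathcal Y}$ over $\widehat{\mathcal A}$; and for every balanced tensor product $(\mathcal W, Q)$ of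 $\widehat{\mathcal X}$ and $\widehat{\mathcal Y}$ over $\widehat{\mathcal A}$ there is a $\mathbb K$-linear cocontinuous equivalence $G : \widehat{\mathcal X \otimes_{\mathcal A} \mathcal Y} \to \mathcal W$ with $G \circ P \cong Q$ as balanced functors. -/

import Mathlib

open CategoryTheory CategoryTheory.Limits MonoidalCategory Opposite
universe u v w v₁ v₂ v₃

namespace LinCat

section FreeCocompletion

variable (K : Type u) [Field K]
variable (X : Type u) [SmallCategory X] [Preadditive X] [Linear K X]

/-- The property of a contravariant functor to `K`-vector spaces to be `K`-linear on morphisms. -/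
def isLinearPresheaf : ObjectProperty (Xᵒᵖ ⥤ ModuleCat.{u} K) := fun F =>
  (∀ ⦃x y : X⦄ (f g : x ⟶ y), F.map (f + g).op = F.map f.op + F.map g.op) ∧
  (∀ ⦃x y : X⦄ (r : K) (f : x ⟶ y), F.map (r • f).op = r • F.map f.op)

/-- The free cocompletion of a small `K`-linear category `X`: the category of `K`-linear functors
`Xᵒᵖ ⥤ Vect K` and natural transformations. -/
abbrev FreeCocompletion : Type (u + 1) := (isLinearPresheaf K X).FullSubcategory

end FreeCocompletion

namespace FreeCocompletion

variable {K : Type u} [Field K]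
variable {X : Type u} [SmallCategory X] [Preadditive X] [Linear K X]

/-- The vector space of sections of a presheaf over an object. -/
abbrev sec (F : FreeCocompletion K X) (x : X) : Type u := F.obj.obj (op x)

/-- The action of a morphism on sections. -/
def res (F : FreeCocompletion K X) {x y : X} (f : x ⟶ y) : F.sec y →ₗ[K] F.sec x :=
  (F.obj.map f.op).hom

/-- The components of a natural transformation, as linear maps. -/
def app {F G : FreeCocompletion K X} (η : F ⟶ G) (x : X) : F.sec x →ₗ[K] G.sec x :=
  (η.hom.app (op x)).hom

@[simp] lemma res_id (F : FreeCocompletion K X) (x : X) (s : F.sec x) : F.res (𝟙 x) s = s := by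
  simp [res]

@[simp] lemma res_res (F : FreeCocompletion K X) {x y z : X} (f : x ⟶ y) (g : y ⟶ z)
    (s : F.sec z) : F.res f (F.res g s) = F.res (f ≫ g) s := by
  simp [res]

lemma res_add (F : FreeCocompletion K X) {x y : X} (f g : x ⟶ y) (s : F.sec y) :
    F.res (f + g) s = F.res f s + F.res g s := by
  have h := F.property.1 f g
  simp only [res, h]
  rfl

lemma res_smul (F : FreeCocompletion K X) {x y : X} (r : K) (f : x ⟶ y) (s : F.sec y) :
    F.res (r • f) s = r • F.res f s := by
  have h := F.property.2 r f
  simp only [res, h]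
  rfl

@[simp] lemma app_res {F G : FreeCocompletion K X} (η : F ⟶ G) {x y : X} (f : x ⟶ y)
    (s : F.sec y) : app η x (F.res f s) = G.res f (app η y s) :=
  ConcreteCategory.congr_hom (η.hom.naturality f.op) s

@[simp] lemma app_id (F : FreeCocompletion K X) (x : X) (s : F.sec x) : app (𝟙 F) x s = s := rfl

@[simp] lemma app_comp {F G H : FreeCocompletion K X} (η : F ⟶ G) (θ : G ⟶ H) (x : X)
    (s : F.sec x) : app (η ≫ θ) x s = app θ x (app η x s) := rfl

lemma hom_ext' {F G : FreeCocompletion K X} {η θ : F ⟶ G}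
    (h : ∀ (x : X) (s : F.sec x), app η x s = app θ x s) : η = θ := by
  apply ObjectProperty.hom_ext
  ext x s
  exact h x.unop s

/-- A linear presheaf from its spaces of sections and restriction maps. -/
def mkObj (S : X → Type u) [∀ x, AddCommGroup (S x)] [∀ x, Module K (S x)]
    (r : ∀ {x y : X}, (x ⟶ y) → (S y →ₗ[K] S x))
    (r_id : ∀ x s, r (𝟙 x) s = s)
    (r_comp : ∀ {x y z : X} (f : x ⟶ y) (g : y ⟶ z) s, r (f ≫ g) s = r f (r g s))
    (r_add : ∀ {x y : X} (f g : x ⟶ y) s, r (f + g) s = r f s + r g s)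
    (r_smul : ∀ {x y : X} (c : K) (f : x ⟶ y) s, r (c • f) s = c • r f s) :
    FreeCocompletion K X where
  obj :=
    { obj := fun x => ModuleCat.of K (S x.unop)
      map := fun f => ModuleCat.ofHom (r f.unop)
      map_id := fun x => by ext s; exact r_id _ s
      map_comp := fun f g => by ext s; exact r_comp _ _ s }
  property := ⟨fun x y f g => by ext s; exact r_add f g s,
    fun x y c f => by ext s; exact r_smul c f s⟩

/-- A morphism of linear presheaves from its components. -/
def mkHom {F G : FreeCocompletion K X} (a : ∀ x, F.sec x →ₗ[K] G.sec x)
    (nat : ∀ {x y : X} (f : x ⟶ y) (s : F.sec y), a x (F.res f s) = G.res f (a y s)) :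
    F ⟶ G :=
  ObjectProperty.homMk
    { app := fun x => ModuleCat.ofHom (a x.unop)
      naturality := fun x y f => by ext s; exact nat f.unop s }

@[simp] lemma app_mkHom {F G : FreeCocompletion K X} (a : ∀ x, F.sec x →ₗ[K] G.sec x)
    (nat : ∀ {x y : X} (f : x ⟶ y) (s : F.sec y), a x (F.res f s) = G.res f (a y s)) (x : X)
    (s : F.sec x) : app (mkHom a nat) x s = a x s := rfl

/-- The presheaf represented by an object. -/
def rep (K : Type u) [Field K] {X : Type u} [SmallCategory X] [Preadditive X] [Linear K X]
    (z : X) : FreeCocompletion K X :=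
  mkObj (fun x => x ⟶ z) (fun f => Linear.leftComp K z f) (by simp) (by simp) (by simp) (by simp)

/-- A section of a represented presheaf, as a morphism. -/
def toHom {z x : X} : (rep K z).sec x →ₗ[K] (x ⟶ z) := LinearMap.id (M := x ⟶ z)

/-- A morphism, as a section of a represented presheaf. -/
def ofHom {z x : X} : (x ⟶ z) →ₗ[K] (rep K z).sec x := LinearMap.id (M := x ⟶ z)

@[simp] lemma toHom_ofHom {z x : X} (f : x ⟶ z) : toHom (ofHom (K := K) f) = f := rfl

@[simp] lemma ofHom_toHom {z x : X} (s : (rep K z).sec x) : ofHom (toHom s) = s := rfl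

@[simp] lemma toHom_res {z x y : X} (f : x ⟶ y) (s : (rep K z).sec y) :
    toHom ((rep K z).res f s) = f ≫ toHom s := rfl

lemma res_ofHom {z x y : X} (f : x ⟶ y) (g : y ⟶ z) :
    (rep K z).res f (ofHom g) = ofHom (f ≫ g) := rfl

lemma eq_res {z x : X} (s : (rep K z).sec x) : s = (rep K z).res (toHom s) (ofHom (𝟙 z)) := by
  rw [res_ofHom, Category.comp_id, ofHom_toHom]

end FreeCocompletion

/-! ### Day convolution along a bilinear functor -/

/-- A functor of two variables between `K`-linear categories which is `K`-linear in each. -/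
class IsBilinear (K : Type*) [Field K] {B C D : Type*} [Category* B] [Category* C]
    [Category* D] [Preadditive B] [Preadditive C] [Preadditive D] [Linear K B] [Linear K C]
    [Linear K D] (T : B ⥤ C ⥤ D) : Prop where
  map_add_left : ∀ {b b' : B} (f g : b ⟶ b') (c : C),
    (T.map (f + g)).app c = (T.map f).app c + (T.map g).app c
  map_smul_left : ∀ {b b' : B} (r : K) (f : b ⟶ b') (c : C),
    (T.map (r • f)).app c = r • (T.map f).app c
  map_add_right : ∀ (b : B) {c c' : C} (f g : c ⟶ c'),
    (T.obj b).map (f + g) = (T.obj b).map f + (T.obj b).map g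
  map_smul_right : ∀ (b : B) {c c' : C} (r : K) (f : c ⟶ c'),
    (T.obj b).map (r • f) = r • (T.obj b).map f

namespace Day

open FreeCocompletion

variable {K : Type u} [Field K]
variable {B C D : Type u} [SmallCategory B] [SmallCategory C] [SmallCategory D]
variable [Preadditive B] [Preadditive C] [Preadditive D] [Linear K B] [Linear K C] [Linear K D]
variable (T : B ⥤ C ⥤ D) (F : FreeCocompletion K B) (G : FreeCocompletion K C)

/-- Generators of the coend `∫^{b,c} D(d, T(b,c)) ⊗ F(b) ⊗ G(c)`. -/
structure Gen (d : D) : Type u where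
  /-- the first object -/
  b : B
  /-- the second object -/
  c : C
  /-- the morphism -/
  φ : d ⟶ (T.obj b).obj c
  /-- the section of the first presheaf -/
  s : F.sec b
  /-- the section of the second presheaf -/
  t : G.sec c

/-- The free vector space on the generators. -/
abbrev Pre (d : D) : Type u := Gen T F G d →₀ K

/-- A generator, as a vector. -/
noncomputable def gen {T : B ⥤ C ⥤ D} {F : FreeCocompletion K B} {G : FreeCocompletion K C} {d : D}
    {b : B} {c : C} (φ : d ⟶ (T.obj b).obj c) (s : F.sec b) (t : G.sec c) : Pre T F G d :=
  Finsupp.single ⟨b, c, φ, s, t⟩ 1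

/-- The defining relators of the coend: linearity in each of the three tensor factors, and
dinaturality in the two bound objects. -/
inductive Relator (d : D) : Pre T F G d → Prop
  | add_hom {b c} (φ φ' : d ⟶ (T.obj b).obj c) (s : F.sec b) (t : G.sec c) :
      Relator d (gen (φ + φ') s t - gen φ s t - gen φ' s t)
  | smul_hom {b c} (r : K) (φ : d ⟶ (T.obj b).obj c) (s : F.sec b) (t : G.sec c) :
      Relator d (gen (r • φ) s t - r • gen φ s t)
  | add_left {b c} (φ : d ⟶ (T.obj b).obj c) (s s' : F.sec b) (t : G.sec c) :
      Relator d (gen φ (s + s') t - gen φ s t - gen φ s' t)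
  | smul_left {b c} (r : K) (φ : d ⟶ (T.obj b).obj c) (s : F.sec b) (t : G.sec c) :
      Relator d (gen φ (r • s) t - r • gen φ s t)
  | add_right {b c} (φ : d ⟶ (T.obj b).obj c) (s : F.sec b) (t t' : G.sec c) :
      Relator d (gen φ s (t + t') - gen φ s t - gen φ s t')
  | smul_right {b c} (r : K) (φ : d ⟶ (T.obj b).obj c) (s : F.sec b) (t : G.sec c) :
      Relator d (gen φ s (r • t) - r • gen φ s t)
  | dinat_left {b b' c} (f : b ⟶ b') (φ : d ⟶ (T.obj b).obj c) (s : F.sec b') (t : G.sec c) :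
      Relator d (gen (φ ≫ (T.map f).app c) s t - gen φ (F.res f s) t)
  | dinat_right {b c c'} (g : c ⟶ c') (φ : d ⟶ (T.obj b).obj c) (s : F.sec b) (t : G.sec c') :
      Relator d (gen (φ ≫ (T.obj b).map g) s t - gen φ s (G.res g t))

/-- The coend `∫^{b,c} D(d, T(b,c)) ⊗ F(b) ⊗ G(c)`. -/
abbrev Coend (d : D) : Type u :=
  Pre T F G d ⧸ Submodule.span K {z | Relator T F G d z}

variable {T F G} {d : D}

/-- The class of a generator in the coend. -/
noncomputable def mk {b : B} {c : C} (φ : d ⟶ (T.obj b).obj c) (s : F.sec b) (t : G.sec c) :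
    Coend T F G d :=
  (Submodule.span K {z | Relator T F G d z}).mkQ (gen φ s t)

lemma mkQ_eq_zero {z : Pre T F G d} (h : Relator T F G d z) :
    (Submodule.span K {z | Relator T F G d z}).mkQ z = 0 := by
  rw [Submodule.mkQ_apply, Submodule.Quotient.mk_eq_zero]
  exact Submodule.subset_span h

section

variable {b b' : B} {c c' : C}

lemma mk_add_hom (φ φ' : d ⟶ (T.obj b).obj c) (s : F.sec b) (t : G.sec c) :
    mk (φ + φ') s t = mk φ s t + mk φ' s t := by
  have h := mkQ_eq_zero (Relator.add_hom φ φ' s t)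
  rw [map_sub, map_sub, sub_sub, sub_eq_zero] at h
  exact h

lemma mk_smul_hom (r : K) (φ : d ⟶ (T.obj b).obj c) (s : F.sec b) (t : G.sec c) :
    mk (r • φ) s t = r • mk φ s t := by
  have h := mkQ_eq_zero (Relator.smul_hom r φ s t)
  rw [map_sub, map_smul, sub_eq_zero] at h
  exact h

lemma mk_add_left (φ : d ⟶ (T.obj b).obj c) (s s' : F.sec b) (t : G.sec c) :
    mk φ (s + s') t = mk φ s t + mk φ s' t := by
  have h := mkQ_eq_zero (Relator.add_left φ s s' t)
  rw [map_sub, map_sub, sub_sub, sub_eq_zero] at h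
  exact h

lemma mk_smul_left (r : K) (φ : d ⟶ (T.obj b).obj c) (s : F.sec b) (t : G.sec c) :
    mk φ (r • s) t = r • mk φ s t := by
  have h := mkQ_eq_zero (Relator.smul_left r φ s t)
  rw [map_sub, map_smul, sub_eq_zero] at h
  exact h

lemma mk_add_right (φ : d ⟶ (T.obj b).obj c) (s : F.sec b) (t t' : G.sec c) :
    mk φ s (t + t') = mk φ s t + mk φ s t' := by
  have h := mkQ_eq_zero (Relator.add_right φ s t t')
  rw [map_sub, map_sub, sub_sub, sub_eq_zero] at h
  exact h

lemma mk_smul_right (r : K) (φ : d ⟶ (T.obj b).obj c) (s : F.sec b) (t : G.sec c) :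
    mk φ s (r • t) = r • mk φ s t := by
  have h := mkQ_eq_zero (Relator.smul_right r φ s t)
  rw [map_sub, map_smul, sub_eq_zero] at h
  exact h

lemma mk_res_left (f : b ⟶ b') (φ : d ⟶ (T.obj b).obj c) (s : F.sec b') (t : G.sec c) :
    mk φ (F.res f s) t = mk (φ ≫ (T.map f).app c) s t := by
  have h := mkQ_eq_zero (Relator.dinat_left f φ s t)
  rw [map_sub, sub_eq_zero] at h
  exact h.symm

lemma mk_res_right (g : c ⟶ c') (φ : d ⟶ (T.obj b).obj c) (s : F.sec b) (t : G.sec c') :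
    mk φ s (G.res g t) = mk (φ ≫ (T.obj b).map g) s t := by
  have h := mkQ_eq_zero (Relator.dinat_right g φ s t)
  rw [map_sub, sub_eq_zero] at h
  exact h.symm

end

lemma ind {p : Coend T F G d → Prop}
    (h_mk : ∀ {b : B} {c : C} (φ : d ⟶ (T.obj b).obj c) (s : F.sec b) (t : G.sec c), p (mk φ s t))
    (h_zero : p 0) (h_add : ∀ x y, p x → p y → p (x + y)) (x : Coend T F G d) : p x := by
  obtain ⟨z, rfl⟩ := Submodule.mkQ_surjective _ x
  induction z using Finsupp.induction_linear with
  | zero => rw [map_zero]; exact h_zero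
  | add f g hf hg => rw [map_add]; exact h_add _ _ hf hg
  | single a r =>
    have h : (Submodule.span K {z | Relator T F G d z}).mkQ (Finsupp.single a r)
        = mk (r • a.φ) a.s a.t := by
      have e : Finsupp.single a r = r • gen a.φ a.s a.t := by simp [gen]
      rw [mk_smul_hom, e]
      exact map_smul _ _ _
    rw [h]
    exact h_mk _ _ _

variable (T F G d) in
/-- A trilinear dinatural family of maps `D(d, T(b,c)) × F(b) × G(c) → M`. -/
structure TriMap (M : Type*) [AddCommGroup M] [Module K M] where
  /-- the family of maps -/
  f : ∀ {b : B} {c : C}, (d ⟶ (T.obj b).obj c) → F.sec b → G.sec c → M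
  add_hom : ∀ {b : B} {c : C} (φ φ' : d ⟶ (T.obj b).obj c) (s : F.sec b) (t : G.sec c),
    f (φ + φ') s t = f φ s t + f φ' s t := by simp
  smul_hom : ∀ {b : B} {c : C} (r : K) (φ : d ⟶ (T.obj b).obj c) (s : F.sec b) (t : G.sec c),
    f (r • φ) s t = r • f φ s t := by simp
  add_left : ∀ {b : B} {c : C} (φ : d ⟶ (T.obj b).obj c) (s s' : F.sec b) (t : G.sec c),
    f φ (s + s') t = f φ s t + f φ s' t := by simp
  smul_left : ∀ {b : B} {c : C} (r : K) (φ : d ⟶ (T.obj b).obj c) (s : F.sec b) (t : G.sec c),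
    f φ (r • s) t = r • f φ s t := by simp
  add_right : ∀ {b : B} {c : C} (φ : d ⟶ (T.obj b).obj c) (s : F.sec b) (t t' : G.sec c),
    f φ s (t + t') = f φ s t + f φ s t' := by simp
  smul_right : ∀ {b : B} {c : C} (r : K) (φ : d ⟶ (T.obj b).obj c) (s : F.sec b) (t : G.sec c),
    f φ s (r • t) = r • f φ s t := by simp
  dinat_left : ∀ {b b' : B} {c : C} (g : b ⟶ b') (φ : d ⟶ (T.obj b).obj c) (s : F.sec b')
    (t : G.sec c), f (φ ≫ (T.map g).app c) s t = f φ (F.res g s) t := by simp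
  dinat_right : ∀ {b : B} {c c' : C} (g : c ⟶ c') (φ : d ⟶ (T.obj b).obj c) (s : F.sec b)
    (t : G.sec c'), f (φ ≫ (T.obj b).map g) s t = f φ s (G.res g t) := by simp

/-- The linear map out of the coend determined by its values on generators. -/
noncomputable def lift {M : Type*} [AddCommGroup M] [Module K M] (m : TriMap T F G d M) :
    Coend T F G d →ₗ[K] M :=
  (Submodule.span K {z | Relator T F G d z}).liftQ
    (Finsupp.linearCombination K (fun a : Gen T F G d => m.f a.φ a.s a.t)) (by
      rw [Submodule.span_le]
      intro z hz
      have hg : ∀ {b : B} {c : C} (φ : d ⟶ (T.obj b).obj c) (s : F.sec b) (t : G.sec c),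
        Finsupp.linearCombination K (fun a : Gen T F G d => m.f a.φ a.s a.t) (gen φ s t)
          = m.f φ s t := fun φ s t => by simp [gen]
      rw [SetLike.mem_coe, LinearMap.mem_ker]
      cases hz with
      | add_hom φ φ' s t => simp only [map_sub, hg, m.add_hom]; abel
      | smul_hom r φ s t => simp only [map_sub, map_smul, hg, m.smul_hom, sub_self]
      | add_left φ s s' t => simp only [map_sub, hg, m.add_left]; abel
      | smul_left r φ s t => simp only [map_sub, map_smul, hg, m.smul_left, sub_self]
      | add_right φ s t t' => simp only [map_sub, hg, m.add_right]; abel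
      | smul_right r φ s t => simp only [map_sub, map_smul, hg, m.smul_right, sub_self]
      | dinat_left g φ s t => simp only [map_sub, hg, m.dinat_left, sub_self]
      | dinat_right g φ s t => simp only [map_sub, hg, m.dinat_right, sub_self])

lemma lift_mk {M : Type*} [AddCommGroup M] [Module K M] (m : TriMap T F G d M)
    {b : B} {c : C} (φ : d ⟶ (T.obj b).obj c) (s : F.sec b) (t : G.sec c) :
    lift m (mk φ s t) = m.f φ s t := by
  have h : lift m (mk φ s t) =
      Finsupp.linearCombination K (fun a : Gen T F G d => m.f a.φ a.s a.t) (gen φ s t) :=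
    Submodule.liftQ_apply _ _ _
  rw [h]
  simp [gen]

variable (T F G) in
/-- Restriction maps of the Day convolution. -/
noncomputable def coendRes {d d' : D} (h : d ⟶ d') : Coend T F G d' →ₗ[K] Coend T F G d :=
  lift
    { f := fun φ s t => mk (h ≫ φ) s t
      add_hom := by simp [mk_add_hom]
      smul_hom := by simp [mk_smul_hom]
      add_left := by simp [mk_add_left]
      smul_left := by simp [mk_smul_left]
      add_right := by simp [mk_add_right]
      smul_right := by simp [mk_smul_right]
      dinat_left := by simp [mk_res_left]
      dinat_right := by simp [mk_res_right] }

lemma coendRes_mk {d' : D} (h : d' ⟶ d) {b : B} {c : C} (φ : d ⟶ (T.obj b).obj c)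
    (s : F.sec b) (t : G.sec c) : coendRes T F G h (mk φ s t) = mk (h ≫ φ) s t :=
  lift_mk _ _ _ _

variable (T F G) in
/-- The Day convolution of two linear presheaves along a functor `T` of two variables:
`d ↦ ∫^{b,c} D(d, T(b,c)) ⊗ F(b) ⊗ G(c)`. -/
noncomputable def conv : FreeCocompletion K D :=
  mkObj (fun d => Coend T F G d) (coendRes T F G)
    (fun d s => by
      induction s using ind with
      | h_mk φ s t => rw [coendRes_mk, Category.id_comp]
      | h_zero => simp only [map_zero]
      | h_add x y hx hy => simp only [map_add, hx, hy])
    (fun f g s => by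
      induction s using ind with
      | h_mk φ s t => rw [coendRes_mk, coendRes_mk, coendRes_mk, Category.assoc]
      | h_zero => simp only [map_zero]
      | h_add x y hx hy => simp only [map_add, hx, hy])
    (fun f g s => by
      induction s using ind with
      | h_mk φ s t =>
        rw [coendRes_mk, coendRes_mk, coendRes_mk, Preadditive.add_comp, mk_add_hom]
      | h_zero => simp only [map_zero, add_zero]
      | h_add x y hx hy => simp only [map_add, hx, hy]; abel)
    (fun r f s => by
      induction s using ind with
      | h_mk φ s t => rw [coendRes_mk, coendRes_mk, Linear.smul_comp, mk_smul_hom]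
      | h_zero => simp only [map_zero, smul_zero]
      | h_add x y hx hy => simp only [map_add, hx, hy, smul_add])

/-- A generator, as a section of the Day convolution. -/
noncomputable def cmk {b : B} {c : C} (φ : d ⟶ (T.obj b).obj c) (s : F.sec b) (t : G.sec c) :
    (conv T F G).sec d := mk φ s t

@[simp] lemma res_cmk {d' : D} (h : d' ⟶ d) {b : B} {c : C} (φ : d ⟶ (T.obj b).obj c)
    (s : F.sec b) (t : G.sec c) :
    (conv T F G).res h (cmk φ s t) = cmk (h ≫ φ) s t :=
  coendRes_mk _ _ _ _

lemma cind {p : (conv T F G).sec d → Prop}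
    (h_mk : ∀ {b : B} {c : C} (φ : d ⟶ (T.obj b).obj c) (s : F.sec b) (t : G.sec c),
      p (cmk φ s t))
    (h_zero : p 0) (h_add : ∀ x y, p x → p y → p (x + y)) (x : (conv T F G).sec d) : p x :=
  ind h_mk h_zero h_add x

/-- The linear map out of the sections of the Day convolution determined by a trilinear dinatural
family of maps. -/
noncomputable def clift {M : Type*} [AddCommGroup M] [Module K M] (m : TriMap T F G d M) :
    (conv T F G).sec d →ₗ[K] M :=
  lift m

@[simp] lemma clift_cmk {M : Type*} [AddCommGroup M] [Module K M] (m : TriMap T F G d M)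
    {b : B} {c : C} (φ : d ⟶ (T.obj b).obj c) (s : F.sec b) (t : G.sec c) :
    clift m (cmk φ s t) = m.f φ s t :=
  lift_mk _ _ _ _

section

variable {b b' : B} {c c' : C}

@[simp] lemma cmk_add_hom (φ φ' : d ⟶ (T.obj b).obj c) (s : F.sec b) (t : G.sec c) :
    cmk (φ + φ') s t = cmk φ s t + cmk φ' s t := mk_add_hom φ φ' s t

@[simp] lemma cmk_smul_hom (r : K) (φ : d ⟶ (T.obj b).obj c) (s : F.sec b) (t : G.sec c) :
    cmk (r • φ) s t = r • cmk φ s t := mk_smul_hom r φ s t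

@[simp] lemma cmk_add_left (φ : d ⟶ (T.obj b).obj c) (s s' : F.sec b) (t : G.sec c) :
    cmk φ (s + s') t = cmk φ s t + cmk φ s' t := mk_add_left φ s s' t

@[simp] lemma cmk_smul_left (r : K) (φ : d ⟶ (T.obj b).obj c) (s : F.sec b) (t : G.sec c) :
    cmk φ (r • s) t = r • cmk φ s t := mk_smul_left r φ s t

@[simp] lemma cmk_add_right (φ : d ⟶ (T.obj b).obj c) (s : F.sec b) (t t' : G.sec c) :
    cmk φ s (t + t') = cmk φ s t + cmk φ s t' := mk_add_right φ s t t'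

@[simp] lemma cmk_smul_right (r : K) (φ : d ⟶ (T.obj b).obj c) (s : F.sec b) (t : G.sec c) :
    cmk φ s (r • t) = r • cmk φ s t := mk_smul_right r φ s t

@[simp] lemma cmk_zero_left (φ : d ⟶ (T.obj b).obj c) (t : G.sec c) :
    cmk (F := F) φ 0 t = 0 := by
  simpa using cmk_smul_left (F := F) 0 φ 0 t

@[simp] lemma cmk_zero_right (φ : d ⟶ (T.obj b).obj c) (s : F.sec b) :
    cmk (G := G) φ s 0 = 0 := by
  simpa using cmk_smul_right (G := G) 0 φ s 0

@[simp] lemma cmk_res_left (f : b ⟶ b') (φ : d ⟶ (T.obj b).obj c) (s : F.sec b') (t : G.sec c) :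
    cmk φ (F.res f s) t = cmk (φ ≫ (T.map f).app c) s t := mk_res_left f φ s t

@[simp] lemma cmk_res_right (g : c ⟶ c') (φ : d ⟶ (T.obj b).obj c) (s : F.sec b)
    (t : G.sec c') :
    cmk φ s (G.res g t) = cmk (φ ≫ (T.obj b).map g) s t := mk_res_right g φ s t

end

/-- A morphism out of a Day convolution, from compatible trilinear dinatural families. -/
noncomputable def desc {H : FreeCocompletion K D} (m : ∀ d, TriMap T F G d (H.sec d))
    (nat : ∀ {d d' : D} (h : d ⟶ d') {b : B} {c : C} (φ : d' ⟶ (T.obj b).obj c) (s : F.sec b)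
      (t : G.sec c), (m d).f (h ≫ φ) s t = H.res h ((m d').f φ s t)) : conv T F G ⟶ H :=
  mkHom (fun d => clift (m d)) (fun f s => by
      induction s using cind with
      | h_mk φ s t => rw [res_cmk, clift_cmk, clift_cmk, nat]
      | h_zero => simp only [map_zero]
      | h_add x y hx hy => simp only [map_add, hx, hy])

@[simp] lemma app_desc {H : FreeCocompletion K D} (m : ∀ d, TriMap T F G d (H.sec d)) (nat)
    {b : B} {c : C} (φ : d ⟶ (T.obj b).obj c) (s : F.sec b) (t : G.sec c) :
    app (desc m nat) d (cmk φ s t) = (m d).f φ s t :=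
  clift_cmk _ _ _ _

/-- Functoriality of the Day convolution in both presheaves. -/
noncomputable def map (T : B ⥤ C ⥤ D) {F F' : FreeCocompletion K B} {G G' : FreeCocompletion K C}
    (η : F ⟶ F') (θ : G ⟶ G') : conv T F G ⟶ conv T F' G' :=
  desc (fun d => { f := fun {b c} φ s t => cmk φ (app η b s) (app θ c t) }) (by simp)

@[simp] lemma app_map_cmk {F F' : FreeCocompletion K B} {G G' : FreeCocompletion K C}
    (η : F ⟶ F') (θ : G ⟶ G') {b : B} {c : C} (φ : d ⟶ (T.obj b).obj c) (s : F.sec b)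
    (t : G.sec c) : app (map T η θ) d (cmk φ s t) = cmk φ (app η b s) (app θ c t) :=
  app_desc _ _ _ _ _

lemma conv_hom_ext {H : FreeCocompletion K D} {η θ : conv T F G ⟶ H}
    (h : ∀ {d : D} {b : B} {c : C} (φ : d ⟶ (T.obj b).obj c) (s : F.sec b) (t : G.sec c),
      app η d (cmk φ s t) = app θ d (cmk φ s t)) : η = θ := by
  apply hom_ext'
  intro x s
  induction s using cind with
  | h_mk φ s t => exact h φ s t
  | h_zero => simp
  | h_add x y hx hy => rw [map_add, map_add, hx, hy]

lemma map_id : map T (𝟙 F) (𝟙 G) = 𝟙 _ := conv_hom_ext (by simp)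

lemma map_comp {F F' F'' : FreeCocompletion K B} {G G' G'' : FreeCocompletion K C}
    (η : F ⟶ F') (η' : F' ⟶ F'') (θ : G ⟶ G') (θ' : G' ⟶ G'') :
    map T (η ≫ η') (θ ≫ θ') = map T η θ ≫ map T η' θ' := conv_hom_ext (by simp)

/-! #### Unit constraints -/

section Unitors

variable {Y A : Type u} [SmallCategory Y] [SmallCategory A]

/-- A natural family of isomorphisms `T(e, y) ≅ y`. -/
structure LeftUnit (T : A ⥤ Y ⥤ Y) (e : A) where
  /-- the isomorphisms -/
  iso : ∀ y, (T.obj e).obj y ≅ y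
  nat : ∀ {y y' : Y} (f : y ⟶ y'), (T.obj e).map f ≫ (iso y').hom = (iso y).hom ≫ f

/-- A natural family of isomorphisms `T(y, e) ≅ y`. -/
structure RightUnit (T : Y ⥤ A ⥤ Y) (e : A) where
  /-- the isomorphisms -/
  iso : ∀ y, (T.obj y).obj e ≅ y
  nat : ∀ {y y' : Y} (f : y ⟶ y'), (T.map f).app e ≫ (iso y').hom = (iso y).hom ≫ f

variable [Preadditive Y] [Preadditive A] [Linear K Y] [Linear K A]

/-- The map `Hom(-, e) ⊛ F ⟶ F` induced by `T(e, y) ≅ y`. -/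
noncomputable def leftUnitHom (T : A ⥤ Y ⥤ Y) [IsBilinear K T] (e : A) (l : LeftUnit T e)
    (F : FreeCocompletion K Y) : conv T (rep K e) F ⟶ F :=
  desc (fun d =>
    { f := fun {b c} φ u t => F.res (φ ≫ (T.map (toHom u)).app c ≫ (l.iso c).hom) t
      add_hom := by simp [res_add]
      smul_hom := by simp [res_smul]
      add_left := by simp [res_add, IsBilinear.map_add_left (K := K)]
      smul_left := by simp [res_smul, IsBilinear.map_smul_left (K := K)]
      dinat_right := by simp [← l.nat] }) (by simp)

/-- The map `F ⟶ Hom(-, e) ⊛ F` induced by `T(e, y) ≅ y`. -/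
noncomputable def leftUnitInv (T : A ⥤ Y ⥤ Y) (e : A) (l : LeftUnit T e)
    (F : FreeCocompletion K Y) : F ⟶ conv T (rep K e) F :=
  mkHom (fun d =>
    { toFun := fun s => cmk (l.iso d).inv (ofHom (𝟙 e)) s
      map_add' := by simp
      map_smul' := by simp }) (fun {x y} f s => by
        have h : (l.iso x).inv ≫ (T.obj e).map f = f ≫ (l.iso y).inv := by
          rw [Iso.inv_comp_eq, ← Category.assoc, ← l.nat, Category.assoc, Iso.hom_inv_id,
            Category.comp_id]
        simp [h])

section

variable (T : A ⥤ Y ⥤ Y) (e : A) (l : LeftUnit T e) (F : FreeCocompletion K Y)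

@[simp] lemma app_leftUnitInv {d : Y} (s : F.sec d) :
    app (leftUnitInv T e l F) d s = cmk (l.iso d).inv (ofHom (𝟙 e)) s := rfl

variable [IsBilinear K T]

@[simp] lemma app_leftUnitHom {d : Y} {b : A} {c : Y} (φ : d ⟶ (T.obj b).obj c)
    (u : (rep K e).sec b) (t : F.sec c) : app (leftUnitHom T e l F) d (cmk φ u t) =
      F.res (φ ≫ (T.map (toHom u)).app c ≫ (l.iso c).hom) t := by
  rw [leftUnitHom, app_desc]

/-- A unit isomorphism `T(e, y) ≅ y` induces `Hom(-, e) ⊛ F ≅ F`. -/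
noncomputable def leftUnit : conv T (rep K e) F ≅ F where
  hom := leftUnitHom T e l F
  inv := leftUnitInv T e l F
  hom_inv_id := conv_hom_ext (fun φ s t => by
    rw [eq_res s]
    simp)
  inv_hom_id := hom_ext' (by simp)

end

/-- The map `F ⊛ Hom(-, e) ⟶ F` induced by `T(y, e) ≅ y`. -/
noncomputable def rightUnitHom (T : Y ⥤ A ⥤ Y) [IsBilinear K T] (e : A) (l : RightUnit T e)
    (F : FreeCocompletion K Y) : conv T F (rep K e) ⟶ F :=
  desc (fun d =>
    { f := fun {b c} φ t u => F.res (φ ≫ (T.obj b).map (toHom u) ≫ (l.iso b).hom) t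
      add_hom := by simp [res_add]
      smul_hom := by simp [res_smul]
      add_right := by simp [res_add, IsBilinear.map_add_right (K := K)]
      smul_right := by simp [res_smul, IsBilinear.map_smul_right (K := K)]
      dinat_left := fun g φ s t => by
        rw [res_res]
        simp only [Category.assoc]
        rw [← l.nat, ← NatTrans.naturality_assoc] }) (by simp)

/-- The map `F ⟶ F ⊛ Hom(-, e)` induced by `T(y, e) ≅ y`. -/
noncomputable def rightUnitInv (T : Y ⥤ A ⥤ Y) (e : A) (l : RightUnit T e)
    (F : FreeCocompletion K Y) : F ⟶ conv T F (rep K e) :=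
  mkHom (fun d =>
    { toFun := fun s => cmk (l.iso d).inv s (ofHom (𝟙 e))
      map_add' := by simp
      map_smul' := by simp }) (fun {x y} f s => by
        have h : (l.iso x).inv ≫ (T.map f).app e = f ≫ (l.iso y).inv := by
          rw [Iso.inv_comp_eq, ← Category.assoc, ← l.nat, Category.assoc, Iso.hom_inv_id,
            Category.comp_id]
        simp [h])

section

variable (T : Y ⥤ A ⥤ Y) (e : A) (l : RightUnit T e) (F : FreeCocompletion K Y)

@[simp] lemma app_rightUnitInv {d : Y} (s : F.sec d) :
    app (rightUnitInv T e l F) d s = cmk (l.iso d).inv s (ofHom (𝟙 e)) := rfl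

variable [IsBilinear K T]

@[simp] lemma app_rightUnitHom {d : Y} {b : Y} {c : A} (φ : d ⟶ (T.obj b).obj c)
    (t : F.sec b) (u : (rep K e).sec c) : app (rightUnitHom T e l F) d (cmk φ t u) =
      F.res (φ ≫ (T.obj b).map (toHom u) ≫ (l.iso b).hom) t := by
  rw [rightUnitHom, app_desc]

/-- A unit isomorphism `T(y, e) ≅ y` induces `F ⊛ Hom(-, e) ≅ F`. -/
noncomputable def rightUnit : conv T F (rep K e) ≅ F where
  hom := rightUnitHom T e l F
  inv := rightUnitInv T e l F
  hom_inv_id := conv_hom_ext (fun φ s t => by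
    rw [eq_res t]
    simp)
  inv_hom_id := hom_ext' (by simp)

end

end Unitors

/-! #### Associativity constraints -/

section Associators

variable {B₁ B₂ B₃ B₁₂ B₂₃ E : Type u} [SmallCategory B₁] [SmallCategory B₂] [SmallCategory B₃]
variable [SmallCategory B₁₂] [SmallCategory B₂₃] [SmallCategory E]

/-- A family of associativity isomorphisms `T(S(b₁,b₂),b₃) ≅ V(b₁,U(b₂,b₃))`, natural in all three
variables. -/
structure Assoc (S : B₁ ⥤ B₂ ⥤ B₁₂) (T : B₁₂ ⥤ B₃ ⥤ E) (U : B₂ ⥤ B₃ ⥤ B₂₃)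
    (V : B₁ ⥤ B₂₃ ⥤ E) where
  /-- the isomorphisms -/
  iso : ∀ b₁ b₂ b₃, (T.obj ((S.obj b₁).obj b₂)).obj b₃ ≅ (V.obj b₁).obj ((U.obj b₂).obj b₃)
  nat₁ : ∀ {b₁ b₁' : B₁} (f : b₁ ⟶ b₁') (b₂ : B₂) (b₃ : B₃),
    (T.map ((S.map f).app b₂)).app b₃ ≫ (iso b₁' b₂ b₃).hom =
      (iso b₁ b₂ b₃).hom ≫ (V.map f).app ((U.obj b₂).obj b₃)
  nat₂ : ∀ (b₁ : B₁) {b₂ b₂' : B₂} (f : b₂ ⟶ b₂') (b₃ : B₃),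
    (T.map ((S.obj b₁).map f)).app b₃ ≫ (iso b₁ b₂' b₃).hom =
      (iso b₁ b₂ b₃).hom ≫ (V.obj b₁).map ((U.map f).app b₃)
  nat₃ : ∀ (b₁ : B₁) (b₂ : B₂) {b₃ b₃' : B₃} (f : b₃ ⟶ b₃'),
    (T.obj ((S.obj b₁).obj b₂)).map f ≫ (iso b₁ b₂ b₃').hom =
      (iso b₁ b₂ b₃).hom ≫ (V.obj b₁).map ((U.obj b₂).map f)

namespace Assoc

variable {S : B₁ ⥤ B₂ ⥤ B₁₂} {T : B₁₂ ⥤ B₃ ⥤ E} {U : B₂ ⥤ B₃ ⥤ B₂₃} {V : B₁ ⥤ B₂₃ ⥤ E}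

section

variable (a : Assoc S T U V)

lemma inv_nat₁ {b₁ b₁' : B₁} (f : b₁ ⟶ b₁') (b₂ : B₂) (b₃ : B₃) :
    (V.map f).app ((U.obj b₂).obj b₃) ≫ (a.iso b₁' b₂ b₃).inv =
      (a.iso b₁ b₂ b₃).inv ≫ (T.map ((S.map f).app b₂)).app b₃ := by
  rw [Iso.eq_inv_comp, ← Category.assoc, ← a.nat₁, Category.assoc, Iso.hom_inv_id,
    Category.comp_id]

lemma inv_nat₂ (b₁ : B₁) {b₂ b₂' : B₂} (f : b₂ ⟶ b₂') (b₃ : B₃) :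
    (V.obj b₁).map ((U.map f).app b₃) ≫ (a.iso b₁ b₂' b₃).inv =
      (a.iso b₁ b₂ b₃).inv ≫ (T.map ((S.obj b₁).map f)).app b₃ := by
  rw [Iso.eq_inv_comp, ← Category.assoc, ← a.nat₂, Category.assoc, Iso.hom_inv_id,
    Category.comp_id]

lemma inv_nat₃ (b₁ : B₁) (b₂ : B₂) {b₃ b₃' : B₃} (f : b₃ ⟶ b₃') :
    (V.obj b₁).map ((U.obj b₂).map f) ≫ (a.iso b₁ b₂ b₃').inv =
      (a.iso b₁ b₂ b₃).inv ≫ (T.obj ((S.obj b₁).obj b₂)).map f := by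
  rw [Iso.eq_inv_comp, ← Category.assoc, ← a.nat₃, Category.assoc, Iso.hom_inv_id,
    Category.comp_id]

end

variable [Preadditive B₁] [Preadditive B₂] [Preadditive B₃] [Preadditive B₁₂] [Preadditive B₂₃]
variable [Preadditive E] [Linear K B₁] [Linear K B₂] [Linear K B₃] [Linear K B₁₂] [Linear K B₂₃]
variable [Linear K E]
variable (a : Assoc S T U V)
variable (F₁ : FreeCocompletion K B₁) (F₂ : FreeCocompletion K B₂) (F₃ : FreeCocompletion K B₃)

section

variable [IsBilinear K T]

/-- Auxiliary map for `Assoc.hom`: the morphism `φ` and the third section are fixed. -/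
noncomputable def homAux {e : E} {x : B₁₂} {b₃ : B₃} (φ : e ⟶ (T.obj x).obj b₃) (s₃ : F₃.sec b₃) :
    (conv S F₁ F₂).sec x →ₗ[K] (conv V F₁ (conv U F₂ F₃)).sec e :=
  clift
    { f := fun {b₁ b₂} ψ s₁ s₂ => cmk (φ ≫ (T.map ψ).app b₃ ≫ (a.iso b₁ b₂ b₃).hom) s₁
        (cmk (𝟙 _) s₂ s₃)
      add_hom := by simp [IsBilinear.map_add_left (K := K)]
      smul_hom := by simp [IsBilinear.map_smul_left (K := K)]
      dinat_left := by simp [a.nat₁]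
      dinat_right := fun g ψ s t => by
        have h : cmk (T := U) (𝟙 _) (F₂.res g t) s₃ =
          (conv U F₂ F₃).res ((U.map g).app b₃) (cmk (𝟙 _) t s₃) := by simp
        rw [h, cmk_res_right]
        simp [a.nat₂] }

@[simp] lemma homAux_cmk {e : E} {x : B₁₂} {b₃ : B₃} (φ : e ⟶ (T.obj x).obj b₃) (s₃ : F₃.sec b₃)
    {b₁ : B₁} {b₂ : B₂} (ψ : x ⟶ (S.obj b₁).obj b₂) (s₁ : F₁.sec b₁) (s₂ : F₂.sec b₂) :
    a.homAux F₁ F₂ F₃ φ s₃ (cmk ψ s₁ s₂) =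
      cmk (φ ≫ (T.map ψ).app b₃ ≫ (a.iso b₁ b₂ b₃).hom) s₁ (cmk (𝟙 _) s₂ s₃) := by
  rw [homAux, clift_cmk]

lemma homAux_add_hom {e : E} {x : B₁₂} {b₃ : B₃} (φ φ' : e ⟶ (T.obj x).obj b₃)
    (P : (conv S F₁ F₂).sec x) (s₃ : F₃.sec b₃) :
    a.homAux F₁ F₂ F₃ (φ + φ') s₃ P = a.homAux F₁ F₂ F₃ φ s₃ P + a.homAux F₁ F₂ F₃ φ' s₃ P := by
  induction P using cind with
  | h_mk ψ s t => simp
  | h_zero => simp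
  | h_add x y hx hy => simp only [map_add, hx, hy]; abel

lemma homAux_smul_hom {e : E} {x : B₁₂} {b₃ : B₃} (r : K) (φ : e ⟶ (T.obj x).obj b₃)
    (P : (conv S F₁ F₂).sec x) (s₃ : F₃.sec b₃) :
    a.homAux F₁ F₂ F₃ (r • φ) s₃ P = r • a.homAux F₁ F₂ F₃ φ s₃ P := by
  induction P using cind with
  | h_mk ψ s t => simp
  | h_zero => simp
  | h_add x y hx hy => simp only [map_add, hx, hy, smul_add]

lemma homAux_add_right {e : E} {x : B₁₂} {b₃ : B₃} (φ : e ⟶ (T.obj x).obj b₃)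
    (P : (conv S F₁ F₂).sec x) (s₃ s₃' : F₃.sec b₃) :
    a.homAux F₁ F₂ F₃ φ (s₃ + s₃') P =
      a.homAux F₁ F₂ F₃ φ s₃ P + a.homAux F₁ F₂ F₃ φ s₃' P := by
  induction P using cind with
  | h_mk ψ s t => simp
  | h_zero => simp
  | h_add x y hx hy => simp only [map_add, hx, hy]; abel

lemma homAux_smul_right {e : E} {x : B₁₂} {b₃ : B₃} (r : K) (φ : e ⟶ (T.obj x).obj b₃)
    (P : (conv S F₁ F₂).sec x) (s₃ : F₃.sec b₃) :
    a.homAux F₁ F₂ F₃ φ (r • s₃) P = r • a.homAux F₁ F₂ F₃ φ s₃ P := by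
  induction P using cind with
  | h_mk ψ s t => simp
  | h_zero => simp
  | h_add x y hx hy => simp only [map_add, hx, hy, smul_add]

lemma homAux_left {e : E} {x x' : B₁₂} {b₃ : B₃} (g : x ⟶ x') (φ : e ⟶ (T.obj x).obj b₃)
    (P : (conv S F₁ F₂).sec x') (s₃ : F₃.sec b₃) :
    a.homAux F₁ F₂ F₃ (φ ≫ (T.map g).app b₃) s₃ P =
      a.homAux F₁ F₂ F₃ φ s₃ ((conv S F₁ F₂).res g P) := by
  induction P using cind with
  | h_mk ψ s t => simp
  | h_zero => simp
  | h_add x y hx hy => simp only [map_add, hx, hy]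

lemma homAux_right {e : E} {x : B₁₂} {b₃ b₃' : B₃} (g : b₃ ⟶ b₃') (φ : e ⟶ (T.obj x).obj b₃)
    (P : (conv S F₁ F₂).sec x) (s₃ : F₃.sec b₃') :
    a.homAux F₁ F₂ F₃ (φ ≫ (T.obj x).map g) s₃ P =
      a.homAux F₁ F₂ F₃ φ (F₃.res g s₃) P := by
  induction P using cind with
  | @h_mk b₁ b₂ ψ s t =>
    have h : cmk (T := U) (𝟙 _) t (F₃.res g s₃) =
      (conv U F₂ F₃).res ((U.obj b₂).map g) (cmk (𝟙 _) t s₃) := by simp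
    rw [homAux_cmk, homAux_cmk, h, cmk_res_right]
    simp [← a.nat₃]
  | h_zero => simp
  | h_add x y hx hy => simp only [map_add, hx, hy]

lemma homAux_res {e e' : E} {x : B₁₂} {b₃ : B₃} (h : e ⟶ e') (φ : e' ⟶ (T.obj x).obj b₃)
    (P : (conv S F₁ F₂).sec x) (s₃ : F₃.sec b₃) :
    a.homAux F₁ F₂ F₃ (h ≫ φ) s₃ P =
      (conv V F₁ (conv U F₂ F₃)).res h (a.homAux F₁ F₂ F₃ φ s₃ P) := by
  induction P using cind with
  | h_mk ψ s t => simp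
  | h_zero => simp
  | h_add x y hx hy => simp only [map_add, hx, hy]

/-- The map `(F₁ ⊛ F₂) ⊛ F₃ ⟶ F₁ ⊛ (F₂ ⊛ F₃)`. -/
noncomputable def hom : conv T (conv S F₁ F₂) F₃ ⟶ conv V F₁ (conv U F₂ F₃) :=
  desc (fun _ =>
    { f := fun φ P s₃ => a.homAux F₁ F₂ F₃ φ s₃ P
      add_hom := fun φ φ' P s₃ => a.homAux_add_hom F₁ F₂ F₃ φ φ' P s₃
      smul_hom := fun r φ P s₃ => a.homAux_smul_hom F₁ F₂ F₃ r φ P s₃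
      add_right := fun φ P s₃ s₃' => a.homAux_add_right F₁ F₂ F₃ φ P s₃ s₃'
      smul_right := fun r φ P s₃ => a.homAux_smul_right F₁ F₂ F₃ r φ P s₃
      dinat_left := fun g φ P s₃ => a.homAux_left F₁ F₂ F₃ g φ P s₃
      dinat_right := fun g φ P s₃ => a.homAux_right F₁ F₂ F₃ g φ P s₃ })
    (fun h _ _ φ P s₃ => a.homAux_res F₁ F₂ F₃ h φ P s₃)

@[simp] lemma app_hom {e : E} {x : B₁₂} {b₃ : B₃} (φ : e ⟶ (T.obj x).obj b₃)
    {b₁ : B₁} {b₂ : B₂} (ψ : x ⟶ (S.obj b₁).obj b₂) (s₁ : F₁.sec b₁) (s₂ : F₂.sec b₂)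
    (s₃ : F₃.sec b₃) :
    app (a.hom F₁ F₂ F₃) e (cmk φ (cmk ψ s₁ s₂) s₃) =
      cmk (φ ≫ (T.map ψ).app b₃ ≫ (a.iso b₁ b₂ b₃).hom) s₁ (cmk (𝟙 _) s₂ s₃) := by
  rw [hom, app_desc]
  exact a.homAux_cmk F₁ F₂ F₃ φ s₃ ψ s₁ s₂

end

section

variable [IsBilinear K V]

/-- Auxiliary map for `Assoc.inv`: the morphism `φ` and the first section are fixed. -/
noncomputable def invAux {e : E} {b₁ : B₁} {x : B₂₃} (φ : e ⟶ (V.obj b₁).obj x) (s₁ : F₁.sec b₁) :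
    (conv U F₂ F₃).sec x →ₗ[K] (conv T (conv S F₁ F₂) F₃).sec e :=
  clift
    { f := fun {b₂ b₃} ψ s₂ s₃ => cmk (φ ≫ (V.obj b₁).map ψ ≫ (a.iso b₁ b₂ b₃).inv)
        (cmk (𝟙 _) s₁ s₂) s₃
      add_hom := by simp [IsBilinear.map_add_right (K := K)]
      smul_hom := by simp [IsBilinear.map_smul_right (K := K)]
      dinat_left := fun g ψ s t => by
        have h : cmk (T := S) (𝟙 _) s₁ (F₂.res g s) =
          (conv S F₁ F₂).res ((S.obj b₁).map g) (cmk (𝟙 _) s₁ s) := by simp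
        rw [h, cmk_res_left]
        simp [a.inv_nat₂]
      dinat_right := by simp [a.inv_nat₃] }

@[simp] lemma invAux_cmk {e : E} {b₁ : B₁} {x : B₂₃} (φ : e ⟶ (V.obj b₁).obj x) (s₁ : F₁.sec b₁)
    {b₂ : B₂} {b₃ : B₃} (ψ : x ⟶ (U.obj b₂).obj b₃) (s₂ : F₂.sec b₂) (s₃ : F₃.sec b₃) :
    a.invAux F₁ F₂ F₃ φ s₁ (cmk ψ s₂ s₃) =
      cmk (φ ≫ (V.obj b₁).map ψ ≫ (a.iso b₁ b₂ b₃).inv) (cmk (𝟙 _) s₁ s₂) s₃ := by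
  rw [invAux, clift_cmk]

lemma invAux_add_hom {e : E} {b₁ : B₁} {x : B₂₃} (φ φ' : e ⟶ (V.obj b₁).obj x)
    (s₁ : F₁.sec b₁) (P : (conv U F₂ F₃).sec x) :
    a.invAux F₁ F₂ F₃ (φ + φ') s₁ P = a.invAux F₁ F₂ F₃ φ s₁ P + a.invAux F₁ F₂ F₃ φ' s₁ P := by
  induction P using cind with
  | h_mk ψ s t => simp
  | h_zero => simp
  | h_add x y hx hy => simp only [map_add, hx, hy]; abel

lemma invAux_smul_hom {e : E} {b₁ : B₁} {x : B₂₃} (r : K) (φ : e ⟶ (V.obj b₁).obj x)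
    (s₁ : F₁.sec b₁) (P : (conv U F₂ F₃).sec x) :
    a.invAux F₁ F₂ F₃ (r • φ) s₁ P = r • a.invAux F₁ F₂ F₃ φ s₁ P := by
  induction P using cind with
  | h_mk ψ s t => simp
  | h_zero => simp
  | h_add x y hx hy => simp only [map_add, hx, hy, smul_add]

lemma invAux_add_left {e : E} {b₁ : B₁} {x : B₂₃} (φ : e ⟶ (V.obj b₁).obj x)
    (s₁ s₁' : F₁.sec b₁) (P : (conv U F₂ F₃).sec x) :
    a.invAux F₁ F₂ F₃ φ (s₁ + s₁') P =
      a.invAux F₁ F₂ F₃ φ s₁ P + a.invAux F₁ F₂ F₃ φ s₁' P := by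
  induction P using cind with
  | h_mk ψ s t => simp
  | h_zero => simp
  | h_add x y hx hy => simp only [map_add, hx, hy]; abel

lemma invAux_smul_left {e : E} {b₁ : B₁} {x : B₂₃} (r : K) (φ : e ⟶ (V.obj b₁).obj x)
    (s₁ : F₁.sec b₁) (P : (conv U F₂ F₃).sec x) :
    a.invAux F₁ F₂ F₃ φ (r • s₁) P = r • a.invAux F₁ F₂ F₃ φ s₁ P := by
  induction P using cind with
  | h_mk ψ s t => simp
  | h_zero => simp
  | h_add x y hx hy => simp only [map_add, hx, hy, smul_add]

lemma invAux_left {e : E} {b₁ b₁' : B₁} {x : B₂₃} (g : b₁ ⟶ b₁') (φ : e ⟶ (V.obj b₁).obj x)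
    (s₁ : F₁.sec b₁') (P : (conv U F₂ F₃).sec x) :
    a.invAux F₁ F₂ F₃ (φ ≫ (V.map g).app x) s₁ P =
      a.invAux F₁ F₂ F₃ φ (F₁.res g s₁) P := by
  induction P using cind with
  | @h_mk b₂ b₃ ψ s t =>
    have h : cmk (T := S) (𝟙 _) (F₁.res g s₁) s =
      (conv S F₁ F₂).res ((S.map g).app b₂) (cmk (𝟙 _) s₁ s) := by simp
    rw [invAux_cmk, invAux_cmk, h, cmk_res_left]
    simp [← a.inv_nat₁]
  | h_zero => simp
  | h_add x y hx hy => simp only [map_add, hx, hy]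

lemma invAux_right {e : E} {b₁ : B₁} {x x' : B₂₃} (g : x ⟶ x') (φ : e ⟶ (V.obj b₁).obj x)
    (s₁ : F₁.sec b₁) (P : (conv U F₂ F₃).sec x') :
    a.invAux F₁ F₂ F₃ (φ ≫ (V.obj b₁).map g) s₁ P =
      a.invAux F₁ F₂ F₃ φ s₁ ((conv U F₂ F₃).res g P) := by
  induction P using cind with
  | h_mk ψ s t => simp
  | h_zero => simp
  | h_add x y hx hy => simp only [map_add, hx, hy]

lemma invAux_res {e e' : E} {b₁ : B₁} {x : B₂₃} (h : e ⟶ e') (φ : e' ⟶ (V.obj b₁).obj x)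
    (s₁ : F₁.sec b₁) (P : (conv U F₂ F₃).sec x) :
    a.invAux F₁ F₂ F₃ (h ≫ φ) s₁ P =
      (conv T (conv S F₁ F₂) F₃).res h (a.invAux F₁ F₂ F₃ φ s₁ P) := by
  induction P using cind with
  | h_mk ψ s t => simp
  | h_zero => simp
  | h_add x y hx hy => simp only [map_add, hx, hy]

/-- The map `F₁ ⊛ (F₂ ⊛ F₃) ⟶ (F₁ ⊛ F₂) ⊛ F₃`. -/
noncomputable def inv : conv V F₁ (conv U F₂ F₃) ⟶ conv T (conv S F₁ F₂) F₃ :=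
  desc (fun _ =>
    { f := fun φ s₁ P => a.invAux F₁ F₂ F₃ φ s₁ P
      add_hom := fun φ φ' s₁ P => a.invAux_add_hom F₁ F₂ F₃ φ φ' s₁ P
      smul_hom := fun r φ s₁ P => a.invAux_smul_hom F₁ F₂ F₃ r φ s₁ P
      add_left := fun φ s₁ s₁' P => a.invAux_add_left F₁ F₂ F₃ φ s₁ s₁' P
      smul_left := fun r φ s₁ P => a.invAux_smul_left F₁ F₂ F₃ r φ s₁ P
      dinat_left := fun g φ s₁ P => a.invAux_left F₁ F₂ F₃ g φ s₁ P
      dinat_right := fun g φ s₁ P => a.invAux_right F₁ F₂ F₃ g φ s₁ P })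
    (fun h _ _ φ s₁ P => a.invAux_res F₁ F₂ F₃ h φ s₁ P)

@[simp] lemma app_inv {e : E} {b₁ : B₁} {x : B₂₃} (φ : e ⟶ (V.obj b₁).obj x)
    {b₂ : B₂} {b₃ : B₃} (ψ : x ⟶ (U.obj b₂).obj b₃) (s₁ : F₁.sec b₁) (s₂ : F₂.sec b₂)
    (s₃ : F₃.sec b₃) :
    app (a.inv F₁ F₂ F₃) e (cmk φ s₁ (cmk ψ s₂ s₃)) =
      cmk (φ ≫ (V.obj b₁).map ψ ≫ (a.iso b₁ b₂ b₃).inv) (cmk (𝟙 _) s₁ s₂) s₃ := by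
  rw [inv, app_desc]
  exact a.invAux_cmk F₁ F₂ F₃ φ s₁ ψ s₂ s₃

end

lemma ext_left {H : FreeCocompletion K E} {η θ : conv T (conv S F₁ F₂) F₃ ⟶ H}
    (h : ∀ {e : E} {x : B₁₂} {b₃ : B₃} (φ : e ⟶ (T.obj x).obj b₃)
      {b₁ : B₁} {b₂ : B₂} (ψ : x ⟶ (S.obj b₁).obj b₂) (s₁ : F₁.sec b₁) (s₂ : F₂.sec b₂)
      (s₃ : F₃.sec b₃), app η e (cmk φ (cmk ψ s₁ s₂) s₃) = app θ e (cmk φ (cmk ψ s₁ s₂) s₃)) :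
    η = θ := by
  apply conv_hom_ext
  intro d b c φ P s₃
  induction P using cind with
  | h_mk ψ s t => exact h _ _ _ _ _
  | h_zero => simp
  | h_add x y hx hy => simp only [cmk_add_left, map_add, hx, hy]

lemma ext_right {H : FreeCocompletion K E} {η θ : conv V F₁ (conv U F₂ F₃) ⟶ H}
    (h : ∀ {e : E} {b₁ : B₁} {x : B₂₃} (φ : e ⟶ (V.obj b₁).obj x)
      {b₂ : B₂} {b₃ : B₃} (ψ : x ⟶ (U.obj b₂).obj b₃) (s₁ : F₁.sec b₁) (s₂ : F₂.sec b₂)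
      (s₃ : F₃.sec b₃), app η e (cmk φ s₁ (cmk ψ s₂ s₃)) = app θ e (cmk φ s₁ (cmk ψ s₂ s₃))) :
    η = θ := by
  apply conv_hom_ext
  intro d b c φ s₁ P
  induction P using cind with
  | h_mk ψ s t => exact h _ _ _ _ _
  | h_zero => simp
  | h_add x y hx hy => simp only [cmk_add_right, map_add, hx, hy]

end Assoc

section

variable {S : B₁ ⥤ B₂ ⥤ B₁₂} {T : B₁₂ ⥤ B₃ ⥤ E} {U : B₂ ⥤ B₃ ⥤ B₂₃} {V : B₁ ⥤ B₂₃ ⥤ E}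
variable [Preadditive B₁] [Preadditive B₂] [Preadditive B₃] [Preadditive B₁₂] [Preadditive B₂₃]
variable [Preadditive E] [Linear K B₁] [Linear K B₂] [Linear K B₃] [Linear K B₁₂] [Linear K B₂₃]
variable [Linear K E]
variable {F₁ : FreeCocompletion K B₁} {F₂ : FreeCocompletion K B₂} {F₃ : FreeCocompletion K B₃}

lemma cmk_cmk_right {e : E} {b₁ : B₁} {x : B₂₃} (φ : e ⟶ (V.obj b₁).obj x) {b₂ : B₂} {b₃ : B₃}
    (ψ : x ⟶ (U.obj b₂).obj b₃) (s₁ : F₁.sec b₁) (s₂ : F₂.sec b₂) (s₃ : F₃.sec b₃) :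
    cmk φ s₁ (cmk ψ s₂ s₃) = cmk (φ ≫ (V.obj b₁).map ψ) s₁ (cmk (T := U) (𝟙 _) s₂ s₃) := by
  rw [← cmk_res_right, res_cmk, Category.comp_id]

lemma cmk_cmk_left {e : E} {x : B₁₂} {b₃ : B₃} (φ : e ⟶ (T.obj x).obj b₃) {b₁ : B₁} {b₂ : B₂}
    (ψ : x ⟶ (S.obj b₁).obj b₂) (s₁ : F₁.sec b₁) (s₂ : F₂.sec b₂) (s₃ : F₃.sec b₃) :
    cmk φ (cmk ψ s₁ s₂) s₃ = cmk (φ ≫ (T.map ψ).app b₃) (cmk (T := S) (𝟙 _) s₁ s₂) s₃ := by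
  rw [← cmk_res_left, res_cmk, Category.comp_id]

end

namespace Assoc

variable {S : B₁ ⥤ B₂ ⥤ B₁₂} {T : B₁₂ ⥤ B₃ ⥤ E} {U : B₂ ⥤ B₃ ⥤ B₂₃} {V : B₁ ⥤ B₂₃ ⥤ E}
variable [Preadditive B₁] [Preadditive B₂] [Preadditive B₃] [Preadditive B₁₂] [Preadditive B₂₃]
variable [Preadditive E] [Linear K B₁] [Linear K B₂] [Linear K B₃] [Linear K B₁₂] [Linear K B₂₃]
variable [Linear K E] [IsBilinear K T] [IsBilinear K V]
variable (a : Assoc S T U V)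
variable (F₁ : FreeCocompletion K B₁) (F₂ : FreeCocompletion K B₂) (F₃ : FreeCocompletion K B₃)

/-- The associativity isomorphism `(F₁ ⊛ F₂) ⊛ F₃ ≅ F₁ ⊛ (F₂ ⊛ F₃)` induced by a natural
isomorphism `T(S(b₁,b₂),b₃) ≅ V(b₁,U(b₂,b₃))`. -/
noncomputable def convIso : conv T (conv S F₁ F₂) F₃ ≅ conv V F₁ (conv U F₂ F₃) where
  hom := a.hom F₁ F₂ F₃
  inv := a.inv F₁ F₂ F₃
  hom_inv_id := by
    apply ext_left
    intro e x b₃ φ b₁ b₂ ψ s₁ s₂ s₃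
    rw [app_comp, app_hom, app_inv, cmk_cmk_left φ ψ]
    simp
  inv_hom_id := by
    apply ext_right
    intro e b₁ x φ b₂ b₃ ψ s₁ s₂ s₃
    rw [app_comp, app_inv, app_hom, cmk_cmk_right φ ψ]
    simp

@[simp] lemma convIso_hom : (a.convIso F₁ F₂ F₃).hom = a.hom F₁ F₂ F₃ := rfl

@[simp] lemma convIso_inv : (a.convIso F₁ F₂ F₃).inv = a.inv F₁ F₂ F₃ := rfl

lemma hom_naturality {F₁' : FreeCocompletion K B₁} {F₂' : FreeCocompletion K B₂}
    {F₃' : FreeCocompletion K B₃} (η₁ : F₁ ⟶ F₁') (η₂ : F₂ ⟶ F₂') (η₃ : F₃ ⟶ F₃') :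
    map T (map S η₁ η₂) η₃ ≫ a.hom F₁' F₂' F₃' = a.hom F₁ F₂ F₃ ≫ map V η₁ (map U η₂ η₃) := by
  apply ext_left
  intros
  simp

end Assoc

end Associators

end Day

/-! ### Linear modules over a linear monoidal category -/

open MonoidalLeftAction MonoidalRightAction

/-- A right action of a monoidal category on a category is `K`-linear if the action bifunctor is
`K`-linear in each variable. -/
class LinearRightAction (K : Type*) [Field K] (A X : Type*) [Category* A] [Category* X]
    [Preadditive A] [Preadditive X] [Linear K A] [Linear K X] [MonoidalCategory A]
    [MonoidalRightAction A X] : Prop where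
  add_left : ∀ {x x' : X} (f g : x ⟶ x') (a : A), (f + g) ⊵ᵣ a = f ⊵ᵣ a + g ⊵ᵣ a
  smul_left : ∀ {x x' : X} (r : K) (f : x ⟶ x') (a : A), (r • f) ⊵ᵣ a = r • f ⊵ᵣ a
  add_right : ∀ (x : X) {a a' : A} (f g : a ⟶ a'), x ⊴ᵣ (f + g) = x ⊴ᵣ f + x ⊴ᵣ g
  smul_right : ∀ (x : X) {a a' : A} (r : K) (f : a ⟶ a'), x ⊴ᵣ (r • f) = r • x ⊴ᵣ f

/-- A left action of a monoidal category on a category is `K`-linear if the action bifunctor is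
`K`-linear in each variable. -/
class LinearLeftAction (K : Type*) [Field K] (A Y : Type*) [Category* A] [Category* Y]
    [Preadditive A] [Preadditive Y] [Linear K A] [Linear K Y] [MonoidalCategory A]
    [MonoidalLeftAction A Y] : Prop where
  add_left : ∀ {a a' : A} (f g : a ⟶ a') (y : Y), (f + g) ⊵ₗ y = f ⊵ₗ y + g ⊵ₗ y
  smul_left : ∀ {a a' : A} (r : K) (f : a ⟶ a') (y : Y), (r • f) ⊵ₗ y = r • f ⊵ₗ y
  add_right : ∀ (a : A) {y y' : Y} (f g : y ⟶ y'), a ⊴ₗ (f + g) = a ⊴ₗ f + a ⊴ₗ g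
  smul_right : ∀ (a : A) {y y' : Y} (r : K) (f : y ⟶ y'), a ⊴ₗ (r • f) = r • a ⊴ₗ f

/-- The bifunctor `(x, a) ↦ x ◁ a` of a right action. -/
@[simps]
def rightActionBifunctor (A X : Type*) [Category* A] [Category* X] [MonoidalCategory A]
    [MonoidalRightAction A X] : X ⥤ A ⥤ X where
  obj x := { obj := fun a => x ⊙ᵣ a, map := fun f => x ⊴ᵣ f }
  map f := { app := fun a => f ⊵ᵣ a, naturality := fun _ _ g => action_exchange _ _ }

/-- The bifunctor `(a, y) ↦ a ▷ y` of a left action. -/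
@[simps]
def leftActionBifunctor (A Y : Type*) [Category* A] [Category* Y] [MonoidalCategory A]
    [MonoidalLeftAction A Y] : A ⥤ Y ⥤ Y where
  obj a := { obj := fun y => a ⊙ₗ y, map := fun f => a ⊴ₗ f }
  map f := { app := fun y => f ⊵ₗ y, naturality := fun _ _ g => by simp [MonoidalLeftAction.action_exchange] }

section BaseCoherence

variable {A X Y : Type*} [Category* A] [Category* X] [Category* Y] [MonoidalCategory A]
variable [MonoidalRightAction A X] [MonoidalLeftAction A Y]

lemma right_pentagon_inv (x : X) (a b c : A) :
    (αᵣ x a b).inv ⊵ᵣ c ≫ (αᵣ x (a ⊗ b) c).inv ≫ x ⊴ᵣ (α_ a b c).hom =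
      (αᵣ (x ⊙ᵣ a) b c).inv ≫ (αᵣ x a (b ⊗ c)).inv := by
  rw [← cancel_mono (αᵣ x a (b ⊗ c)).hom, ← cancel_mono (αᵣ (x ⊙ᵣ a) b c).hom]
  simp only [Category.assoc]
  rw [MonoidalRightAction.actionHom_associator, Iso.inv_hom_id_assoc, Iso.inv_hom_id_assoc,
    Iso.inv_hom_id]
  simp

lemma right_pentagon_aux {e x b₁ c₁ : X} {c₂ b₂ b₃ : A} (φ : e ⟶ x ⊙ᵣ b₃) (ψ : x ⟶ b₁ ⊙ᵣ b₂)
    (χ : b₁ ⟶ c₁ ⊙ᵣ c₂) :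
    (φ ≫ (ψ ≫ χ ⊵ᵣ b₂ ≫ (αᵣ c₁ c₂ b₂).inv) ⊵ᵣ b₃ ≫ (αᵣ c₁ (c₂ ⊗ b₂) b₃).inv) ≫
      c₁ ⊴ᵣ (𝟙 ((c₂ ⊗ b₂) ⊗ b₃) ≫ (𝟙 (c₂ ⊗ b₂)) ▷ b₃ ≫ (α_ c₂ b₂ b₃).hom) =
      (φ ≫ ψ ⊵ᵣ b₃ ≫ (αᵣ b₁ b₂ b₃).inv) ≫ χ ⊵ᵣ (b₂ ⊗ b₃) ≫ (αᵣ c₁ c₂ (b₂ ⊗ b₃)).inv := by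
  simp [right_pentagon_inv]

lemma right_leftUnitor_aux {e x b₁ : X} {b₂ b₃ : A} (φ : e ⟶ x ⊙ᵣ b₃) (ψ : x ⟶ b₁ ⊙ᵣ b₂)
    (s : b₂ ⟶ 𝟙_ A) :
    (φ ≫ ψ ⊵ᵣ b₃ ≫ (αᵣ b₁ b₂ b₃).inv) ≫ b₁ ⊴ᵣ (𝟙 (b₂ ⊗ b₃) ≫ s ▷ b₃ ≫ (λ_ b₃).hom) =
      φ ≫ (ψ ≫ b₁ ⊴ᵣ s ≫ (ρᵣ b₁).hom) ⊵ᵣ b₃ := by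
  simp

lemma right_rightUnitor_aux {e x b₁ : X} {b₂ b₃ : A} (φ : e ⟶ x ⊙ᵣ b₃) (ψ : x ⟶ b₁ ⊙ᵣ b₂)
    (s : b₃ ⟶ 𝟙_ A) :
    (φ ≫ ψ ⊵ᵣ b₃ ≫ (αᵣ b₁ b₂ b₃).inv) ≫ b₁ ⊴ᵣ (𝟙 (b₂ ⊗ b₃) ≫ b₂ ◁ s ≫ (ρ_ b₂).hom) =
      (φ ≫ x ⊴ᵣ s ≫ (ρᵣ x).hom) ≫ ψ := by
  have h := MonoidalRightAction.action_exchange_assoc ψ s (ρᵣ (b₁ ⊙ᵣ b₂)).hom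
  rw [← MonoidalRightAction.actionUnitIso_hom_naturality] at h
  simp [h]

lemma left_pentagon_aux {e b₃ : Y} {x b₁ c₁ c₂ b₂ : A} (φ : e ⟶ x ⊙ₗ b₃) (ψ : x ⟶ b₁ ⊗ b₂)
    (χ : b₁ ⟶ c₁ ⊗ c₂) :
    (φ ≫ (ψ ≫ χ ▷ b₂ ≫ (α_ c₁ c₂ b₂).hom) ⊵ₗ b₃ ≫ (αₗ c₁ (c₂ ⊗ b₂) b₃).hom) ≫
      c₁ ⊴ₗ (𝟙 ((c₂ ⊗ b₂) ⊙ₗ b₃) ≫ (𝟙 (c₂ ⊗ b₂)) ⊵ₗ b₃ ≫ (αₗ c₂ b₂ b₃).hom) =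
      (φ ≫ ψ ⊵ₗ b₃ ≫ (αₗ b₁ b₂ b₃).hom) ≫ χ ⊵ₗ (b₂ ⊙ₗ b₃) ≫ (αₗ c₁ c₂ (b₂ ⊙ₗ b₃)).hom := by
  simp

lemma left_leftUnitor_aux {e b₃ : Y} {x b₁ b₂ : A} (φ : e ⟶ x ⊙ₗ b₃) (ψ : x ⟶ b₁ ⊗ b₂)
    (s : b₁ ⟶ 𝟙_ A) :
    φ ≫ (ψ ≫ s ▷ b₂ ≫ (λ_ b₂).hom) ⊵ₗ b₃ =
      (φ ≫ ψ ⊵ₗ b₃ ≫ (αₗ b₁ b₂ b₃).hom) ≫ s ⊵ₗ (b₂ ⊙ₗ b₃) ≫ (λₗ (b₂ ⊙ₗ b₃)).hom := by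
  simp

lemma left_rightUnitor_aux {e b₃ : Y} {x b₁ b₂ : A} (φ : e ⟶ x ⊙ₗ b₃) (ψ : x ⟶ b₁ ⊗ b₂)
    (s : b₂ ⟶ 𝟙_ A) :
    φ ≫ (ψ ≫ b₁ ◁ s ≫ (ρ_ b₁).hom) ⊵ₗ b₃ =
      (φ ≫ ψ ⊵ₗ b₃ ≫ (αₗ b₁ b₂ b₃).hom) ≫
        b₁ ⊴ₗ (𝟙 (b₂ ⊙ₗ b₃) ≫ s ⊵ₗ b₃ ≫ (λₗ b₃).hom) := by
  simp

end BaseCoherence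

section DayStructures

open FreeCocompletion Day

variable {K : Type u} [Field K]
variable {A X Y : Type u} [SmallCategory A] [SmallCategory X] [SmallCategory Y]
variable [Preadditive A] [Preadditive X] [Preadditive Y] [Linear K A] [Linear K X] [Linear K Y]
variable [MonoidalCategory A] [MonoidalPreadditive A] [MonoidalLinear K A]
variable [MonoidalRightAction A X] [LinearRightAction K A X]
variable [MonoidalLeftAction A Y] [LinearLeftAction K A Y]

instance : IsBilinear K (curriedTensor A) where
  map_add_left := by simp
  map_smul_left := by simp
  map_add_right := by simp
  map_smul_right := by simp

instance : IsBilinear K (rightActionBifunctor A X) where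
  map_add_left := LinearRightAction.add_left (K := K)
  map_smul_left := LinearRightAction.smul_left
  map_add_right := LinearRightAction.add_right (K := K)
  map_smul_right := LinearRightAction.smul_right

instance : IsBilinear K (leftActionBifunctor A Y) where
  map_add_left := LinearLeftAction.add_left (K := K)
  map_smul_left := LinearLeftAction.smul_left
  map_add_right := LinearLeftAction.add_right (K := K)
  map_smul_right := LinearLeftAction.smul_right

variable (A) in
/-- The associativity isomorphisms of the monoidal category. -/
def tensorAssoc : Assoc (curriedTensor A) (curriedTensor A) (curriedTensor A) (curriedTensor A) where
  iso a b c := α_ a b c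
  nat₁ := by simp
  nat₂ := by simp
  nat₃ := by simp

variable (A X) in
/-- The associativity isomorphisms of the right action. -/
def rightAssoc : Assoc (rightActionBifunctor A X) (rightActionBifunctor A X) (curriedTensor A)
    (rightActionBifunctor A X) where
  iso x a b := (αᵣ x a b).symm
  nat₁ {x x'} f a b := by
    change (f ⊵ᵣ a) ⊵ᵣ b ≫ (αᵣ x' a b).inv = (αᵣ x a b).inv ≫ f ⊵ᵣ (a ⊗ b)
    simp
  nat₂ x {a a'} f b := by
    change (x ⊴ᵣ f) ⊵ᵣ b ≫ (αᵣ x a' b).inv = (αᵣ x a b).inv ≫ x ⊴ᵣ (f ▷ b)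
    simp
  nat₃ x a {b b'} f := by
    change (x ⊙ᵣ a) ⊴ᵣ f ≫ (αᵣ x a b').inv = (αᵣ x a b).inv ≫ x ⊴ᵣ (a ◁ f)
    simp

variable (A Y) in
/-- The associativity isomorphisms of the left action. -/
def leftAssoc : Assoc (curriedTensor A) (leftActionBifunctor A Y) (leftActionBifunctor A Y)
    (leftActionBifunctor A Y) where
  iso a b y := αₗ a b y
  nat₁ {a a'} f b y := by
    change (f ▷ b) ⊵ₗ y ≫ (αₗ a' b y).hom = (αₗ a b y).hom ≫ f ⊵ₗ (b ⊙ₗ y)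
    simp
  nat₂ a {b b'} f y := by
    change (a ◁ f) ⊵ₗ y ≫ (αₗ a b' y).hom = (αₗ a b y).hom ≫ a ⊴ₗ (f ⊵ₗ y)
    simp
  nat₃ a b {y y'} f := by
    change (a ⊗ b) ⊴ₗ f ≫ (αₗ a b y').hom = (αₗ a b y).hom ≫ a ⊴ₗ (b ⊴ₗ f)
    simp

variable (A) in
/-- The left unit isomorphisms of the monoidal category. -/
def tensorLeftUnit : LeftUnit (curriedTensor A) (𝟙_ A) where
  iso a := λ_ a
  nat := by simp

variable (A) in
/-- The right unit isomorphisms of the monoidal category. -/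
def tensorRightUnit : RightUnit (curriedTensor A) (𝟙_ A) where
  iso a := ρ_ a
  nat := by simp

variable (A X) in
/-- The unit isomorphisms of the right action. -/
def rightActionUnit : RightUnit (rightActionBifunctor A X) (𝟙_ A) where
  iso x := ρᵣ x
  nat {x x'} f := by
    change f ⊵ᵣ (𝟙_ A) ≫ (ρᵣ x').hom = (ρᵣ x).hom ≫ f
    simp

variable (A Y) in
/-- The unit isomorphisms of the left action. -/
def leftActionUnit : LeftUnit (leftActionBifunctor A Y) (𝟙_ A) where
  iso y := λₗ y
  nat {y y'} f := by
    change (𝟙_ A) ⊴ₗ f ≫ (λₗ y').hom = (λₗ y).hom ≫ f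
    simp

/-- The Day convolution monoidal structure on the free cocompletion of a small `K`-linear monoidal
category. -/
noncomputable instance dayMonoidalCategoryStruct :
    MonoidalCategoryStruct (FreeCocompletion K A) where
  tensorObj F G := conv (curriedTensor A) F G
  whiskerLeft F _ _ η := map (curriedTensor A) (𝟙 F) η
  whiskerRight η G := map (curriedTensor A) η (𝟙 G)
  tensorHom η θ := map (curriedTensor A) η θ
  tensorUnit := rep K (𝟙_ A)
  associator F G H := (tensorAssoc A).convIso F G H
  leftUnitor F := leftUnit (curriedTensor A) (𝟙_ A) (tensorLeftUnit A) F
  rightUnitor F := rightUnit (curriedTensor A) (𝟙_ A) (tensorRightUnit A) F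

/-- Day convolution is a monoidal structure. -/
noncomputable instance dayMonoidalCategory : MonoidalCategory (FreeCocompletion K A) where
  tensorHom_def η θ := by
    change map _ η θ = map _ η (𝟙 _) ≫ map _ (𝟙 _) θ
    rw [← map_comp, Category.comp_id, Category.id_comp]
  id_tensorHom_id F G := map_id
  tensorHom_comp_tensorHom η₁ η₂ θ₁ θ₂ := (map_comp _ _ _ _).symm
  whiskerLeft_id F G := map_id
  id_whiskerRight F G := map_id
  associator_naturality η₁ η₂ η₃ := (tensorAssoc A).hom_naturality _ _ _ η₁ η₂ η₃
  leftUnitor_naturality {F G} η := by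
    change map _ (𝟙 _) η ≫ leftUnitHom _ _ (tensorLeftUnit A) G = leftUnitHom _ _ (tensorLeftUnit A) F ≫ η
    exact conv_hom_ext (by simp)
  rightUnitor_naturality {F G} η := by
    change map _ η (𝟙 _) ≫ rightUnitHom _ _ (tensorRightUnit A) G = rightUnitHom _ _ (tensorRightUnit A) F ≫ η
    exact conv_hom_ext (by simp)
  pentagon F G H L := by
    change map _ ((tensorAssoc A).hom F G H) (𝟙 L) ≫ (tensorAssoc A).hom F _ L ≫
      map _ (𝟙 F) ((tensorAssoc A).hom G H L) =
      (tensorAssoc A).hom _ H L ≫ (tensorAssoc A).hom F G _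
    apply Assoc.ext_left
    intro e x b₃ φ b₁ b₂ ψ P s₂ s₃
    induction P using cind with
    | h_mk χ s t =>
      simp only [app_comp, app_map_cmk, Assoc.app_hom, app_id]
      rw [cmk_cmk_right (s₁ := s)]
      congr 1
      simp [tensorAssoc]
    | h_zero => simp
    | h_add x y hx hy => simp only [cmk_add_left, map_add, hx, hy]
  triangle F G := by
    change (tensorAssoc A).hom F _ G ≫ map _ (𝟙 F) (leftUnitHom _ _ (tensorLeftUnit A) G) =
      map _ (rightUnitHom _ _ (tensorRightUnit A) F) (𝟙 G)
    apply Assoc.ext_left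
    intro e x b₃ φ b₁ b₂ ψ s₁ s₂ s₃
    simp only [app_comp, app_map_cmk, Assoc.app_hom, app_id, app_rightUnitHom, app_leftUnitHom,
      cmk_res_left, cmk_res_right]
    congr 1
    simp [tensorAssoc, tensorLeftUnit, tensorRightUnit]

/-- The right action of the free cocompletion of `A` on that of a right `A`-module `X`, by Day
convolution. -/
noncomputable instance dayRightActionStruct :
    MonoidalRightActionStruct (FreeCocompletion K A) (FreeCocompletion K X) where
  actionObj F G := conv (rightActionBifunctor A X) F G
  actionHomRight F _ _ η := map (rightActionBifunctor A X) (𝟙 F) η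
  actionHomLeft η G := map (rightActionBifunctor A X) η (𝟙 G)
  actionHom η θ := map (rightActionBifunctor A X) η θ
  actionAssocIso F G H := ((rightAssoc A X).convIso F G H).symm
  actionUnitIso F := rightUnit (rightActionBifunctor A X) (𝟙_ A) (rightActionUnit A X) F

lemma rightAssoc_pentagon (L : FreeCocompletion K X) (F G H : FreeCocompletion K A) :
    map _ ((rightAssoc A X).hom L F G) (𝟙 H) ≫ (rightAssoc A X).hom L (conv _ F G) H ≫
      map _ (𝟙 L) ((tensorAssoc A).hom F G H) =
    (rightAssoc A X).hom (conv _ L F) G H ≫ (rightAssoc A X).hom L F (conv _ G H) := by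
  apply Assoc.ext_left
  intro e x b₃ φ b₁ b₂ ψ P s₂ s₃
  induction P using cind with
  | @h_mk c₁ c₂ χ s t =>
    simp only [app_comp, app_map_cmk, Assoc.app_hom, app_id]
    rw [cmk_cmk_right (s₁ := s)]
    congr 1
    exact right_pentagon_aux φ ψ χ
  | h_zero => simp
  | h_add x y hx hy => simp only [cmk_add_left, map_add, hx, hy]

/-- Day convolution is a right action. -/
noncomputable instance dayRightAction :
    MonoidalRightAction (FreeCocompletion K A) (FreeCocompletion K X) where
  actionHom_def η θ := by
    change map _ η θ = map _ η (𝟙 _) ≫ map _ (𝟙 _) θ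
    rw [← map_comp, Category.comp_id, Category.id_comp]
  actionHomRight_id F G := map_id
  id_actionHomLeft F G := map_id
  actionHom_comp η₁ η₂ θ₁ θ₂ := map_comp _ _ _ _
  actionAssocIso_hom_naturality {F₁ F₂ G₁ G₂ H₁ H₂} η₁ η₂ η₃ := by
    change map _ η₁ (map _ η₂ η₃) ≫ ((rightAssoc A X).convIso F₂ G₂ H₂).inv =
      ((rightAssoc A X).convIso F₁ G₁ H₁).inv ≫ map _ (map _ η₁ η₂) η₃
    rw [Iso.comp_inv_eq, Category.assoc, Iso.eq_inv_comp]
    exact ((rightAssoc A X).hom_naturality _ _ _ η₁ η₂ η₃).symm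
  actionUnitIso_hom_naturality {F G} η := by
    change rightUnitHom _ _ (rightActionUnit A X) F ≫ η =
      map _ η (𝟙 _) ≫ rightUnitHom _ _ (rightActionUnit A X) G
    exact conv_hom_ext (by simp)
  actionHomRight_whiskerRight {G G'} η H F := by
    change map _ (𝟙 F) (map _ η (𝟙 H)) = ((rightAssoc A X).convIso F G H).inv ≫
      map _ (map _ (𝟙 F) η) (𝟙 H) ≫ ((rightAssoc A X).convIso F G' H).hom
    rw [Iso.eq_inv_comp]
    exact ((rightAssoc A X).hom_naturality _ _ _ (𝟙 F) η (𝟙 H)).symm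
  whiskerRight_actionHomLeft G {H H'} η F := by
    change map _ (𝟙 F) (map _ (𝟙 G) η) = ((rightAssoc A X).convIso F G H).inv ≫
      map _ (𝟙 (conv _ F G)) η ≫ ((rightAssoc A X).convIso F G H').hom
    rw [Iso.eq_inv_comp, ← map_id]
    exact ((rightAssoc A X).hom_naturality _ _ _ (𝟙 F) (𝟙 G) η).symm
  actionHom_associator F G H L := by
    change map _ (𝟙 L) ((tensorAssoc A).hom F G H) ≫
      ((rightAssoc A X).convIso L F (conv _ G H)).inv ≫
        ((rightAssoc A X).convIso (conv _ L F) G H).inv =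
      ((rightAssoc A X).convIso L (conv _ F G) H).inv ≫
        map _ ((rightAssoc A X).convIso L F G).inv (𝟙 H)
    rw [← Category.assoc, Iso.comp_inv_eq, Iso.comp_inv_eq, Category.assoc, Category.assoc,
      Iso.eq_inv_comp]
    have h := rightAssoc_pentagon (X := X) L F G H
    have h' : map (rightActionBifunctor A X) ((rightAssoc A X).convIso L F G).inv (𝟙 H) ≫
        map (rightActionBifunctor A X) ((rightAssoc A X).hom L F G) (𝟙 H) = 𝟙 _ := by
      rw [← map_comp, ← Assoc.convIso_hom, Iso.inv_hom_id, Category.comp_id, map_id]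
    rw [Assoc.convIso_hom, Assoc.convIso_hom, Assoc.convIso_hom, ← h, reassoc_of% h']
  actionHom_leftUnitor F G := by
    change map _ (𝟙 G) (leftUnitHom _ _ (tensorLeftUnit A) F) =
      ((rightAssoc A X).convIso G _ F).inv ≫
        map _ (rightUnitHom _ _ (rightActionUnit A X) G) (𝟙 F)
    rw [Iso.eq_inv_comp]
    apply Assoc.ext_left
    intro e x b₃ φ b₁ b₂ ψ s₁ s₂ s₃
    simp only [app_comp, app_map_cmk, Assoc.convIso_hom, Assoc.app_hom, app_id, app_rightUnitHom,
      app_leftUnitHom, cmk_res_left, cmk_res_right]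
    congr 1
    exact right_leftUnitor_aux φ ψ (toHom s₂)
  actionHom_rightUnitor F G := by
    change map _ (𝟙 G) (rightUnitHom _ _ (tensorRightUnit A) F) =
      ((rightAssoc A X).convIso G F _).inv ≫ rightUnitHom _ _ (rightActionUnit A X) _
    rw [Iso.eq_inv_comp]
    apply Assoc.ext_left
    intro e x b₃ φ b₁ b₂ ψ s₁ s₂ s₃
    simp only [app_comp, app_map_cmk, Assoc.convIso_hom, Assoc.app_hom, app_id, app_rightUnitHom,
      cmk_res_right, res_cmk]
    congr 1
    exact right_rightUnitor_aux φ ψ (toHom s₃)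

/-- The left action of the free cocompletion of `A` on that of a left `A`-module `Y`, by Day
convolution. -/
noncomputable instance dayLeftActionStruct :
    MonoidalLeftActionStruct (FreeCocompletion K A) (FreeCocompletion K Y) where
  actionObj F G := conv (leftActionBifunctor A Y) F G
  actionHomRight F _ _ η := map (leftActionBifunctor A Y) (𝟙 F) η
  actionHomLeft η G := map (leftActionBifunctor A Y) η (𝟙 G)
  actionHom η θ := map (leftActionBifunctor A Y) η θ
  actionAssocIso F G H := (leftAssoc A Y).convIso F G H
  actionUnitIso F := leftUnit (leftActionBifunctor A Y) (𝟙_ A) (leftActionUnit A Y) F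

/-- Day convolution is a left action. -/
noncomputable instance dayLeftAction :
    MonoidalLeftAction (FreeCocompletion K A) (FreeCocompletion K Y) where
  actionHom_def η θ := by
    change map _ η θ = map _ η (𝟙 _) ≫ map _ (𝟙 _) θ
    rw [← map_comp, Category.comp_id, Category.id_comp]
  actionHomRight_id F G := map_id
  id_actionHomLeft F G := map_id
  actionHom_comp η₁ η₂ θ₁ θ₂ := map_comp _ _ _ _
  actionAssocIso_hom_naturality η₁ η₂ η₃ := (leftAssoc A Y).hom_naturality _ _ _ η₁ η₂ η₃
  actionUnitIso_hom_naturality {F G} η := by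
    change leftUnitHom _ _ (leftActionUnit A Y) F ≫ η =
      map _ (𝟙 _) η ≫ leftUnitHom _ _ (leftActionUnit A Y) G
    exact conv_hom_ext (by simp)
  whiskerLeft_actionHomLeft F {G G'} η H := by
    change map _ (map _ (𝟙 F) η) (𝟙 H) = ((leftAssoc A Y).convIso F G H).hom ≫
      map _ (𝟙 F) (map _ η (𝟙 H)) ≫ ((leftAssoc A Y).convIso F G' H).inv
    rw [← Category.assoc, Iso.eq_comp_inv]
    exact (leftAssoc A Y).hom_naturality _ _ _ (𝟙 F) η (𝟙 H)
  whiskerRight_actionHomLeft {F F'} G η H := by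
    change map _ (map _ η (𝟙 G)) (𝟙 H) = ((leftAssoc A Y).convIso F G H).hom ≫
      map _ η (𝟙 (conv _ G H)) ≫ ((leftAssoc A Y).convIso F' G H).inv
    rw [← Category.assoc, Iso.eq_comp_inv, ← map_id]
    exact (leftAssoc A Y).hom_naturality _ _ _ η (𝟙 G) (𝟙 H)
  associator_actionHom F G H L := by
    change map _ ((tensorAssoc A).hom F G H) (𝟙 L) ≫ (leftAssoc A Y).hom F _ L ≫
      map _ (𝟙 F) ((leftAssoc A Y).hom G H L) =
      (leftAssoc A Y).hom _ H L ≫ (leftAssoc A Y).hom F G _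
    apply Assoc.ext_left
    intro e x b₃ φ b₁ b₂ ψ P s₂ s₃
    induction P using cind with
    | @h_mk c₁ c₂ χ s t =>
      simp only [app_comp, app_map_cmk, Assoc.app_hom, app_id]
      rw [cmk_cmk_right (s₁ := s)]
      congr 1
      exact left_pentagon_aux φ ψ χ
    | h_zero => simp
    | h_add x y hx hy => simp only [cmk_add_left, map_add, hx, hy]
  leftUnitor_actionHom F G := by
    change map _ (leftUnitHom _ _ (tensorLeftUnit A) F) (𝟙 G) =
      (leftAssoc A Y).hom _ F G ≫ leftUnitHom _ _ (leftActionUnit A Y) _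
    apply Assoc.ext_left
    intro e x b₃ φ b₁ b₂ ψ s₁ s₂ s₃
    simp only [app_comp, app_map_cmk, Assoc.app_hom, app_id, app_leftUnitHom,
      cmk_res_left, res_cmk, Category.comp_id]
    exact congrArg (fun χ => cmk χ s₂ s₃) (left_leftUnitor_aux φ ψ (toHom s₁))
  rightUnitor_actionHom F G := by
    change map _ (rightUnitHom _ _ (tensorRightUnit A) F) (𝟙 G) =
      (leftAssoc A Y).hom F _ G ≫ map _ (𝟙 F) (leftUnitHom _ _ (leftActionUnit A Y) G)
    apply Assoc.ext_left
    intro e x b₃ φ b₁ b₂ ψ s₁ s₂ s₃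
    simp only [app_comp, app_map_cmk, Assoc.app_hom, app_id, app_rightUnitHom, app_leftUnitHom,
      cmk_res_left, cmk_res_right]
    congr 1
    exact left_rightUnitor_aux φ ψ (toHom s₂)

end DayStructures

/-! ### The naive tensor product -/

/-- The objects of the naive tensor product `X ⊗_K Y`: pairs of objects. -/
structure NaiveTensor (K X Y : Type*) where
  /-- the first component -/
  fst : X
  /-- the second component -/
  snd : Y

namespace NaiveTensor

variable {K : Type u} [Field K] {X Y : Type u} [SmallCategory X] [SmallCategory Y]
variable [Preadditive X] [Preadditive Y] [Linear K X] [Linear K Y]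

/-- The morphisms of the naive tensor product. -/
abbrev Mor (p q : NaiveTensor K X Y) : Type u :=
  TensorProduct K (p.fst ⟶ q.fst) (p.snd ⟶ q.snd)

/-- The composition of the naive tensor product:
`(f ⊗ g) ≫ (f' ⊗ g') = (f ≫ f') ⊗ (g ≫ g')`. -/
noncomputable def compMap (p q r : NaiveTensor K X Y) : Mor p q →ₗ[K] Mor q r →ₗ[K] Mor p r :=
  TensorProduct.map₂ (Linear.comp p.fst q.fst r.fst) (Linear.comp p.snd q.snd r.snd)

@[simp] lemma compMap_tmul {p q r : NaiveTensor K X Y} (f : p.fst ⟶ q.fst) (g : p.snd ⟶ q.snd)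
    (f' : q.fst ⟶ r.fst) (g' : q.snd ⟶ r.snd) :
    compMap p q r (f ⊗ₜ[K] g) (f' ⊗ₜ[K] g') = (f ≫ f') ⊗ₜ[K] (g ≫ g') := by
  simp [compMap]

noncomputable instance category : SmallCategory (NaiveTensor K X Y) where
  Hom p q := Mor p q
  id p := 𝟙 p.fst ⊗ₜ[K] 𝟙 p.snd
  comp {p q r} f g := compMap p q r f g
  id_comp {p q} f := by
    induction f using TensorProduct.induction_on with
    | zero => simp
    | tmul f g => simp
    | add x y hx hy => rw [map_add, hx, hy]
  comp_id {p q} f := by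
    induction f using TensorProduct.induction_on with
    | zero => simp
    | tmul f g => simp
    | add x y hx hy => rw [map_add, LinearMap.add_apply, hx, hy]
  assoc {p q r s} f g h := by
    induction f using TensorProduct.induction_on with
    | zero => simp
    | add x y hx hy => simp only [map_add, LinearMap.add_apply, hx, hy]
    | tmul f₁ f₂ =>
      induction g using TensorProduct.induction_on with
      | zero => simp
      | add x y hx hy => simp only [map_add, LinearMap.add_apply, hx, hy]
      | tmul g₁ g₂ =>
        induction h using TensorProduct.induction_on with
        | zero => simp
        | add x y hx hy => simp only [map_add, hx, hy]
        | tmul h₁ h₂ => simp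

noncomputable instance (p q : NaiveTensor K X Y) : AddCommGroup (p ⟶ q) :=
  inferInstanceAs (AddCommGroup (Mor p q))

noncomputable instance (p q : NaiveTensor K X Y) : Module K (p ⟶ q) :=
  inferInstanceAs (Module K (Mor p q))

noncomputable instance preadditive : Preadditive (NaiveTensor K X Y) where
  add_comp p q r f f' g := by
    change compMap p q r (f + f') g = compMap p q r f g + compMap p q r f' g
    rw [map_add, LinearMap.add_apply]
  comp_add p q r f g g' := map_add (compMap p q r f) g g'

noncomputable instance linear : Linear K (NaiveTensor K X Y) where
  smul_comp p q r c f g := by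
    change compMap p q r (c • f) g = c • compMap p q r f g
    rw [map_smul, LinearMap.smul_apply]
  comp_smul p q r f c g := map_smul (compMap p q r f) c g

/-- The morphism `f ⊗ g` of the naive tensor product. -/
noncomputable def tmul {x x' : X} {y y' : Y} (f : x ⟶ x') (g : y ⟶ y') :
    (⟨x, y⟩ : NaiveTensor K X Y) ⟶ ⟨x', y'⟩ := f ⊗ₜ[K] g

end NaiveTensor

/-! ### The naive balanced tensor product -/

/-- The objects of the naive balanced tensor product `X ⊗_A Y`, which are those of `X ⊗_K Y`. -/
structure NaiveBalancedTensor (K A X Y : Type*) where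
  /-- the underlying object of the naive tensor product -/
  obj : NaiveTensor K X Y

section NaiveBalanced

variable (K : Type u) [Field K] (A X Y : Type u)
variable [SmallCategory A] [SmallCategory X] [SmallCategory Y]
variable [Preadditive X] [Preadditive Y] [Linear K X] [Linear K Y]
variable [MonoidalCategory A] [MonoidalRightAction A X] [MonoidalLeftAction A Y]

namespace NaiveBalancedTensor

/-- Formal expressions for the morphisms of the naive balanced tensor product: they are generated
under composition and linear combinations by the morphisms of `X ⊗_K Y` and by new morphisms
`(x ◁ a, y) → (x, a ▷ y)` and `(x, a ▷ y) → (x ◁ a, y)`. -/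
inductive Word : NaiveTensor K X Y → NaiveTensor K X Y → Type u
  | of {p q : NaiveTensor K X Y} (f : p ⟶ q) : Word p q
  | bal (x : X) (a : A) (y : Y) : Word ⟨x ⊙ᵣ a, y⟩ ⟨x, a ⊙ₗ y⟩
  | balInv (x : X) (a : A) (y : Y) : Word ⟨x, a ⊙ₗ y⟩ ⟨x ⊙ᵣ a, y⟩
  | comp {p q r : NaiveTensor K X Y} (f : Word p q) (g : Word q r) : Word p r
  | add {p q : NaiveTensor K X Y} (f g : Word p q) : Word p q
  | smul {p q : NaiveTensor K X Y} (c : K) (f : Word p q) : Word p q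

variable {K A X Y}

open Word NaiveTensor

/-- The relations between formal expressions: the laws of a `K`-linear category, linear
functoriality of the inclusion of `X ⊗_K Y`, and, for the new morphisms, invertibility,
naturality, the pentagon relation and the unit relation. -/
inductive Rel : ∀ {p q : NaiveTensor K X Y}, Word K A X Y p q → Word K A X Y p q → Prop
  -- equivalence relation
  | refl {p q} (f : Word K A X Y p q) : Rel f f
  | symm {p q} {f g : Word K A X Y p q} : Rel f g → Rel g f
  | trans {p q} {f g h : Word K A X Y p q} : Rel f g → Rel g h → Rel f h
  -- congruence
  | comp_congr {p q r} {f f' : Word K A X Y p q} {g g' : Word K A X Y q r} :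
      Rel f f' → Rel g g' → Rel (comp f g) (comp f' g')
  | add_congr {p q} {f f' g g' : Word K A X Y p q} :
      Rel f f' → Rel g g' → Rel (add f g) (add f' g')
  | smul_congr {p q} (c : K) {f f' : Word K A X Y p q} :
      Rel f f' → Rel (smul c f) (smul c f')
  -- category
  | id_comp {p q} (f : Word K A X Y p q) : Rel (comp (of (𝟙 p)) f) f
  | comp_id {p q} (f : Word K A X Y p q) : Rel (comp f (of (𝟙 q))) f
  | assoc {p q r s} (f : Word K A X Y p q) (g : Word K A X Y q r) (h : Word K A X Y r s) :
      Rel (comp (comp f g) h) (comp f (comp g h))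
  -- vector space of morphisms
  | add_assoc {p q} (f g h : Word K A X Y p q) : Rel (add (add f g) h) (add f (add g h))
  | add_comm {p q} (f g : Word K A X Y p q) : Rel (add f g) (add g f)
  | zero_add {p q} (f : Word K A X Y p q) : Rel (add (of 0) f) f
  | neg_add {p q} (f : Word K A X Y p q) : Rel (add (smul (-1) f) f) (of 0)
  | one_smul {p q} (f : Word K A X Y p q) : Rel (smul 1 f) f
  | mul_smul {p q} (c c' : K) (f : Word K A X Y p q) :
      Rel (smul (c * c') f) (smul c (smul c' f))
  | smul_add {p q} (c : K) (f g : Word K A X Y p q) :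
      Rel (smul c (add f g)) (add (smul c f) (smul c g))
  | add_smul {p q} (c c' : K) (f : Word K A X Y p q) :
      Rel (smul (c + c') f) (add (smul c f) (smul c' f))
  -- bilinearity of composition
  | add_comp {p q r} (f f' : Word K A X Y p q) (g : Word K A X Y q r) :
      Rel (comp (add f f') g) (add (comp f g) (comp f' g))
  | comp_add {p q r} (f : Word K A X Y p q) (g g' : Word K A X Y q r) :
      Rel (comp f (add g g')) (add (comp f g) (comp f g'))
  | smul_comp {p q r} (c : K) (f : Word K A X Y p q) (g : Word K A X Y q r) :
      Rel (comp (smul c f) g) (smul c (comp f g))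
  | comp_smul {p q r} (c : K) (f : Word K A X Y p q) (g : Word K A X Y q r) :
      Rel (comp f (smul c g)) (smul c (comp f g))
  -- the inclusion of `X ⊗_K Y` is a linear functor
  | of_comp {p q r : NaiveTensor K X Y} (f : p ⟶ q) (g : q ⟶ r) :
      Rel (of (f ≫ g)) (comp (of f) (of g))
  | of_add {p q : NaiveTensor K X Y} (f g : p ⟶ q) : Rel (of (f + g)) (add (of f) (of g))
  | of_smul {p q : NaiveTensor K X Y} (c : K) (f : p ⟶ q) : Rel (of (c • f)) (smul c (of f))
  -- the new morphisms are mutually inverse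
  | bal_balInv (x : X) (a : A) (y : Y) : Rel (comp (bal x a y) (balInv x a y)) (of (𝟙 _))
  | balInv_bal (x : X) (a : A) (y : Y) : Rel (comp (balInv x a y) (bal x a y)) (of (𝟙 _))
  -- naturality
  | bal_nat {x x' : X} {a a' : A} {y y' : Y} (f : x ⟶ x') (g : a ⟶ a') (h : y ⟶ y') :
      Rel (comp (of (tmul (f ⊙ᵣₘ g) h)) (bal x' a' y'))
        (comp (bal x a y) (of (tmul f (g ⊙ₗₘ h))))
  -- pentagon
  | pentagon (x : X) (a b : A) (y : Y) :
      Rel (comp (bal (x ⊙ᵣ a) b y) (bal x a (b ⊙ₗ y)))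
        (comp (of (tmul (αᵣ x a b).inv (𝟙 y)))
          (comp (bal x (a ⊗ b) y) (of (tmul (𝟙 x) (αₗ a b y).hom))))
  -- unit
  | unit (x : X) (y : Y) :
      Rel (comp (bal x (𝟙_ A) y) (of (tmul (𝟙 x) (λₗ y).hom))) (of (tmul (ρᵣ x).hom (𝟙 y)))

variable (K A X Y) in
/-- Formal expressions modulo the relations. -/
instance setoid (p q : NaiveTensor K X Y) : Setoid (Word K A X Y p q) where
  r := Rel
  iseqv := ⟨Rel.refl, Rel.symm, Rel.trans⟩

/-- The morphisms of the naive balanced tensor product. -/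
def Mor (p q : NaiveBalancedTensor K A X Y) : Type u :=
  _root_.Quotient (setoid K A X Y p.obj q.obj)

noncomputable instance category : SmallCategory (NaiveBalancedTensor K A X Y) where
  Hom p q := Mor p q
  id p := Quotient.mk (setoid K A X Y _ _) (of (𝟙 p.obj))
  comp f g := Quotient.map₂ comp (fun _ _ h _ _ h' => Rel.comp_congr h h') f g
  id_comp f := by
    induction f using Quotient.ind
    exact Quotient.sound (Rel.id_comp _)
  comp_id f := by
    induction f using Quotient.ind
    exact Quotient.sound (Rel.comp_id _)
  assoc f g h := by
    induction f using Quotient.ind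
    induction g using Quotient.ind
    induction h using Quotient.ind
    exact Quotient.sound (Rel.assoc _ _ _)

/-- The class of a formal expression. -/
def homMk {p q : NaiveBalancedTensor K A X Y} (f : Word K A X Y p.obj q.obj) : p ⟶ q :=
  Quotient.mk (setoid K A X Y _ _) f

lemma homMk_surjective {p q : NaiveBalancedTensor K A X Y} (f : p ⟶ q) :
    ∃ w, f = homMk w := by
  obtain ⟨w, rfl⟩ := Quotient.exists_rep f
  exact ⟨w, rfl⟩

lemma homMk_eq {p q : NaiveBalancedTensor K A X Y} {f g : Word K A X Y p.obj q.obj}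
    (h : Rel f g) : homMk f = homMk g := Quotient.sound h

/-- Addition of morphisms. -/
noncomputable instance (p q : NaiveBalancedTensor K A X Y) : Add (p ⟶ q) where
  add f g := Quotient.map₂ add (fun _ _ h _ _ h' => Rel.add_congr h h') f g

/-- The zero morphism. -/
noncomputable instance (p q : NaiveBalancedTensor K A X Y) : Zero (p ⟶ q) where
  zero := homMk (of 0)

/-- Negation of morphisms. -/
noncomputable instance (p q : NaiveBalancedTensor K A X Y) : Neg (p ⟶ q) where
  neg f := Quotient.map (smul (-1)) (fun _ _ h => Rel.smul_congr (-1) h) f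

noncomputable instance (p q : NaiveBalancedTensor K A X Y) : AddCommGroup (p ⟶ q) where
  add_assoc f g h := by
    obtain ⟨f, rfl⟩ := homMk_surjective f
    obtain ⟨g, rfl⟩ := homMk_surjective g
    obtain ⟨h, rfl⟩ := homMk_surjective h
    exact homMk_eq (Rel.add_assoc f g h)
  zero_add f := by
    obtain ⟨f, rfl⟩ := homMk_surjective f
    exact homMk_eq (Rel.zero_add f)
  add_zero f := by
    obtain ⟨f, rfl⟩ := homMk_surjective f
    exact homMk_eq ((Rel.add_comm _ _).trans (Rel.zero_add f))
  neg_add_cancel f := by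
    obtain ⟨f, rfl⟩ := homMk_surjective f
    exact homMk_eq (Rel.neg_add f)
  add_comm f g := by
    obtain ⟨f, rfl⟩ := homMk_surjective f
    obtain ⟨g, rfl⟩ := homMk_surjective g
    exact homMk_eq (Rel.add_comm f g)
  nsmul := nsmulRec
  zsmul := zsmulRec

lemma homMk_add {p q : NaiveBalancedTensor K A X Y} (f g : Word K A X Y p.obj q.obj) :
    homMk (add f g) = homMk f + homMk g := rfl

/-- Scalar multiplication of morphisms. -/
noncomputable instance (p q : NaiveBalancedTensor K A X Y) : SMul K (p ⟶ q) where
  smul c f := Quotient.map (smul c) (fun _ _ h => Rel.smul_congr c h) f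

lemma homMk_smul {p q : NaiveBalancedTensor K A X Y} (c : K) (f : Word K A X Y p.obj q.obj) :
    homMk (smul c f) = c • homMk f := rfl

protected lemma smul_add' {p q : NaiveBalancedTensor K A X Y} (c : K) (f g : p ⟶ q) :
    c • (f + g) = c • f + c • g := by
  obtain ⟨f, rfl⟩ := homMk_surjective f
  obtain ⟨g, rfl⟩ := homMk_surjective g
  exact homMk_eq (Rel.smul_add c f g)

protected lemma add_smul' {p q : NaiveBalancedTensor K A X Y} (c c' : K) (f : p ⟶ q) :
    (c + c') • f = c • f + c' • f := by
  obtain ⟨f, rfl⟩ := homMk_surjective f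
  exact homMk_eq (Rel.add_smul c c' f)

noncomputable instance (p q : NaiveBalancedTensor K A X Y) : Module K (p ⟶ q) where
  one_smul f := by
    obtain ⟨f, rfl⟩ := homMk_surjective f
    exact homMk_eq (Rel.one_smul f)
  mul_smul c c' f := by
    obtain ⟨f, rfl⟩ := homMk_surjective f
    exact homMk_eq (Rel.mul_smul c c' f)
  smul_zero c := by
    have h := NaiveBalancedTensor.smul_add' c (0 : p ⟶ q) 0
    rw [add_zero] at h
    exact left_eq_add.mp h
  zero_smul f := by
    have h := NaiveBalancedTensor.add_smul' (0 : K) 0 f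
    rw [add_zero] at h
    exact left_eq_add.mp h
  smul_add := NaiveBalancedTensor.smul_add'
  add_smul := NaiveBalancedTensor.add_smul'

noncomputable instance preadditive : Preadditive (NaiveBalancedTensor K A X Y) where
  add_comp _ _ _ f f' g := by
    obtain ⟨f, rfl⟩ := homMk_surjective f
    obtain ⟨f', rfl⟩ := homMk_surjective f'
    obtain ⟨g, rfl⟩ := homMk_surjective g
    exact homMk_eq (Rel.add_comp f f' g)
  comp_add _ _ _ f g g' := by
    obtain ⟨f, rfl⟩ := homMk_surjective f
    obtain ⟨g, rfl⟩ := homMk_surjective g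
    obtain ⟨g', rfl⟩ := homMk_surjective g'
    exact homMk_eq (Rel.comp_add f g g')

noncomputable instance linear : Linear K (NaiveBalancedTensor K A X Y) where
  smul_comp _ _ _ c f g := by
    obtain ⟨f, rfl⟩ := homMk_surjective f
    obtain ⟨g, rfl⟩ := homMk_surjective g
    exact homMk_eq (Rel.smul_comp c f g)
  comp_smul _ _ _ f c g := by
    obtain ⟨f, rfl⟩ := homMk_surjective f
    obtain ⟨g, rfl⟩ := homMk_surjective g
    exact homMk_eq (Rel.comp_smul c f g)

end NaiveBalancedTensor

end NaiveBalanced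

/-! ### Balanced tensor products of cocomplete categories -/

/-- The property of a functor between `K`-linear categories to be a 1-morphism of cocomplete
`K`-linear categories, that is, `K`-linear and cocontinuous. -/
def isLinearCocontinuous (K : Type u) [Field K] (W : Type v) [Category.{u} W] [Preadditive W]
    [Linear K W] (E : Type w) [Category.{u} E] [Preadditive E] [Linear K E] :
    ObjectProperty (W ⥤ E) := fun F =>
  (∀ ⦃x y : W⦄ (f g : x ⟶ y), F.map (f + g) = F.map f + F.map g) ∧
  (∀ ⦃x y : W⦄ (r : K) (f : x ⟶ y), F.map (r • f) = r • F.map f) ∧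
  PreservesColimits F

/-- The category of `K`-linear cocontinuous functors and natural transformations. -/
abbrev CocontFunctor (K : Type u) [Field K] (W : Type v) [Category.{u} W] [Preadditive W]
    [Linear K W] (E : Type w) [Category.{u} E] [Preadditive E] [Linear K E] :=
  (isLinearCocontinuous K W E).FullSubcategory

section Balanced

variable (K : Type u) [Field K]
variable (C : Type v₁) [Category.{u} C] [MonoidalCategory C]
variable (X : Type v₂) [Category.{u} X] [Preadditive X] [Linear K X] [MonoidalRightAction C X]
variable (Y : Type v₃) [Category.{u} Y] [Preadditive Y] [Linear K Y] [MonoidalLeftAction C Y]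
variable (E : Type w) [Category.{u} E] [Preadditive E] [Linear K E]

/-- A `C`-balanced functor `P : X ⊠ Y → E`: a functor of two variables which is `K`-linear and
cocontinuous in each variable, with an isomorphism `P(x ◁ c, y) ≅ P(x, c ▷ y)` natural in `x`, `c`
and `y` and satisfying the pentagon and triangle equations. -/
structure BalancedFunctor where
  /-- the functor of two variables -/
  functor : X ⥤ Y ⥤ E
  bilinear : IsBilinear K functor
  cocont_left : ∀ y : Y, PreservesColimits (functor.flip.obj y)
  cocont_right : ∀ x : X, PreservesColimits (functor.obj x)
  /-- the balancing isomorphism -/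
  bal : ∀ (x : X) (c : C) (y : Y),
    (functor.obj (x ⊙ᵣ c)).obj y ≅ (functor.obj x).obj (c ⊙ₗ y)
  bal_nat : ∀ {x x' : X} {c c' : C} {y y' : Y} (f : x ⟶ x') (g : c ⟶ c') (h : y ⟶ y'),
    ((functor.map (f ⊙ᵣₘ g)).app y ≫ (functor.obj (x' ⊙ᵣ c')).map h) ≫ (bal x' c' y').hom =
      (bal x c y).hom ≫ (functor.map f).app (c ⊙ₗ y) ≫ (functor.obj x').map (g ⊙ₗₘ h)
  pentagon : ∀ (x : X) (c d : C) (y : Y),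
    (bal (x ⊙ᵣ c) d y).hom ≫ (bal x c (d ⊙ₗ y)).hom =
      (functor.map (αᵣ x c d).inv).app y ≫ (bal x (c ⊗ d) y).hom ≫
        (functor.obj x).map (αₗ c d y).hom
  triangle : ∀ (x : X) (y : Y),
    (bal x (𝟙_ C) y).hom ≫ (functor.obj x).map (λₗ y).hom = (functor.map (ρᵣ x).hom).app y

namespace BalancedFunctor

variable {K C X Y E}

/-- A morphism of balanced functors: a natural transformation compatible with the balancing
isomorphisms. -/
@[ext]
structure Hom (P Q : BalancedFunctor K C X Y E) where
  /-- the natural transformation -/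
  hom : P.functor ⟶ Q.functor
  comm : ∀ (x : X) (c : C) (y : Y),
    (hom.app (x ⊙ᵣ c)).app y ≫ (Q.bal x c y).hom = (P.bal x c y).hom ≫ (hom.app x).app (c ⊙ₗ y)

instance category : Category (BalancedFunctor K C X Y E) where
  Hom P Q := Hom P Q
  id P := { hom := 𝟙 _, comm := by simp }
  comp η θ :=
    { hom := η.hom ≫ θ.hom
      comm := fun x c y => by
        simp only [NatTrans.comp_app, Category.assoc, θ.comm]
        rw [← Category.assoc, η.comm, Category.assoc] }
  id_comp η := Hom.ext (Category.id_comp _)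
  comp_id η := Hom.ext (Category.comp_id _)
  assoc η θ κ := Hom.ext (Category.assoc _ _ _)

/-- The balanced functor obtained from a balanced functor by composing it with a `K`-linear
cocontinuous functor. -/
def postcomp {W : Type v} [Category.{u} W] [Preadditive W] [Linear K W]
    (P : BalancedFunctor K C X Y W) (G : CocontFunctor K W E) : BalancedFunctor K C X Y E where
  functor := P.functor ⋙ (Functor.whiskeringRight Y W E).obj G.obj
  bilinear :=
    { map_add_left := fun f g y => by
        simp [P.bilinear.map_add_left, G.property.1]
      map_smul_left := fun r f y => by
        simp [P.bilinear.map_smul_left, G.property.2.1]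
      map_add_right := fun x _ _ f g => by
        simp [P.bilinear.map_add_right, G.property.1]
      map_smul_right := fun x _ _ r f => by
        simp [P.bilinear.map_smul_right, G.property.2.1] }
  cocont_left y := by
    have h₁ := P.cocont_left y
    have h₂ := G.property.2.2
    exact inferInstanceAs (PreservesColimits (P.functor.flip.obj y ⋙ G.obj))
  cocont_right x := by
    have h₁ := P.cocont_right x
    have h₂ := G.property.2.2
    exact inferInstanceAs (PreservesColimits (P.functor.obj x ⋙ G.obj))
  bal x c y := G.obj.mapIso (P.bal x c y)
  bal_nat f g h := by
    simpa using congrArg G.obj.map (P.bal_nat f g h)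
  pentagon x c d y := by
    simpa using congrArg G.obj.map (P.pentagon x c d y)
  triangle x y := by
    simpa using congrArg G.obj.map (P.triangle x y)

/-- Composition with a balanced functor `P : X ⊠ Y → W`, as a functor from `K`-linear cocontinuous
functors `W ⥤ E` to balanced functors `X ⊠ Y → E`. -/
def postcompFunctor {W : Type v} [Category.{u} W] [Preadditive W] [Linear K W]
    (P : BalancedFunctor K C X Y W) (E : Type w) [Category.{u} E] [Preadditive E] [Linear K E] :
    CocontFunctor K W E ⥤ BalancedFunctor K C X Y E where
  obj G := P.postcomp G
  map η :=
    { hom := Functor.whiskerLeft P.functor ((Functor.whiskeringRight Y W E).map η.hom)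
      comm := fun x c y => (η.hom.naturality (P.bal x c y).hom).symm }
  map_id _ := rfl
  map_comp _ _ := rfl

/-- A balanced functor `P : X ⊠ Y → W` exhibits `W` as the balanced tensor product `X ⊠_C Y` if `W`
is cocomplete and `P` is universal among balanced functors to cocomplete `K`-linear categories:
composition with `P` is an equivalence from `K`-linear cocontinuous functors `W ⥤ E` to balanced
functors `X ⊠ Y → E`. -/
structure IsBalancedTensorProduct {W : Type v} [Category.{u} W] [Preadditive W] [Linear K W]
    (P : BalancedFunctor K C X Y W) : Prop where
  cocomplete : HasColimits W
  universal : ∀ (E : Type w) [Category.{u} E] [Preadditive E] [Linear K E] [HasColimits E],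
    (P.postcompFunctor E).IsEquivalence

end BalancedFunctor

end Balanced

end LinCat

/-!
Every presheaf is the colimit of the represented presheaves over its sections, so for cocomplete
`E` restriction along the Yoneda embedding is an equivalence from linear cocontinuous functors
`FreeCocompletion K Z ⥤ E` to linear functors `Z ⥤ E`. For the naive balanced tensor product, the
latter are bilinear functors on `X` and `Y` with a balancing, because it is freely generated by
these data.

Day convolution along `incl : X ⥤ Y ⥤ NaiveBalancedTensor K A X Y` is balanced, and composition with
it, followed by restriction to represented presheaves, is the composite of these two equivalences.
By two-out-of-three it therefore suffices that restricting balanced functors on the free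
cocompletions to represented presheaves is fully faithful. This holds since such functors are
cocontinuous in each variable and the Day convolution of represented presheaves is represented, so
that both natural transformations and their compatibility with the balancing are detected there.
-/

namespace LinCat

namespace FreeCocompletion

variable {K : Type u} [Field K]
variable {Z : Type u} [SmallCategory Z] [Preadditive Z] [Linear K Z]
variable {F G : FreeCocompletion K Z}

@[simp] lemma app_add (η θ : F ⟶ G) (z : Z) (s : F.sec z) :
    app (η + θ) z s = app η z s + app θ z s := rfl

@[simp] lemma app_smul (r : K) (η : F ⟶ G) (z : Z) (s : F.sec z) :
    app (r • η) z s = r • app η z s := rfl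

/-- The morphism out of a represented presheaf classifying a section. -/
def ofSec {z : Z} (s : F.sec z) : rep K z ⟶ F :=
  mkHom (fun x =>
    { toFun := fun f => F.res (toHom f) s
      map_add' := by simp [res_add]
      map_smul' := by simp [res_smul] }) (by simp)

@[simp] lemma app_ofSec {z : Z} (s : F.sec z) (x : Z) (f : (rep K z).sec x) :
    app (ofSec s) x f = F.res (toHom f) s := rfl

lemma rep_hom_ext {z : Z} {η θ : rep K z ⟶ F}
    (h : app η z (ofHom (𝟙 z)) = app θ z (ofHom (𝟙 z))) : η = θ := by
  apply hom_ext'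
  intro x s
  rw [eq_res s, app_res, app_res, h]

@[simp] lemma ofSec_ofHom_id (z : Z) : ofSec (ofHom (𝟙 z)) = 𝟙 (rep K z) :=
  rep_hom_ext (by simp)

@[simp] lemma ofSec_app {z : Z} (η : rep K z ⟶ F) : ofSec (app η z (ofHom (𝟙 z))) = η :=
  rep_hom_ext (by simp)

@[simp] lemma ofSec_comp {z : Z} (s : F.sec z) (η : F ⟶ G) :
    ofSec s ≫ η = ofSec (app η z s) :=
  rep_hom_ext (by simp)

lemma app_ofSec_ofHom_id {y z : Z} (f : y ⟶ z) :
    app (ofSec (ofHom f)) y (ofHom (𝟙 y)) = (rep K z).res f (ofHom (𝟙 z)) := by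
  simp [res_ofHom]

lemma ofSec_add {z : Z} (s t : F.sec z) : ofSec (s + t) = ofSec s + ofSec t :=
  rep_hom_ext (by simp)

lemma ofSec_smul {z : Z} (r : K) (s : F.sec z) : ofSec (r • s) = r • ofSec s :=
  rep_hom_ext (by simp)

variable (K Z) in
/-- The Yoneda embedding. -/
abbrev yoneda : Z ⥤ FreeCocompletion K Z where
  obj z := rep K z
  map f := ofSec (ofHom f)
  map_id z := rep_hom_ext (by simp)
  map_comp f g := rep_hom_ext (by simp [res_ofHom])

lemma ofSec_ofHom_comp_ofSec {y z : Z} (f : y ⟶ z) (s : F.sec z) :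
    ofSec (ofHom f) ≫ ofSec s = ofSec (F.res f s) :=
  rep_hom_ext (by simp)

instance : (yoneda K Z).Additive where
  map_add {_ _ f g} := (congrArg ofSec (map_add ofHom f g)).trans (ofSec_add _ _)

instance : (yoneda K Z).Linear K where
  map_smul f r := (congrArg ofSec (map_smul ofHom r f)).trans (ofSec_smul _ _)

section Nerve

variable {E : Type w} [Category.{u} E] [Preadditive E] [Linear K E]
variable (q : Z ⥤ E) [q.Additive] [q.Linear K]

variable (K) in
/-- The nerve of a linear functor `q : Z ⥤ E`: an object `e` is sent to the presheaf
`Hom(q(-), e)`. -/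
def nerve : E ⥤ FreeCocompletion K Z where
  obj e := mkObj (fun z => q.obj z ⟶ e) (fun f => Linear.leftComp K e (q.map f)) (by simp)
    (by simp) (by simp) (by simp [q.map_smul])
  map g := mkHom (fun z => Linear.rightComp K (q.obj z) g) (fun f s => Category.assoc _ _ _)
  map_id e := hom_ext' (fun z s => Category.comp_id _)
  map_comp f g := hom_ext' (fun z s => (Category.assoc _ _ _).symm)

variable {q}

variable (K) in
/-- Nerves are contravariantly functorial in the linear functor, by precomposition. -/
def nerveMap {q' : Z ⥤ E} [q'.Additive] [q'.Linear K] (τ : q ⟶ q') : nerve K q' ⟶ nerve K q where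
  app e := mkHom (fun z => Linear.leftComp K e (τ.app z)) (fun f (s : q'.obj _ ⟶ e) => by
    exact (τ.naturality_assoc f s).symm)
  naturality _ _ g := hom_ext' (fun z (s : q'.obj z ⟶ _) => (Category.assoc (τ.app z) s g).symm)

/-- A section of a nerve, as a morphism. -/
def unnerve {e : E} {z : Z} : ((nerve K q).obj e).sec z →ₗ[K] (q.obj z ⟶ e) :=
  LinearMap.id (M := q.obj z ⟶ e)

/-- A morphism, as a section of a nerve. -/
def ennerve {e : E} {z : Z} : (q.obj z ⟶ e) →ₗ[K] ((nerve K q).obj e).sec z :=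
  LinearMap.id (M := q.obj z ⟶ e)

@[simp] lemma unnerve_ennerve {e : E} {z : Z} (f : q.obj z ⟶ e) :
    unnerve (K := K) (ennerve f) = f := rfl

@[simp] lemma unnerve_res {e : E} {y z : Z} (f : y ⟶ z) (s : ((nerve K q).obj e).sec z) :
    unnerve (((nerve K q).obj e).res f s) = q.map f ≫ unnerve s := rfl

@[simp] lemma unnerve_app_map {e e' : E} (g : e ⟶ e') {z : Z} (s : ((nerve K q).obj e).sec z) :
    unnerve (app ((nerve K q).map g) z s) = unnerve s ≫ g := rfl

lemma unnerve_app_comp_map {e e' : E} (η : F ⟶ (nerve K q).obj e) (g : e ⟶ e') {z : Z}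
    (s : F.sec z) :
    unnerve (app (η ≫ (nerve K q).map g) z s) = unnerve (app η z s) ≫ g := rfl

lemma hom_nerve_ext {e : E} {η θ : F ⟶ (nerve K q).obj e}
    (h : ∀ (z : Z) (s : F.sec z), unnerve (app η z s) = unnerve (app θ z s)) : η = θ :=
  hom_ext' h

end Nerve

/-! ### Cocompleteness -/

instance isClosedUnderColimitsOfShape (J : Type v₁) [Category.{v₂} J] :
    (isLinearPresheaf K Z).IsClosedUnderColimitsOfShape J where
  colimitsOfShape_le := by
    rintro F ⟨p⟩
    have ext : ∀ {y : Z} {M : ModuleCat.{u} K} {a b : F.obj (op y) ⟶ M},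
        (∀ j, (p.ι.app j).app (op y) ≫ a = (p.ι.app j).app (op y) ≫ b) → a = b :=
      fun {y} _ _ _ h =>
        (isColimitOfPreserves ((evaluation _ _).obj (op y)) p.isColimit).hom_ext h
    constructor
    · intro x y f g
      refine ext fun j => ?_
      have h := (p.prop_diag_obj j).1 f g
      have n := (p.ι.app j).naturality
      simp only [Functor.const_obj_obj] at n
      rw [Preadditive.comp_add, ← n, ← n, ← n, h, Preadditive.add_comp]
    · intro x y r f
      refine ext fun j => ?_
      have h := (p.prop_diag_obj j).2 r f
      have n := (p.ι.app j).naturality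
      simp only [Functor.const_obj_obj] at n
      rw [Linear.comp_smul, ← n, ← n, h, Linear.smul_comp]

instance : HasColimits (FreeCocompletion K Z) where
  has_colimits_of_shape _ _ := inferInstance

/-! ### Weighted colimits -/

/-- The relations between the sections of a presheaf over an object which present the linear and
natural families indexed by these sections. -/
inductive SecRel (F : FreeCocompletion K Z) : Z → Type u
  | add {z : Z} (s t : F.sec z) : SecRel F z
  | smul {z : Z} (r : K) (s : F.sec z) : SecRel F z
  | res {y z : Z} (f : y ⟶ z) (s : F.sec z) : SecRel F y

namespace SecRel

variable {E : Type w} [Category.{u} E] {q : Z ⥤ E} {S : E}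

/-- The left hand side of a relation, evaluated in a family of morphisms. -/
def lhs (a : ∀ z, F.sec z → (q.obj z ⟶ S)) : ∀ {z : Z}, SecRel F z → (q.obj z ⟶ S)
  | _, add s t => a _ (s + t)
  | _, smul r s => a _ (r • s)
  | _, res f s => a _ (F.res f s)

variable [Preadditive E] [Linear K E]

/-- The right hand side of a relation, evaluated in a family of morphisms. -/
def rhs (a : ∀ z, F.sec z → (q.obj z ⟶ S)) : ∀ {z : Z}, SecRel F z → (q.obj z ⟶ S)
  | _, add s t => a _ s + a _ t
  | _, smul r s => r • a _ s
  | _, res f s => q.map f ≫ a _ s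

end SecRel

section Presentation

variable {E : Type w} [Category.{u} E] [HasColimits E] {E' : Type v} [Category.{u} E']
variable (F) (q : Z ⥤ E) (H : E ⥤ E') [PreservesColimits H]

/-- The coproduct of the objects `q.obj z` over all sections of `F`: the generators in the
presentation of the weighted colimit. -/
noncomputable abbrev generators : E := ∐ fun g : Σ z, F.sec z => q.obj g.1

/-- The generator belonging to a section. -/
noncomputable abbrev generator (z : Z) (s : F.sec z) : q.obj z ⟶ generators F q :=
  Sigma.ι (fun g : Σ z, F.sec z => q.obj g.1) ⟨z, s⟩

lemma exists_desc_map_generators {e : E'} (a : ∀ z, F.sec z → (H.obj (q.obj z) ⟶ e)) :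
    ∃ d : H.obj (generators F q) ⟶ e, ∀ z s, H.map (generator F q z s) ≫ d = a z s :=
  let h := isColimitOfHasCoproductOfPreservesColimit H fun g : Σ z, F.sec z => q.obj g.1
  ⟨Cofan.IsColimit.desc h fun g => a g.1 g.2, fun z s =>
    Cofan.IsColimit.fac h _ (⟨z, s⟩ : Σ z, F.sec z)⟩

variable [Preadditive E] [Linear K E]

/-- The coproduct of the objects `q.obj z` over all relations between the sections of `F`. -/
noncomputable abbrev relations : E := ∐ fun r : Σ z, SecRel F z => q.obj r.1

/-- The left hand sides of all relations between the generators. -/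
noncomputable abbrev relationsLhs : relations F q ⟶ generators F q :=
  Sigma.desc fun r => r.2.lhs (generator F q)

/-- The right hand sides of all relations between the generators. -/
noncomputable abbrev relationsRhs : relations F q ⟶ generators F q :=
  Sigma.desc fun r => r.2.rhs (generator F q)

/-- The colimit of `q` weighted by `F`, presented by the sections of `F` and their relations. -/
noncomputable abbrev weightedColimit : E := coequalizer (relationsLhs F q) (relationsRhs F q)

lemma lhs_generator_comp_π {z : Z} (r : SecRel F z) :
    r.lhs (generator F q) ≫ coequalizer.π (relationsLhs F q) (relationsRhs F q) =
      r.rhs (generator F q) ≫ coequalizer.π _ _ := by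
  simpa using Sigma.ι (fun r : Σ z, SecRel F z => q.obj r.1) ⟨z, r⟩ ≫=
    coequalizer.condition (relationsLhs F q) (relationsRhs F q)

lemma map_weightedColimit_hom_ext {e : E'} {f g : H.obj (weightedColimit F q) ⟶ e}
    (h : ∀ z s, H.map (generator F q z s) ≫ H.map (coequalizer.π _ _) ≫ f =
      H.map (generator F q z s) ≫ H.map (coequalizer.π _ _) ≫ g) : f = g := by
  refine Cofork.IsColimit.hom_ext (isColimitOfHasCoequalizerOfPreservesColimit H _ _) ?_
  exact Cofan.IsColimit.hom_ext (isColimitOfHasCoproductOfPreservesColimit H _) _ _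
    fun ⟨z, s⟩ => h z s

end Presentation

section WeightedColimit

variable {E : Type w} [Category.{u} E] [Preadditive E] [Linear K E]
variable {q : Z ⥤ E} [q.Additive] [q.Linear K] {S T : E}

/-- The colimit of `q : Z ⥤ E` weighted by a presheaf `F` on `Z`: an object `S` with a universal
family of morphisms `q.obj z ⟶ S` indexed by the sections of `F`, linear and natural in these. Such
a family is encoded as a morphism from `F` to the nerve of `q` at `S`. -/
def IsWeightedColimit (ι : F ⟶ (nerve K q).obj S) : Prop :=
  ∀ e : E, Function.Bijective fun f : S ⟶ e => ι ≫ (nerve K q).map f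

namespace IsWeightedColimit

variable {ι : F ⟶ (nerve K q).obj S} {κ : F ⟶ (nerve K q).obj T}

/-- The morphisms out of a weighted colimit. -/
noncomputable def homEquiv (hι : IsWeightedColimit ι) (e : E) :
    (S ⟶ e) ≃ (F ⟶ (nerve K q).obj e) :=
  Equiv.ofBijective _ (hι e)

@[simp] lemma homEquiv_apply (hι : IsWeightedColimit ι) {e : E} (f : S ⟶ e) :
    hι.homEquiv e f = ι ≫ (nerve K q).map f := rfl

lemma comp_map_homEquiv_symm (hι : IsWeightedColimit ι) {e : E} (η : F ⟶ (nerve K q).obj e) :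
    ι ≫ (nerve K q).map ((hι.homEquiv e).symm η) = η :=
  (hι.homEquiv e).apply_symm_apply η

lemma hom_ext (hι : IsWeightedColimit ι) {e : E} {f g : S ⟶ e}
    (h : ι ≫ (nerve K q).map f = ι ≫ (nerve K q).map g) : f = g :=
  (hι e).injective h

lemma exists_iso (hι : IsWeightedColimit ι) (hκ : IsWeightedColimit κ) :
    ∃ i : S ≅ T, ι ≫ (nerve K q).map i.hom = κ := by
  refine ⟨⟨(hι.homEquiv T).symm κ, (hκ.homEquiv S).symm ι, hι.hom_ext ?_, hκ.hom_ext ?_⟩, ?_⟩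
  · rw [Functor.map_comp, ← Category.assoc]
    simp [comp_map_homEquiv_symm]
  · rw [Functor.map_comp, ← Category.assoc]
    simp [comp_map_homEquiv_symm]
  · exact hι.comp_map_homEquiv_symm κ

lemma isIso (hι : IsWeightedColimit ι) (hκ : IsWeightedColimit κ) {f : S ⟶ T}
    (hf : ι ≫ (nerve K q).map f = κ) : IsIso f := by
  obtain ⟨i, hi⟩ := hι.exists_iso hκ
  rw [hι.hom_ext (hf.trans hi.symm)]
  infer_instance

lemma comp_iso (hι : IsWeightedColimit ι) (i : S ≅ T) :
    IsWeightedColimit (ι ≫ (nerve K q).map i.hom) := fun e => by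
  simpa [Function.comp_def] using (hι e).comp i.homFromEquiv.symm.bijective

end IsWeightedColimit

section

variable [HasColimits E]
variable (F q)

/-- The universal family of morphisms to the weighted colimit. -/
noncomputable def weightedCocone : F ⟶ (nerve K q).obj (weightedColimit F q) :=
  mkHom (fun z =>
    { toFun := fun s => ennerve (generator F q z s ≫ coequalizer.π _ _)
      map_add' := fun s t => (lhs_generator_comp_π F q (.add s t)).trans
        (Preadditive.add_comp _ _ _ _ _ _)
      map_smul' := fun r s => (lhs_generator_comp_π F q (.smul r s)).trans
        (Linear.smul_comp _ _ _ _ _ _) })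
    (fun f s => (lhs_generator_comp_π F q (.res f s)).trans (Category.assoc _ _ _))

end

section Map

variable {E' : Type v} [Category.{u} E'] [Preadditive E'] [Linear K E']
variable (H : E ⥤ E') [H.Additive] [H.Linear K]

variable (K q S) in
/-- The action of a linear functor on morphisms, as a morphism of nerves. -/
def mapNerve : (nerve K q).obj S ⟶ (nerve K (q ⋙ H)).obj (H.obj S) :=
  mkHom (fun z => ennerve (q := q ⋙ H) ∘ₗ H.mapLinearMap K (X := q.obj z) (Y := S))
    (fun f s => H.map_comp (q.map f) (unnerve s))

lemma map_comp_mapNerve (f : S ⟶ T) :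
    (nerve K q).map f ≫ mapNerve K q T H =
      mapNerve K q S H ≫ (nerve K (q ⋙ H)).map (H.map f) :=
  hom_nerve_ext fun _ s => H.map_comp (unnerve s) f

variable [HasColimits E]
variable (F q)

lemma unnerve_app_weightedCocone_comp_mapNerve {e : E'} (f : H.obj (weightedColimit F q) ⟶ e)
    (z : Z) (s : F.sec z) :
    unnerve (app ((weightedCocone F q ≫ mapNerve K q _ H) ≫ (nerve K (q ⋙ H)).map f) z s) =
      H.map (generator F q z s) ≫
        H.map (coequalizer.π (relationsLhs F q) (relationsRhs F q)) ≫ f := by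
  rw [← Category.assoc, ← H.map_comp]
  rfl

variable [PreservesColimits H]

lemma map_relations_comp_eq {e : E'} (η : F ⟶ (nerve K (q ⋙ H)).obj e)
    {d : H.obj (generators F q) ⟶ e}
    (hd : ∀ z s, H.map (generator F q z s) ≫ d = unnerve (app η z s)) :
    H.map (relationsLhs F q) ≫ d = H.map (relationsRhs F q) ≫ d := by
  refine Cofan.IsColimit.hom_ext (isColimitOfHasCoproductOfPreservesColimit H _) _ _
    fun ⟨z, r⟩ => ?_
  have h : H.map (r.lhs (generator F q)) ≫ d = H.map (r.rhs (generator F q)) ≫ d := by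
    cases r with
    | add s t => simp [SecRel.lhs, SecRel.rhs, hd, H.map_add]
    | smul r s => simp [SecRel.lhs, SecRel.rhs, hd, H.map_smul]
    | res f s => simp [SecRel.lhs, SecRel.rhs, hd]
  simpa [← H.map_comp_assoc] using h

lemma isWeightedColimit_weightedCocone_comp_mapNerve :
    IsWeightedColimit (weightedCocone F q ≫ mapNerve K q _ H) := fun e => by
  refine ⟨fun f g h => map_weightedColimit_hom_ext F q H fun z s => ?_, fun η => ?_⟩
  · simpa only [unnerve_app_weightedCocone_comp_mapNerve] using
      congrArg (fun η => unnerve (app η z s)) h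
  · obtain ⟨d, hd⟩ := exists_desc_map_generators F q H fun z s => unnerve (app η z s)
    obtain ⟨f, hf⟩ := Cofork.IsColimit.desc'
      (isColimitOfHasCoequalizerOfPreservesColimit H (relationsLhs F q) (relationsRhs F q)) d
      (map_relations_comp_eq F q H η hd)
    have hf : H.map (coequalizer.π (relationsLhs F q) (relationsRhs F q)) ≫ f = d := hf
    refine ⟨f, hom_nerve_ext fun z s => ?_⟩
    rw [unnerve_app_weightedCocone_comp_mapNerve, hf, hd]

end Map

lemma isWeightedColimit_weightedCocone [HasColimits E] (F : FreeCocompletion K Z)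
    (q : Z ⥤ E) [q.Additive] [q.Linear K] : IsWeightedColimit (weightedCocone F q) :=
  isWeightedColimit_weightedCocone_comp_mapNerve F q (𝟭 E)

lemma IsWeightedColimit.map [HasColimits E] {ι : F ⟶ (nerve K q).obj S}
    (hι : IsWeightedColimit ι) {E' : Type v} [Category.{u} E'] [Preadditive E'] [Linear K E']
    (H : E ⥤ E') [H.Additive] [H.Linear K] [PreservesColimits H] :
    IsWeightedColimit (ι ≫ mapNerve K q S H) := by
  obtain ⟨i, rfl⟩ := (isWeightedColimit_weightedCocone F q).exists_iso hι
  rw [Category.assoc, map_comp_mapNerve, ← Category.assoc]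
  exact (isWeightedColimit_weightedCocone_comp_mapNerve F q H).comp_iso (H.mapIso i)

end WeightedColimit

end FreeCocompletion

/-! ### The universal property of the free cocompletion -/

/-- The property of a functor between `K`-linear categories to be `K`-linear. -/
def isLinearFunctor (K : Type u) [Field K] (Z : Type v) [Category.{u} Z] [Preadditive Z]
    [Linear K Z] (E : Type w) [Category.{u} E] [Preadditive E] [Linear K E] :
    ObjectProperty (Z ⥤ E) :=
  fun q => q.Additive ∧ q.Linear K

/-- The category of `K`-linear functors and natural transformations. -/
abbrev LinearFunctor (K : Type u) [Field K] (Z : Type v) [Category.{u} Z] [Preadditive Z]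
    [Linear K Z] (E : Type w) [Category.{u} E] [Preadditive E] [Linear K E] :=
  (isLinearFunctor K Z E).FullSubcategory

namespace LinearFunctor

variable {K : Type u} [Field K]
variable {Z : Type v} [Category.{u} Z] [Preadditive Z] [Linear K Z]
variable {E : Type w} [Category.{u} E] [Preadditive E] [Linear K E] (q : LinearFunctor K Z E)

instance : q.obj.Additive := q.property.1

instance : q.obj.Linear K := q.property.2

end LinearFunctor

namespace CocontFunctor

variable {K : Type u} [Field K]
variable {W : Type v} [Category.{u} W] [Preadditive W] [Linear K W]
variable {E : Type w} [Category.{u} E] [Preadditive E] [Linear K E] (H : CocontFunctor K W E)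

instance : H.obj.Additive := ⟨H.property.1 _ _⟩

instance : H.obj.Linear K := ⟨fun f r => H.property.2.1 r f⟩

instance : PreservesColimits H.obj := H.property.2.2

/-- A linear functor which preserves colimits. -/
def of (H : W ⥤ E) [H.Additive] [H.Linear K] [PreservesColimits H] : CocontFunctor K W E :=
  ⟨H, fun _ _ _ _ => H.map_add, fun _ _ _ _ => H.map_smul _ _, inferInstance⟩

end CocontFunctor

namespace FreeCocompletion

variable {K : Type u} [Field K]
variable {Z : Type u} [SmallCategory Z] [Preadditive Z] [Linear K Z]
variable (F : FreeCocompletion K Z)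

section Density

/-- The family of all morphisms from represented presheaves to a presheaf, indexed by its
sections. -/
def yonedaCocone : F ⟶ (nerve K (yoneda K Z)).obj F :=
  mkHom (fun _ =>
    { toFun := fun s => ennerve (ofSec s)
      map_add' := ofSec_add
      map_smul' := ofSec_smul })
    (fun f s => (ofSec_ofHom_comp_ofSec f s).symm)

@[simp] lemma unnerve_app_yonedaCocone {z : Z} (s : F.sec z) :
    unnerve (app (yonedaCocone F) z s) = ofSec s := rfl

/-- Evaluation at the identities, the inverse of `yonedaCocone`. -/
def evalNerve : (nerve K (yoneda K Z)).obj F ⟶ F :=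
  mkHom (fun z =>
    { toFun := fun s => app (unnerve s) z (ofHom (𝟙 z))
      map_add' := by simp
      map_smul' := by simp })
    (fun {y _} f s =>
      (congrArg (app (unnerve s) y) (app_ofSec_ofHom_id f)).trans (app_res _ _ _))

lemma ofSec_app_evalNerve {z : Z} (s : ((nerve K (yoneda K Z)).obj F).sec z) :
    ofSec (app (evalNerve F) z s) = unnerve s :=
  ofSec_app (unnerve s)

lemma isWeightedColimit_yonedaCocone : IsWeightedColimit (yonedaCocone F) := fun G => by
  refine ⟨fun f g h => hom_ext' fun z s => ?_, fun η => ⟨η ≫ evalNerve G, ?_⟩⟩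
  · have h : ofSec s ≫ f = ofSec s ≫ g := congrArg (fun η => unnerve (app η z s)) h
    simpa using congrArg (fun η => app η z (ofHom (𝟙 z))) h
  · refine hom_nerve_ext fun z s => ?_
    rw [unnerve_app_comp_map, unnerve_app_yonedaCocone, ofSec_comp, app_comp, ofSec_app_evalNerve]

variable {E : Type w} [Category.{u} E] [Preadditive E] [Linear K E]
variable (H : FreeCocompletion K Z ⥤ E) [H.Additive] [H.Linear K]

/-- The image under a linear functor of all morphisms from represented presheaves to a presheaf. -/
def densityCocone : F ⟶ (nerve K (yoneda K Z ⋙ H)).obj (H.obj F) :=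
  yonedaCocone F ≫ mapNerve K (yoneda K Z) F H

lemma unnerve_app_densityCocone {z : Z} (s : F.sec z) :
    unnerve (app (densityCocone F H) z s) = H.map (ofSec s) := rfl

lemma isWeightedColimit_densityCocone [PreservesColimits H] :
    IsWeightedColimit (densityCocone F H) :=
  (isWeightedColimit_yonedaCocone F).map H

variable {F} in
lemma comp_densityCocone {G : FreeCocompletion K Z} (η : F ⟶ G) :
    η ≫ densityCocone G H = densityCocone F H ≫ (nerve K (yoneda K Z ⋙ H)).map (H.map η) :=
  hom_nerve_ext fun z s => by
    rw [app_comp, unnerve_app_comp_map, unnerve_app_densityCocone, unnerve_app_densityCocone,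
      ← H.map_comp, ofSec_comp]

/-- A linear functor which turns each presheaf, as a colimit of represented presheaves, into a
weighted colimit is left adjoint to the nerve of its restriction. -/
noncomputable def adjunctionOfIsWeightedColimit
    (h : ∀ F : FreeCocompletion K Z, IsWeightedColimit (densityCocone F H)) :
    H ⊣ nerve K (yoneda K Z ⋙ H) :=
  Adjunction.mkOfHomEquiv
    { homEquiv := fun F e => (h F).homEquiv e
      homEquiv_naturality_left_symm := fun {F' F e} η θ => by
        obtain ⟨f, rfl⟩ := ((h F).homEquiv e).surjective θ
        rw [Equiv.symm_apply_eq, Equiv.symm_apply_apply, IsWeightedColimit.homEquiv_apply,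
          IsWeightedColimit.homEquiv_apply, Functor.map_comp, ← Category.assoc,
          comp_densityCocone, Category.assoc]
      homEquiv_naturality_right := fun f g => by simp }

lemma isLinearCocontinuous_of_isWeightedColimit
    (h : ∀ F : FreeCocompletion K Z, IsWeightedColimit (densityCocone F H)) :
    isLinearCocontinuous K _ _ H :=
  ⟨fun _ _ _ _ => H.map_add, fun _ _ _ _ => H.map_smul _ _,
    (adjunctionOfIsWeightedColimit H h).leftAdjoint_preservesColimits⟩

end Density

end FreeCocompletion

namespace CocontFunctor

open FreeCocompletion

variable {K : Type u} [Field K]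
variable {Z : Type u} [SmallCategory Z] [Preadditive Z] [Linear K Z]
variable {E : Type w} [Category.{u} E] [Preadditive E] [Linear K E]

lemma hom_ext {H : CocontFunctor K (FreeCocompletion K Z) E} {F : FreeCocompletion K Z} {e : E}
    {f g : H.obj.obj F ⟶ e}
    (h : ∀ (z : Z) (s : F.sec z), H.obj.map (ofSec s) ≫ f = H.obj.map (ofSec s) ≫ g) : f = g :=
  (isWeightedColimit_densityCocone F H.obj).hom_ext (hom_nerve_ext h)

lemma exists_desc (H : CocontFunctor K (FreeCocompletion K Z) E) {F : FreeCocompletion K Z} {e : E}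
    (η : F ⟶ (nerve K (yoneda K Z ⋙ H.obj)).obj e) :
    ∃ f : H.obj.obj F ⟶ e, ∀ (z : Z) (s : F.sec z),
      H.obj.map (ofSec s) ≫ f = unnerve (app η z s) := by
  obtain ⟨f, rfl⟩ := (isWeightedColimit_densityCocone F H.obj e).surjective η
  exact ⟨f, fun z s => rfl⟩

/-- The extension is induced by the canonical presentations of all presheaves. -/
lemma exists_whiskerLeft_yoneda_eq (H : CocontFunctor K (FreeCocompletion K Z) E)
    (H' : FreeCocompletion K Z ⥤ E) [H'.Additive] [H'.Linear K]
    (τ : yoneda K Z ⋙ H.obj ⟶ yoneda K Z ⋙ H') :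
    ∃ α : H.obj ⟶ H', Functor.whiskerLeft (yoneda K Z) α = τ := by
  have h (F : FreeCocompletion K Z) := H.exists_desc (densityCocone F H' ≫ (nerveMap K τ).app _)
  choose α hα using h
  have hα (F : FreeCocompletion K Z) (z : Z) (s : F.sec z) :
      H.obj.map (ofSec s) ≫ α F = τ.app z ≫ H'.map (ofSec s) := hα F z s
  refine ⟨{ app := α, naturality := fun F G η => H.hom_ext fun z s => ?_ }, ?_⟩
  · rw [← H.obj.map_comp_assoc, ofSec_comp, hα, reassoc_of% hα F z s, ← H'.map_comp, ofSec_comp]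
  · ext z
    simpa using hα (rep K z) z (ofHom (𝟙 z))

end CocontFunctor

namespace FreeCocompletion

variable {K : Type u} [Field K]
variable {Z : Type u} [SmallCategory Z] [Preadditive Z] [Linear K Z]
variable {E : Type w} [Category.{u} E] [Preadditive E] [Linear K E]
variable (q : Z ⥤ E) [q.Additive] [q.Linear K]

instance : (nerve K q).Additive where
  map_add {_ _ f g} := hom_ext' fun _ s => Preadditive.comp_add _ _ _ (unnerve s) f g

instance : (nerve K q).Linear K where
  map_smul f r := hom_ext' fun _ s => Linear.comp_smul _ _ _ (unnerve s) r f

lemma isWeightedColimit_ofSec (z : Z) :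
    IsWeightedColimit (ofSec (ennerve (K := K) (q := q) (𝟙 (q.obj z)))) := fun e => by
  refine ⟨fun f g h => ?_, fun η => ⟨unnerve (app η z (ofHom (𝟙 z))), rep_hom_ext ?_⟩⟩
  · have h : app (ofSec (ennerve (𝟙 (q.obj z))) ≫ (nerve K q).map f) z (ofHom (𝟙 z)) =
        app (ofSec (ennerve (𝟙 (q.obj z))) ≫ (nerve K q).map g) z (ofHom (𝟙 z)) :=
      congrArg (fun η => app η z (ofHom (𝟙 z))) h
    simpa [Category.id_comp] using congrArg unnerve h
  · simp only [ofSec_comp, app_ofSec, toHom_ofHom, res_id]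
    exact Category.id_comp (unnerve (app η z (ofHom (𝟙 z))))

variable [HasColimits E]

variable (K) in
/-- The extension of a linear functor `q : Z ⥤ E` along the Yoneda embedding, which sends a presheaf
to the colimit of `q` weighted by it. -/
noncomputable def extension : FreeCocompletion K Z ⥤ E :=
  Adjunction.leftAdjointOfEquiv (G := nerve K q) (F_obj := fun F => weightedColimit F q)
    (fun F e => (isWeightedColimit_weightedCocone F q).homEquiv e)
    (fun _ _ _ _ _ => by simp)

/-- The extension of `q` is left adjoint to its nerve. -/
noncomputable def extensionAdjunction : extension K q ⊣ nerve K q :=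
  Adjunction.adjunctionOfEquivLeft _ _

instance : (extension K q).Additive := (extensionAdjunction q).left_adjoint_additive

instance : (extension K q).Linear K :=
  ⟨fun _ r => ((extensionAdjunction q).homEquiv _ _).injective (by
    simp only [Adjunction.homEquiv_unit, (nerve K q).map_smul, Linear.comp_smul,
      Adjunction.unit_naturality, Linear.smul_comp])⟩

instance : PreservesColimits (extension K q) :=
  (extensionAdjunction q).leftAdjoint_preservesColimits

lemma isWeightedColimit_extensionAdjunction_unit (F : FreeCocompletion K Z) :
    IsWeightedColimit ((extensionAdjunction q).unit.app F) := fun e =>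
  ((extensionAdjunction q).homEquiv F e).bijective

variable (K) in
/-- The comparison of a linear functor with the restriction of its extension. -/
noncomputable def extensionComparison : q ⟶ yoneda K Z ⋙ extension K q where
  app z := unnerve (app ((extensionAdjunction q).unit.app (rep K z)) z (ofHom (𝟙 z)))
  naturality y z f := by
    let u := (extensionAdjunction (K := K) q).unit
    have hf : app (u.app (rep K z)) y (app (ofSec (ofHom f)) y (ofHom (𝟙 y))) =
        ((nerve K q).obj ((extension K q).obj (rep K z))).res f
          (app (u.app (rep K z)) z (ofHom (𝟙 z))) :=
      (congrArg (app (u.app (rep K z)) y) (app_ofSec_ofHom_id f)).trans (app_res _ f _)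
    exact (congrArg unnerve hf).symm.trans <|
      congrArg (fun η => unnerve (app η y (ofHom (𝟙 y)))) (u.naturality ((yoneda K Z).map f))

instance : IsIso (extensionComparison K q) := by
  have (z : Z) : IsIso ((extensionComparison K q).app z) :=
    (isWeightedColimit_ofSec q z).isIso (isWeightedColimit_extensionAdjunction_unit q (rep K z))
      (rep_hom_ext (by
        simp only [ofSec_comp, app_ofSec, toHom_ofHom, res_id]
        exact Category.id_comp (unnerve _)))
  exact NatIso.isIso_of_isIso_app _

variable (K Z E) in
/-- Restriction to the represented presheaves. -/
def restrictYoneda : CocontFunctor K (FreeCocompletion K Z) E ⥤ LinearFunctor K Z E where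
  obj H := ⟨yoneda K Z ⋙ H.obj, inferInstance, inferInstance⟩
  map α := ObjectProperty.homMk (Functor.whiskerLeft (yoneda K Z) α.hom)

instance : (restrictYoneda K Z E).Faithful where
  map_injective {H H' α β} h := by
    ext F
    refine H.hom_ext fun z s => ?_
    have hz : α.hom.app (rep K z) = β.hom.app (rep K z) :=
      congrArg (fun τ => τ.hom.app z) h
    rw [α.hom.naturality, β.hom.naturality, hz]

instance : (restrictYoneda K Z E).Full where
  map_surjective {H H'} τ := by
    obtain ⟨α, hα⟩ := H.exists_whiskerLeft_yoneda_eq H'.obj τ.hom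
    exact ⟨ObjectProperty.homMk α, ObjectProperty.hom_ext _ hα⟩

instance : (restrictYoneda K Z E).EssSurj where
  mem_essImage q :=
    ⟨CocontFunctor.of (extension K q.obj),
      ⟨ObjectProperty.isoMk _ (asIso (extensionComparison K q.obj)).symm⟩⟩

instance : (restrictYoneda K Z E).IsEquivalence where

end FreeCocompletion

namespace IsBilinear

variable (K : Type*) [Field K] {B C D : Type*} [Category* B] [Category* C] [Category* D]
variable [Preadditive B] [Preadditive C] [Preadditive D] [Linear K B] [Linear K C] [Linear K D]
variable (T : B ⥤ C ⥤ D) [IsBilinear K T]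

include K in
lemma additive_obj (b : B) : (T.obj b).Additive := ⟨map_add_right (K := K) b _ _⟩

lemma linear_obj (b : B) : (T.obj b).Linear K := ⟨fun f r => map_smul_right b r f⟩

include K in
lemma additive_flip_obj (c : C) : (T.flip.obj c).Additive :=
  ⟨map_add_left (K := K) (T := T) _ _ c⟩

lemma linear_flip_obj (c : C) : (T.flip.obj c).Linear K :=
  ⟨fun f r => map_smul_left (T := T) r f c⟩

end IsBilinear

namespace Day

open FreeCocompletion

/-! ### Day convolution as a functor of two variables -/

variable {K : Type u} [Field K]
variable {B C D : Type u} [SmallCategory B] [SmallCategory C] [SmallCategory D]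
variable [Preadditive B] [Preadditive C] [Preadditive D] [Linear K B] [Linear K C] [Linear K D]
variable (T : B ⥤ C ⥤ D)

variable (K) in
/-- Day convolution along `T` as a functor of two variables. -/
noncomputable abbrev convFunctor :
    FreeCocompletion K B ⥤ FreeCocompletion K C ⥤ FreeCocompletion K D where
  obj F :=
    { obj := fun G => conv T F G
      map := fun θ => map T (𝟙 F) θ
      map_id := fun G => map_id
      map_comp := fun θ θ' => conv_hom_ext (by simp) }
  map η :=
    { app := fun G => map T η (𝟙 G)
      naturality := fun G G' θ => conv_hom_ext (by simp) }
  map_id F := by ext1; funext G; exact map_id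
  map_comp η η' := by ext1; funext G; exact conv_hom_ext (by simp)

instance isBilinear_convFunctor : IsBilinear K (convFunctor K T) where
  map_add_left _ _ _ := conv_hom_ext (by simp)
  map_smul_left _ _ _ := conv_hom_ext (by simp)
  map_add_right _ _ _ _ _ := conv_hom_ext (by simp)
  map_smul_right _ _ _ _ _ := conv_hom_ext (by simp)

section

variable {T}

instance (G : FreeCocompletion K C) : ((convFunctor K T).flip.obj G).Additive :=
  IsBilinear.additive_flip_obj K _ G

instance (G : FreeCocompletion K C) : ((convFunctor K T).flip.obj G).Linear K :=
  IsBilinear.linear_flip_obj K _ G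

variable {F : FreeCocompletion K B} {G : FreeCocompletion K C} {H : FreeCocompletion K D}
variable (η : F ⟶ (nerve K (yoneda K B ⋙ (convFunctor K T).flip.obj G)).obj H)

/-- The morphism out of `conv T F G` given by a compatible family of morphisms out of all
`conv T (rep K b) G`, indexed by the sections of `F` over `b`. -/
noncomputable def descLeft : conv T F G ⟶ H :=
  desc (fun d =>
    { f := fun {b _} φ s t => app (unnerve (app η b s)) d (cmk (F := rep K b) φ (ofHom (𝟙 b)) t)
      dinat_left := fun {b b' c} g φ s t => by
        have h : unnerve (app η b (F.res g s)) =
            map T (ofSec (ofHom g)) (𝟙 G) ≫ unnerve (app η b' s) :=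
          (congrArg unnerve (app_res η g s)).trans (unnerve_res _ _)
        have h' : app (map T (ofSec (ofHom g)) (𝟙 G)) d (cmk (F := rep K b) φ (ofHom (𝟙 b)) t) =
            cmk (F := rep K b') (φ ≫ (T.map g).app c) (ofHom (𝟙 b')) t := by
          rw [app_map_cmk, app_ofSec_ofHom_id, cmk_res_left, app_id]
        rw [h, app_comp, h'] })
    (by simp [← app_res])

lemma map_ofSec_id_comp_descLeft {b : B} (s : F.sec b) :
    map T (ofSec s) (𝟙 G) ≫ descLeft η = unnerve (app η b s) :=
  conv_hom_ext fun {d b' c} φ f t => by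
    have h : unnerve (app η b' (F.res (toHom f) s)) =
        map T (ofSec (ofHom (toHom f))) (𝟙 G) ≫ unnerve (app η b s) :=
      (congrArg unnerve (app_res η (toHom f) s)).trans (unnerve_res _ _)
    rw [app_comp, app_map_cmk, app_id, app_ofSec, descLeft, app_desc]
    refine (congrArg (fun g => app g d (cmk (F := rep K b') φ (ofHom (𝟙 b')) t)) h).trans ?_
    rw [app_comp, app_map_cmk, app_ofSec_ofHom_id, app_id, ← eq_res]

lemma isLinearCocontinuous_convFunctor_flip_obj (T : B ⥤ C ⥤ D) (G : FreeCocompletion K C) :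
    isLinearCocontinuous K _ _ ((convFunctor K T).flip.obj G) :=
  isLinearCocontinuous_of_isWeightedColimit _ fun F H =>
    ⟨fun f g h => conv_hom_ext fun {d b c} φ s t => by
      have h : map T (ofSec s) (𝟙 G) ≫ f = map T (ofSec s) (𝟙 G) ≫ g :=
        congrArg (fun η => unnerve (app η b s)) h
      simpa using congrArg (fun η => app η d (cmk (F := rep K b) φ (ofHom (𝟙 b)) t)) h,
     fun η => ⟨descLeft η, hom_nerve_ext fun b s => map_ofSec_id_comp_descLeft η s⟩⟩

end

/-- Day convolution along `T` and along `T.flip` agree up to the order of the arguments. -/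
noncomputable def convFlip (F : FreeCocompletion K B) (G : FreeCocompletion K C) :
    conv T F G ⟶ conv T.flip G F :=
  desc (fun d => { f := fun {b c} φ s t => cmk (T := T.flip) φ t s })
    (fun h _ _ φ s t => (res_cmk h (T := T.flip) φ t s).symm)

lemma app_convFlip {F : FreeCocompletion K B} {G : FreeCocompletion K C} {d : D} {b : B} {c : C}
    (φ : d ⟶ (T.obj b).obj c) (s : F.sec b) (t : G.sec c) :
    app (convFlip T F G) d (cmk φ s t) = cmk (T := T.flip) φ t s :=
  app_desc _ _ _ _ _

lemma convFlip_comp_convFlip (F : FreeCocompletion K B) (G : FreeCocompletion K C) :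
    convFlip T F G ≫ convFlip T.flip G F = 𝟙 (conv T F G) :=
  conv_hom_ext fun {d _ _} φ s t =>
    (congrArg (app (convFlip T.flip G F) d) (app_convFlip T φ s t)).trans
      (app_convFlip T.flip φ t s)

variable (K) in
/-- Day convolution along `T` and along `T.flip` agree up to the order of the arguments, as
functors of the second argument. -/
noncomputable def convFlipIso (F : FreeCocompletion K B) :
    (convFunctor K T).obj F ≅ (convFunctor K T.flip).flip.obj F :=
  NatIso.ofComponents (fun G =>
    { hom := convFlip T F G
      inv := convFlip T.flip G F
      hom_inv_id := convFlip_comp_convFlip T F G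
      inv_hom_id := convFlip_comp_convFlip T.flip G F })
    fun {G G'} θ => conv_hom_ext fun {d b c} φ s t => by
      change app (convFlip T F G') d (app (map T (𝟙 F) θ) d (cmk φ s t)) =
        app (map T.flip θ (𝟙 F)) d (app (convFlip T F G) d (cmk φ s t))
      rw [app_map_cmk, app_convFlip, app_convFlip, app_map_cmk]

lemma isLinearCocontinuous_convFunctor_obj (F : FreeCocompletion K B) :
    isLinearCocontinuous K _ _ ((convFunctor K T).obj F) :=
  have := (isLinearCocontinuous_convFunctor_flip_obj T.flip F).2.2
  ⟨fun _ _ => IsBilinear.map_add_right (K := K) F, fun _ _ => IsBilinear.map_smul_right F,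
    preservesColimits_of_natIso (convFlipIso K T F).symm⟩

/-- The canonical map from the presheaf represented by `T(b, c)` to the Day convolution of
represented presheaves. -/
noncomputable def repHom (b : B) (c : C) :
    rep K ((T.obj b).obj c) ⟶ conv T (rep K b) (rep K c) :=
  ofSec (cmk (𝟙 _) (ofHom (𝟙 b)) (ofHom (𝟙 c)))

lemma app_repHom {b : B} {c : C} {d : D} (f : d ⟶ (T.obj b).obj c) :
    app (repHom (K := K) T b c) d (ofHom f) = cmk f (ofHom (𝟙 b)) (ofHom (𝟙 c)) := by
  rw [repHom, app_ofSec, toHom_ofHom, res_cmk, Category.comp_id]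

lemma cmk_rep {b b' : B} {c c' : C} {d : D} (φ : d ⟶ (T.obj b').obj c') (f : (rep K b).sec b')
    (g : (rep K c).sec c') : cmk φ f g =
      cmk (φ ≫ (T.map (toHom f)).app c' ≫ (T.obj b).map (toHom g)) (ofHom (K := K) (𝟙 b))
        (ofHom (K := K) (𝟙 c)) := by
  conv_lhs => rw [eq_res f, eq_res g]
  rw [cmk_res_left, cmk_res_right, Category.assoc]

lemma repHom_naturality {b b' : B} {c c' : C} (f : b ⟶ b') (g : c ⟶ c') :
    ofSec (ofHom ((T.map f).app c ≫ (T.obj b').map g)) ≫ repHom (K := K) T b' c' =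
      repHom T b c ≫ map T (ofSec (ofHom f)) (ofSec (ofHom g)) := by
  refine rep_hom_ext ?_
  simp only [app_comp, app_ofSec, app_repHom, app_map_cmk, toHom_ofHom, res_ofHom,
    Category.id_comp]
  rw [cmk_rep T _ (ofHom f)]
  simp

variable [IsBilinear K T]

/-- The inverse of the canonical map `repHom`. -/
noncomputable def repInv (b : B) (c : C) :
    conv T (rep K b) (rep K c) ⟶ rep K ((T.obj b).obj c) :=
  desc (fun d =>
    { f := fun {b' c'} φ f g => ofHom (φ ≫ (T.map (toHom f)).app c' ≫ (T.obj b).map (toHom g))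
      add_left := by simp [IsBilinear.map_add_left (K := K)]
      smul_left := by simp [IsBilinear.map_smul_left (K := K)]
      add_right := by simp [IsBilinear.map_add_right (K := K)]
      smul_right := by simp [IsBilinear.map_smul_right (K := K)] })
    (by simp [res_ofHom])

lemma app_repInv {b b' : B} {c c' : C} {d : D} (φ : d ⟶ (T.obj b').obj c') (f : (rep K b).sec b')
    (g : (rep K c).sec c') : app (repInv T b c) d (cmk φ f g) =
      ofHom (φ ≫ (T.map (toHom f)).app c' ≫ (T.obj b).map (toHom g)) :=
  app_desc _ _ _ _ _

instance isIso_repHom (b : B) (c : C) : IsIso (repHom (K := K) T b c) := by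
  refine ⟨repInv T b c, rep_hom_ext ?_, conv_hom_ext fun φ f g => ?_⟩
  · rw [app_comp, app_repHom, app_repInv, app_id]
    simp
  · rw [app_comp, app_repInv, app_repHom, app_id, cmk_rep T φ f g]

end Day

/-! ### Functors out of the naive tensor product -/

namespace NaiveTensor

variable {K : Type u} [Field K] {X Y : Type u} [SmallCategory X] [SmallCategory Y]
variable [Preadditive X] [Preadditive Y] [Linear K X] [Linear K Y]

lemma tmul_comp {x x' x'' : X} {y y' y'' : Y} (f : x ⟶ x') (g : y ⟶ y') (f' : x' ⟶ x'')
    (g' : y' ⟶ y'') :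
    tmul (K := K) f g ≫ tmul f' g' = tmul (f ≫ f') (g ≫ g') :=
  compMap_tmul (p := ⟨x, y⟩) (q := ⟨x', y'⟩) (r := ⟨x'', y''⟩) f g f' g'

lemma hom_induction {p q : NaiveTensor K X Y} {motive : (p ⟶ q) → Prop} (zero : motive 0)
    (tmul : ∀ (f : p.fst ⟶ q.fst) (g : p.snd ⟶ q.snd), motive (tmul f g))
    (add : ∀ f g : p ⟶ q, motive f → motive g → motive (f + g)) (f : p ⟶ q) : motive f :=
  TensorProduct.induction_on f zero tmul add

variable {E : Type w} [Category.{u} E] [Preadditive E]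

lemma naturality_of_tmul {q q' : NaiveTensor K X Y ⥤ E} [q.Additive] [q'.Additive]
    {a : ∀ p, q.obj p ⟶ q'.obj p}
    (h : ∀ {x x' : X} {y y' : Y} (f : x ⟶ x') (g : y ⟶ y'),
      q.map (tmul f g) ≫ a ⟨x', y'⟩ = a ⟨x, y⟩ ≫ q'.map (tmul f g))
    {p p' : NaiveTensor K X Y} (f : p ⟶ p') : q.map f ≫ a p' = a p ≫ q'.map f := by
  induction f using hom_induction with
  | zero => simp
  | tmul f g => exact h f g
  | add f g hf hg =>
    rw [q.map_add, q'.map_add, Preadditive.add_comp, Preadditive.comp_add, hf, hg]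

variable [Linear K E] (T : X ⥤ Y ⥤ E) [IsBilinear K T]

/-- The action of a bilinear functor on the morphisms of the naive tensor product. -/
noncomputable def liftHom (p q : NaiveTensor K X Y) :
    (p ⟶ q) →ₗ[K] ((T.obj p.fst).obj p.snd ⟶ (T.obj q.fst).obj q.snd) :=
  TensorProduct.lift (LinearMap.mk₂ K
    (fun (f : p.fst ⟶ q.fst) (g : p.snd ⟶ q.snd) => (T.map f).app p.snd ≫ (T.obj q.fst).map g)
    (fun f f' g => by rw [IsBilinear.map_add_left K, Preadditive.add_comp])
    (fun r f g => by rw [IsBilinear.map_smul_left, Linear.smul_comp])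
    (fun f g g' => by rw [IsBilinear.map_add_right K, Preadditive.comp_add])
    (fun r f g => by rw [IsBilinear.map_smul_right, Linear.comp_smul]))

lemma liftHom_tmul {x x' : X} {y y' : Y} (f : x ⟶ x') (g : y ⟶ y') :
    liftHom (K := K) T ⟨x, y⟩ ⟨x', y'⟩ (tmul f g) = (T.map f).app y ≫ (T.obj x').map g :=
  TensorProduct.lift.tmul _ _

lemma liftHom_id (p : NaiveTensor K X Y) : liftHom T p p (𝟙 p) = 𝟙 _ :=
  (liftHom_tmul T (𝟙 p.fst) (𝟙 p.snd)).trans (by simp)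

lemma liftHom_tmul_id {x x' : X} (f : x ⟶ x') (y : Y) :
    liftHom (K := K) T ⟨x, y⟩ ⟨x', y⟩ (tmul f (𝟙 y)) = (T.map f).app y := by
  rw [liftHom_tmul, CategoryTheory.Functor.map_id, Category.comp_id]

lemma liftHom_id_tmul (x : X) {y y' : Y} (g : y ⟶ y') :
    liftHom (K := K) T ⟨x, y⟩ ⟨x, y'⟩ (tmul (𝟙 x) g) = (T.obj x).map g := by
  rw [liftHom_tmul, CategoryTheory.Functor.map_id, NatTrans.id_app, Category.id_comp]

lemma liftHom_comp {p q r : NaiveTensor K X Y} (f : p ⟶ q) (g : q ⟶ r) :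
    liftHom T p r (f ≫ g) = liftHom T p q f ≫ liftHom T q r g := by
  induction f using hom_induction with
  | zero => simp
  | add f f' hf hf' => rw [Preadditive.add_comp, map_add, map_add, hf, hf', Preadditive.add_comp]
  | tmul f₁ f₂ =>
    induction g using hom_induction with
    | zero => simp
    | add g g' hg hg' =>
      rw [Preadditive.comp_add, map_add, map_add, hg, hg', Preadditive.comp_add]
    | tmul g₁ g₂ =>
      rw [tmul_comp, liftHom_tmul, liftHom_tmul, liftHom_tmul]
      simp

end NaiveTensor

open MonoidalLeftAction MonoidalRightAction

/-! ### The universal property of the naive balanced tensor product -/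

section NaiveBalancedFunctor

variable (K : Type u) [Field K] (A : Type u) [SmallCategory A] [MonoidalCategory A]
variable (X : Type u) [SmallCategory X] [Preadditive X] [Linear K X] [MonoidalRightAction A X]
variable (Y : Type u) [SmallCategory Y] [Preadditive Y] [Linear K Y] [MonoidalLeftAction A Y]
variable (E : Type w) [Category.{u} E] [Preadditive E] [Linear K E]

/-- A balanced functor between small categories: a bilinear functor of two variables with a
coherent balancing isomorphism, and no cocontinuity condition. -/
structure NaiveBalancedFunctor where
  /-- the functor of two variables -/
  functor : X ⥤ Y ⥤ E
  bilinear : IsBilinear K functor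
  /-- the balancing isomorphism -/
  bal : ∀ (x : X) (a : A) (y : Y),
    (functor.obj (x ⊙ᵣ a)).obj y ≅ (functor.obj x).obj (a ⊙ₗ y)
  bal_nat : ∀ {x x' : X} {a a' : A} {y y' : Y} (f : x ⟶ x') (g : a ⟶ a') (h : y ⟶ y'),
    ((functor.map (f ⊙ᵣₘ g)).app y ≫ (functor.obj (x' ⊙ᵣ a')).map h) ≫ (bal x' a' y').hom =
      (bal x a y).hom ≫ (functor.map f).app (a ⊙ₗ y) ≫ (functor.obj x').map (g ⊙ₗₘ h)
  pentagon : ∀ (x : X) (a b : A) (y : Y),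
    (bal (x ⊙ᵣ a) b y).hom ≫ (bal x a (b ⊙ₗ y)).hom =
      (functor.map (αᵣ x a b).inv).app y ≫ (bal x (a ⊗ b) y).hom ≫
        (functor.obj x).map (αₗ a b y).hom
  triangle : ∀ (x : X) (y : Y),
    (bal x (𝟙_ A) y).hom ≫ (functor.obj x).map (λₗ y).hom = (functor.map (ρᵣ x).hom).app y

namespace NaiveBalancedFunctor

variable {K A X Y E}

instance (P : NaiveBalancedFunctor K A X Y E) : IsBilinear K P.functor := P.bilinear

/-- A morphism of naive balanced functors: a natural transformation compatible with the balancing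
isomorphisms. -/
@[ext]
structure Hom (P Q : NaiveBalancedFunctor K A X Y E) where
  /-- the natural transformation -/
  hom : P.functor ⟶ Q.functor
  comm : ∀ (x : X) (a : A) (y : Y),
    (hom.app (x ⊙ᵣ a)).app y ≫ (Q.bal x a y).hom = (P.bal x a y).hom ≫ (hom.app x).app (a ⊙ₗ y)

instance category : Category (NaiveBalancedFunctor K A X Y E) where
  Hom P Q := Hom P Q
  id P := { hom := 𝟙 _, comm := by simp }
  comp η θ :=
    { hom := η.hom ≫ θ.hom
      comm := fun x a y => by
        simp only [NatTrans.comp_app, Category.assoc, θ.comm]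
        rw [← Category.assoc, η.comm, Category.assoc] }
  id_comp η := Hom.ext (Category.id_comp _)
  comp_id η := Hom.ext (Category.comp_id _)
  assoc η θ κ := Hom.ext (Category.assoc _ _ _)

/-- A natural isomorphism compatible with the balancing isomorphisms, as an isomorphism of naive
balanced functors. -/
def isoMk {P Q : NaiveBalancedFunctor K A X Y E} (e : P.functor ≅ Q.functor)
    (comm : ∀ (x : X) (a : A) (y : Y),
      (e.hom.app (x ⊙ᵣ a)).app y ≫ (Q.bal x a y).hom =
        (P.bal x a y).hom ≫ (e.hom.app x).app (a ⊙ₗ y)) : P ≅ Q where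
  hom := { hom := e.hom, comm := comm }
  inv :=
    { hom := e.inv
      comm := fun x a y => by
        let e' (x : X) (y : Y) : (P.functor.obj x).obj y ≅ (Q.functor.obj x).obj y :=
          (e.app x).app y
        exact (e' (x ⊙ᵣ a) y).inv_comp_eq.mpr
          (((e' x (a ⊙ₗ y)).eq_comp_inv.mpr (comm x a y).symm).trans (Category.assoc _ _ _)) }
  hom_inv_id := Hom.ext e.hom_inv_id
  inv_hom_id := Hom.ext e.inv_hom_id

variable {W : Type v} [Category.{u} W] [Preadditive W] [Linear K W]

/-- The naive balanced functor obtained from a naive balanced functor by composing it with a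
`K`-linear functor. -/
def postcomp (P : NaiveBalancedFunctor K A X Y W) (G : LinearFunctor K W E) :
    NaiveBalancedFunctor K A X Y E where
  functor := P.functor ⋙ (Functor.whiskeringRight Y W E).obj G.obj
  bilinear :=
    { map_add_left := fun f g y => by simp [P.bilinear.map_add_left]
      map_smul_left := fun r f y => by simp [P.bilinear.map_smul_left]
      map_add_right := fun x _ _ f g => by simp [P.bilinear.map_add_right]
      map_smul_right := fun x _ _ r f => by simp [P.bilinear.map_smul_right] }
  bal x a y := G.obj.mapIso (P.bal x a y)
  bal_nat f g h := by simpa using congrArg G.obj.map (P.bal_nat f g h)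
  pentagon x a b y := by simpa using congrArg G.obj.map (P.pentagon x a b y)
  triangle x y := by simpa using congrArg G.obj.map (P.triangle x y)

/-- Composition with a naive balanced functor `P`, as a functor from `K`-linear functors to naive
balanced functors. -/
def postcompFunctor (P : NaiveBalancedFunctor K A X Y W) (E : Type w) [Category.{u} E]
    [Preadditive E] [Linear K E] : LinearFunctor K W E ⥤ NaiveBalancedFunctor K A X Y E where
  obj G := P.postcomp G
  map η :=
    { hom := Functor.whiskerLeft P.functor ((Functor.whiskeringRight Y W E).map η.hom)
      comm := fun x a y => (η.hom.naturality (P.bal x a y).hom).symm }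

end NaiveBalancedFunctor

namespace NaiveBalancedTensor

open NaiveTensor

variable {K A X Y}

variable (K A X Y) in
/-- The canonical functor from the naive tensor product. -/
noncomputable def ofTensor : NaiveTensor K X Y ⥤ NaiveBalancedTensor K A X Y where
  obj p := ⟨p⟩
  map f := homMk (.of f)
  map_comp f g := homMk_eq (Rel.of_comp f g)

instance : (ofTensor K A X Y).Additive where
  map_add {_ _ f g} := homMk_eq (Rel.of_add f g)

instance : (ofTensor K A X Y).Linear K where
  map_smul f r := homMk_eq (Rel.of_smul r f)

/-- The morphism `f ⊗ g` of the naive balanced tensor product. -/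
noncomputable abbrev tens {x x' : X} {y y' : Y} (f : x ⟶ x') (g : y ⟶ y') :
    (⟨⟨x, y⟩⟩ : NaiveBalancedTensor K A X Y) ⟶ ⟨⟨x', y'⟩⟩ := (ofTensor K A X Y).map (tmul f g)

lemma tens_comp {x x' x'' : X} {y y' y'' : Y} (f : x ⟶ x') (g : y ⟶ y') (f' : x' ⟶ x'')
    (g' : y' ⟶ y'') :
    tens (K := K) (A := A) f g ≫ tens f' g' = tens (f ≫ f') (g ≫ g') :=
  ((ofTensor K A X Y).map_comp _ _).symm.trans
    (congrArg (ofTensor K A X Y).map (tmul_comp f g f' g'))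

variable (K A X Y) in
/-- The canonical functor of two variables to the naive balanced tensor product. -/
noncomputable abbrev incl : X ⥤ Y ⥤ NaiveBalancedTensor K A X Y where
  obj x :=
    { obj := fun y => ⟨⟨x, y⟩⟩
      map := fun g => tens (𝟙 x) g
      map_id := fun y => rfl
      map_comp := fun g g' => by rw [tens_comp, Category.id_comp] }
  map f :=
    { app := fun y => tens f (𝟙 y)
      naturality := fun y y' g => by simp only [tens_comp, Category.id_comp, Category.comp_id] }
  map_id x := rfl
  map_comp f f' := by
    ext y
    exact (congrArg _ (Category.id_comp (𝟙 y)).symm).trans (tens_comp f (𝟙 y) f' (𝟙 y)).symm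

instance isBilinear_incl : IsBilinear K (incl K A X Y) where
  map_add_left f g y :=
    (congrArg (ofTensor K A X Y).map (TensorProduct.add_tmul f g (𝟙 y))).trans
      (ofTensor K A X Y).map_add
  map_smul_left r f y :=
    (congrArg (ofTensor K A X Y).map (TensorProduct.smul_tmul' r f (𝟙 y)).symm).trans
      ((ofTensor K A X Y).map_smul _ _)
  map_add_right x _ _ f g :=
    (congrArg (ofTensor K A X Y).map (TensorProduct.tmul_add (𝟙 x) f g)).trans
      (ofTensor K A X Y).map_add
  map_smul_right x _ _ r f :=
    (congrArg (ofTensor K A X Y).map (TensorProduct.tmul_smul r (𝟙 x) f)).trans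
      ((ofTensor K A X Y).map_smul _ _)

lemma tens_eq {x x' : X} {y y' : Y} (f : x ⟶ x') (g : y ⟶ y') :
    tens (K := K) (A := A) f g =
      ((incl K A X Y).map f).app y ≫ ((incl K A X Y).obj x').map g := by
  simp only [tens_comp, Category.id_comp, Category.comp_id]

/-- The canonical balancing isomorphism of the naive balanced tensor product. -/
noncomputable def balIso (x : X) (a : A) (y : Y) :
    (⟨⟨x ⊙ᵣ a, y⟩⟩ : NaiveBalancedTensor K A X Y) ≅ ⟨⟨x, a ⊙ₗ y⟩⟩ where
  hom := homMk (.bal x a y)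
  inv := homMk (.balInv x a y)
  hom_inv_id := homMk_eq (Rel.bal_balInv x a y)
  inv_hom_id := homMk_eq (Rel.balInv_bal x a y)

lemma balIso_nat {x x' : X} {a a' : A} {y y' : Y} (f : x ⟶ x') (g : a ⟶ a') (h : y ⟶ y') :
    tens (K := K) (f ⊙ᵣₘ g) h ≫ (balIso x' a' y').hom = (balIso x a y).hom ≫ tens f (g ⊙ₗₘ h) :=
  homMk_eq (Rel.bal_nat f g h)

lemma balIso_pentagon (x : X) (a b : A) (y : Y) :
    (balIso (K := K) (x ⊙ᵣ a) b y).hom ≫ (balIso x a (b ⊙ₗ y)).hom =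
      tens (αᵣ x a b).inv (𝟙 y) ≫ (balIso x (a ⊗ b) y).hom ≫ tens (𝟙 x) (αₗ a b y).hom :=
  homMk_eq (Rel.pentagon x a b y)

lemma balIso_triangle (x : X) (y : Y) :
    (balIso (K := K) x (𝟙_ A) y).hom ≫ tens (𝟙 x) (λₗ y).hom = tens (ρᵣ x).hom (𝟙 y) :=
  homMk_eq (Rel.unit x y)

variable (K A X Y) in
/-- The canonical balanced functor to the naive balanced tensor product. -/
noncomputable def balancedIncl : NaiveBalancedFunctor K A X Y (NaiveBalancedTensor K A X Y) where
  functor := incl K A X Y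
  bilinear := inferInstance
  bal := balIso
  bal_nat f g h :=
    (congrArg (· ≫ _) (tens_eq _ h)).symm.trans
      ((balIso_nat f g h).trans (congrArg (_ ≫ ·) (tens_eq f _)))
  pentagon := balIso_pentagon
  triangle := balIso_triangle

lemma naturality_comp {C : Type*} {D : Type*} [Category* C] [Category* D] {F G : C ⥤ D} {x y z : C}
    {f : x ⟶ y} {g : y ⟶ z} {a : F.obj x ⟶ G.obj x} {b : F.obj y ⟶ G.obj y}
    {c : F.obj z ⟶ G.obj z} (hf : F.map f ≫ b = a ≫ G.map f) (hg : F.map g ≫ c = b ≫ G.map g) :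
    F.map (f ≫ g) ≫ c = a ≫ G.map (f ≫ g) := by
  rw [F.map_comp, G.map_comp, Category.assoc, hg, ← Category.assoc, hf, Category.assoc]

lemma naturality_of_generators {E : Type w} [Category.{u} E] [Preadditive E] [Linear K E]
    {q q' : NaiveBalancedTensor K A X Y ⥤ E} [q.Additive] [q.Linear K] [q'.Additive]
    [q'.Linear K] {a : ∀ p, q.obj p ⟶ q'.obj p}
    (h_tens : ∀ {x x' : X} {y y' : Y} (f : x ⟶ x') (g : y ⟶ y'),
      q.map (tens (K := K) (A := A) f g) ≫ a ⟨⟨x', y'⟩⟩ =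
        a ⟨⟨x, y⟩⟩ ≫ q'.map (tens f g))
    (h_bal : ∀ (x : X) (c : A) (y : Y),
      q.map (balIso x c y).hom ≫ a ⟨⟨x, c ⊙ₗ y⟩⟩ = a ⟨⟨x ⊙ᵣ c, y⟩⟩ ≫ q'.map (balIso x c y).hom)
    {p p' : NaiveBalancedTensor K A X Y} (f : p ⟶ p') : q.map f ≫ a p' = a p ≫ q'.map f := by
  obtain ⟨w, rfl⟩ := homMk_surjective f
  obtain ⟨p⟩ := p
  obtain ⟨p'⟩ := p'
  change Word K A X Y p p' at w
  induction w with
  | of f =>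
    exact naturality_of_tmul (q := ofTensor K A X Y ⋙ q) (q' := ofTensor K A X Y ⋙ q')
      (a := fun p => a ⟨p⟩) h_tens f
  | bal x c y => exact h_bal x c y
  | balInv x c y =>
    exact ((q.mapIso (balIso x c y)).inv_comp_eq.mpr
      (((q'.mapIso (balIso x c y)).eq_comp_inv.mpr (h_bal x c y).symm).trans
        (Category.assoc _ _ _)))
  | comp f g hf hg => exact naturality_comp hf hg
  | add f g hf hg =>
    change q.map (homMk f + homMk g) ≫ _ = _ ≫ q'.map (homMk f + homMk g)
    rw [q.map_add, q'.map_add, Preadditive.add_comp, Preadditive.comp_add, hf, hg]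
  | smul c f hf =>
    change q.map (c • homMk f) ≫ _ = _ ≫ q'.map (c • homMk f)
    rw [q.map_smul, q'.map_smul, Linear.smul_comp, Linear.comp_smul, hf]

end NaiveBalancedTensor

namespace NaiveBalancedFunctor

open NaiveTensor NaiveBalancedTensor

variable {K A X Y E}
variable (P : NaiveBalancedFunctor K A X Y E)

/-- The value of a balanced functor on a formal expression. -/
noncomputable def wordMap : ∀ {p q : NaiveTensor K X Y}, Word K A X Y p q →
    ((P.functor.obj p.fst).obj p.snd ⟶ (P.functor.obj q.fst).obj q.snd)
  | p, q, .of f => liftHom P.functor p q f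
  | _, _, .bal x a y => (P.bal x a y).hom
  | _, _, .balInv x a y => (P.bal x a y).inv
  | _, _, .comp f g => wordMap f ≫ wordMap g
  | _, _, .add f g => wordMap f + wordMap g
  | _, _, .smul c f => c • wordMap f

lemma wordMap_eq {p q : NaiveTensor K X Y} {f g : Word K A X Y p q} (h : Rel f g) :
    P.wordMap f = P.wordMap g := by
  induction h with
  | refl f => rfl
  | symm _ ih => exact ih.symm
  | trans _ _ ih ih' => exact ih.trans ih'
  | comp_congr _ _ ih ih' => simp only [wordMap, ih, ih']
  | add_congr _ _ ih ih' => simp only [wordMap, ih, ih']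
  | smul_congr c _ ih => simp only [wordMap, ih]
  | id_comp f => simp only [wordMap, liftHom_id, Category.id_comp]
  | comp_id f => simp only [wordMap, liftHom_id, Category.comp_id]
  | assoc f g h => simp only [wordMap, Category.assoc]
  | add_assoc f g h => simp only [wordMap, add_assoc]
  | add_comm f g => simp only [wordMap, add_comm]
  | zero_add f => simp only [wordMap, map_zero, zero_add]
  | neg_add f => simp only [wordMap, map_zero, neg_smul, one_smul, neg_add_cancel]
  | one_smul f => simp only [wordMap, one_smul]
  | mul_smul c c' f => simp only [wordMap, mul_smul]
  | smul_add c f g => simp only [wordMap, smul_add]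
  | add_smul c c' f => simp only [wordMap, add_smul]
  | add_comp f f' g => simp only [wordMap, Preadditive.add_comp]
  | comp_add f g g' => simp only [wordMap, Preadditive.comp_add]
  | smul_comp c f g => simp only [wordMap, Linear.smul_comp]
  | comp_smul c f g => simp only [wordMap, Linear.comp_smul]
  | of_comp f g => simp only [wordMap, liftHom_comp]
  | of_add f g => simp only [wordMap, map_add]
  | of_smul c f => simp only [wordMap, map_smul]
  | bal_balInv x a y => exact (P.bal x a y).hom_inv_id.trans (liftHom_id P.functor ⟨x ⊙ᵣ a, y⟩).symm
  | balInv_bal x a y => exact (P.bal x a y).inv_hom_id.trans (liftHom_id P.functor ⟨x, a ⊙ₗ y⟩).symm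
  | bal_nat f g h =>
    exact (congrArg (· ≫ _) (liftHom_tmul P.functor _ _)).trans ((P.bal_nat f g h).trans
      (congrArg (_ ≫ ·) (liftHom_tmul P.functor _ _).symm))
  | pentagon x a b y =>
    exact (P.pentagon x a b y).trans (congrArg₂ (· ≫ ·) (liftHom_tmul_id P.functor _ y).symm
      (congrArg ((P.bal x (a ⊗ b) y).hom ≫ ·) (liftHom_id_tmul P.functor x _).symm))
  | unit x y =>
    exact (congrArg (_ ≫ ·) (liftHom_id_tmul P.functor x _)).trans
      ((P.triangle x y).trans (liftHom_tmul_id P.functor _ y).symm)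

/-- The linear functor out of the naive balanced tensor product determined by a balanced
functor. -/
noncomputable def lift : NaiveBalancedTensor K A X Y ⥤ E where
  obj p := (P.functor.obj p.obj.fst).obj p.obj.snd
  map {p q} f := Quotient.lift (s := setoid K A X Y p.obj q.obj) P.wordMap
    (fun _ _ h => P.wordMap_eq h) f
  map_id p := liftHom_id P.functor p.obj
  map_comp f g := by
    obtain ⟨f, rfl⟩ := homMk_surjective f
    obtain ⟨g, rfl⟩ := homMk_surjective g
    rfl

instance : P.lift.Additive where
  map_add {_ _ f g} := by
    obtain ⟨f, rfl⟩ := homMk_surjective f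
    obtain ⟨g, rfl⟩ := homMk_surjective g
    rfl

instance : P.lift.Linear K where
  map_smul f r := by
    obtain ⟨f, rfl⟩ := homMk_surjective f
    rfl

/-- The restriction of the linear functor determined by a balanced functor. -/
noncomputable def postcompLiftIso :
    (balancedIncl K A X Y).postcomp ⟨P.lift, inferInstance, inferInstance⟩ ≅ P :=
  isoMk
    (NatIso.ofComponents
      (fun x => NatIso.ofComponents (fun y => Iso.refl _) fun g => by
        exact (Category.comp_id _).trans
          ((liftHom_id_tmul P.functor x g).trans (Category.id_comp _).symm))
      fun f => by
        ext y
        exact (Category.comp_id _).trans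
          ((liftHom_tmul_id P.functor f y).trans (Category.id_comp _).symm))
    fun x a y => (Category.id_comp _).trans (Category.comp_id _).symm

end NaiveBalancedFunctor

namespace NaiveBalancedTensor

variable {K A X Y E}

instance : ((balancedIncl K A X Y).postcompFunctor E).Faithful where
  map_injective {q q' η θ} h := by
    ext ⟨⟨x, y⟩⟩
    exact congrArg (fun α => (α.hom.app x).app y) h

instance : ((balancedIncl K A X Y).postcompFunctor E).Full where
  map_surjective {q q'} α := by
    have h_tens {x x' : X} {y y' : Y} (f : x ⟶ x') (g : y ⟶ y') :
        q.obj.map (tens f g) ≫ (α.hom.app x').app y' =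
          (α.hom.app x).app y ≫ q'.obj.map (tens f g) := by
      rw [tens_eq]
      have h₁ : q.obj.map (tens f (𝟙 y)) ≫ (α.hom.app x').app y =
          (α.hom.app x).app y ≫ q'.obj.map (tens f (𝟙 y)) :=
        NatTrans.congr_app (α.hom.naturality f) y
      have h₂ : q.obj.map (tens (𝟙 x') g) ≫ (α.hom.app x').app y' =
          (α.hom.app x').app y ≫ q'.obj.map (tens (𝟙 x') g) := (α.hom.app x').naturality g
      exact naturality_comp h₁ h₂
    exact ⟨ObjectProperty.homMk
      { app := fun p => (α.hom.app p.obj.fst).app p.obj.snd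
        naturality := fun p p' f =>
          naturality_of_generators (q := q.obj) (q' := q'.obj)
          (a := fun p => (α.hom.app p.obj.fst).app p.obj.snd) h_tens
          (fun x c y => (α.comm x c y).symm) f },
      rfl⟩

instance : ((balancedIncl K A X Y).postcompFunctor E).EssSurj where
  mem_essImage P := ⟨_, ⟨P.postcompLiftIso⟩⟩

instance : ((balancedIncl K A X Y).postcompFunctor E).IsEquivalence where

end NaiveBalancedTensor

end NaiveBalancedFunctor

namespace NaiveBalancedTensor

open FreeCocompletion Day

variable {K : Type u} [Field K] {A X Y : Type u}
variable [SmallCategory A] [SmallCategory X] [SmallCategory Y]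
variable [Preadditive X] [Preadditive Y] [Linear K X] [Linear K Y]
variable [MonoidalCategory A] [MonoidalRightAction A X] [MonoidalLeftAction A Y]

lemma balIso_nat_left {x x' : X} (f : x ⟶ x') (a : A) (y : Y) :
    tens (K := K) (f ⊵ᵣ a) (𝟙 y) ≫ (balIso x' a y).hom =
      (balIso x a y).hom ≫ tens f (𝟙 (a ⊙ₗ y)) := by
  simpa using balIso_nat (K := K) f (𝟙 a) (𝟙 y)

lemma balIso_nat_middle (x : X) {a a' : A} (g : a ⟶ a') (y : Y) :
    tens (K := K) (x ⊴ᵣ g) (𝟙 y) ≫ (balIso x a' y).hom =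
      (balIso x a y).hom ≫ tens (𝟙 x) (g ⊵ₗ y) := by
  simpa using balIso_nat (K := K) (𝟙 x) g (𝟙 y)

lemma balIso_nat_right (x : X) (a : A) {y y' : Y} (h : y ⟶ y') :
    tens (K := K) (𝟙 (x ⊙ᵣ a)) h ≫ (balIso x a y').hom =
      (balIso x a y).hom ≫ tens (𝟙 x) (a ⊴ₗ h) := by
  simpa using balIso_nat (K := K) (𝟙 x) (𝟙 a) h

lemma comp_balIso_pentagon {e : NaiveBalancedTensor K A X Y} {x b₁ c₁ : X} {c₂ b₂ : A} {b₃ : Y}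
    (φ : e ⟶ ⟨⟨x, b₃⟩⟩) (ψ : x ⟶ b₁ ⊙ᵣ b₂) (χ : b₁ ⟶ c₁ ⊙ᵣ c₂) :
    (φ ≫ tens (ψ ≫ χ ⊵ᵣ b₂ ≫ (αᵣ c₁ c₂ b₂).inv) (𝟙 b₃) ≫ (balIso c₁ (c₂ ⊗ b₂) b₃).hom) ≫
      tens (𝟙 c₁) (𝟙 ((c₂ ⊗ b₂) ⊙ₗ b₃) ≫ (𝟙 (c₂ ⊗ b₂)) ⊵ₗ b₃ ≫ (αₗ c₂ b₂ b₃).hom) =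
      (φ ≫ tens ψ (𝟙 b₃) ≫ (balIso b₁ b₂ b₃).hom) ≫ tens χ (𝟙 (b₂ ⊙ₗ b₃)) ≫
        (balIso c₁ c₂ (b₂ ⊙ₗ b₃)).hom := by
  have h : tens (K := K) (ψ ≫ χ ⊵ᵣ b₂ ≫ (αᵣ c₁ c₂ b₂).inv) (𝟙 b₃) =
      tens ψ (𝟙 b₃) ≫ tens (χ ⊵ᵣ b₂) (𝟙 b₃) ≫ tens (A := A) (αᵣ c₁ c₂ b₂).inv (𝟙 b₃) := by
    simp [tens_comp]
  have n := balIso_nat_left (K := K) χ b₂ b₃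
  have p := balIso_pentagon (K := K) c₁ c₂ b₂ b₃
  simp only [MonoidalLeftAction.id_actionHomLeft, Category.id_comp, h, Category.assoc]
  rw [← reassoc_of% n, ← p]

lemma comp_balIso_triangle {e : NaiveBalancedTensor K A X Y} {x b₁ : X} {b₂ : A} {b₃ : Y}
    (φ : e ⟶ ⟨⟨x, b₃⟩⟩) (ψ : x ⟶ b₁ ⊙ᵣ b₂) (s : b₂ ⟶ 𝟙_ A) :
    (φ ≫ tens ψ (𝟙 b₃) ≫ (balIso b₁ b₂ b₃).hom) ≫
      tens (𝟙 b₁) (𝟙 (b₂ ⊙ₗ b₃) ≫ s ⊵ₗ b₃ ≫ (λₗ b₃).hom) =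
      φ ≫ tens (ψ ≫ b₁ ⊴ᵣ s ≫ (ρᵣ b₁).hom) (𝟙 b₃) := by
  have n := balIso_nat_middle (K := K) b₁ s b₃
  have p := balIso_triangle (K := K) (A := A) b₁ b₃
  have h : tens (K := K) (A := A) (ψ ≫ b₁ ⊴ᵣ s ≫ (ρᵣ b₁).hom) (𝟙 b₃) =
      tens ψ (𝟙 b₃) ≫ tens (b₁ ⊴ᵣ s) (𝟙 b₃) ≫ tens (ρᵣ b₁).hom (𝟙 b₃) := by
    simp [tens_comp]
  have h' : tens (K := K) (A := A) (𝟙 b₁) (𝟙 (b₂ ⊙ₗ b₃) ≫ s ⊵ₗ b₃ ≫ (λₗ b₃).hom) =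
      tens (𝟙 b₁) (s ⊵ₗ b₃) ≫ tens (𝟙 b₁) (λₗ b₃).hom := by
    simp [tens_comp]
  rw [h, h', ← p]
  simp only [Category.assoc]
  rw [reassoc_of% n]

variable (K A X Y) in
/-- The balancing isomorphisms of the naive balanced tensor product, as associativity
isomorphisms. -/
noncomputable def inclAssoc : Assoc (rightActionBifunctor A X) (incl K A X Y)
    (leftActionBifunctor A Y) (incl K A X Y) where
  iso x a y := balIso x a y
  nat₁ f a y := balIso_nat_left f a y
  nat₂ x _ _ f y := balIso_nat_middle x f y
  nat₃ x a _ _ f := balIso_nat_right x a f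

variable [Preadditive A] [Linear K A]
variable [MonoidalPreadditive A] [MonoidalLinear K A]
variable [LinearRightAction K A X] [LinearLeftAction K A Y]

variable (K A X Y) in
/-- Day convolution along `incl`, as a balanced functor to the free cocompletion of the naive
balanced tensor product; the balancing is the associativity isomorphism of `inclAssoc`. -/
noncomputable def balancedConv : BalancedFunctor K (FreeCocompletion K A) (FreeCocompletion K X)
    (FreeCocompletion K Y) (FreeCocompletion K (NaiveBalancedTensor K A X Y)) where
  functor := convFunctor K (incl K A X Y)
  bilinear := inferInstance
  cocont_left G := (isLinearCocontinuous_convFunctor_flip_obj _ G).2.2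
  cocont_right F := (isLinearCocontinuous_convFunctor_obj _ F).2.2
  bal F C G := (inclAssoc K A X Y).convIso F C G
  bal_nat {F F' C C' G G'} f g h := by
    change (map _ (map _ f g) (𝟙 G) ≫ map _ (𝟙 _) h) ≫ (inclAssoc K A X Y).hom F' C' G' =
      (inclAssoc K A X Y).hom F C G ≫ map _ f (𝟙 _) ≫ map _ (𝟙 F') (map _ g h)
    rw [← map_comp, ← map_comp, Category.comp_id, Category.id_comp, Category.comp_id,
      Category.id_comp, Assoc.hom_naturality]
  pentagon F C D G := by
    change (inclAssoc K A X Y).hom _ D G ≫ (inclAssoc K A X Y).hom F C _ =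
      map _ ((rightAssoc A X).hom F C D) (𝟙 G) ≫ (inclAssoc K A X Y).hom F _ G ≫
      map _ (𝟙 F) ((leftAssoc A Y).hom C D G)
    symm
    apply Assoc.ext_left
    intro e x b₃ φ b₁ b₂ ψ P s₂ s₃
    induction P using cind with
    | @h_mk c₁ c₂ χ s t =>
      simp only [app_comp, app_map_cmk, Assoc.app_hom, app_id]
      rw [cmk_cmk_right (s₁ := s)]
      exact congrArg (fun κ => cmk κ s _) (comp_balIso_pentagon φ ψ χ)
    | h_zero => simp
    | h_add x y hx hy => simp only [cmk_add_left, map_add, hx, hy]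
  triangle F G := by
    change (inclAssoc K A X Y).hom F _ G ≫ map _ (𝟙 F) (leftUnitHom _ _ (leftActionUnit A Y) G) =
      map _ (rightUnitHom _ _ (rightActionUnit A X) F) (𝟙 G)
    apply Assoc.ext_left
    intro e x b₃ φ b₁ b₂ ψ s₁ s₂ s₃
    simp only [app_comp, app_map_cmk, Assoc.app_hom, app_id, app_rightUnitHom, app_leftUnitHom,
      cmk_res_left, cmk_res_right]
    exact congrArg (fun κ => cmk κ s₁ s₃) (comp_balIso_triangle φ ψ (toHom s₂))

end NaiveBalancedTensor

/-! ### Functors of two variables -/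

section

variable {B C D : Type*} [Category* B] [Category* C] [Category* D]

/-- The action of a functor of two variables on a pair of morphisms. -/
def bimap (T : B ⥤ C ⥤ D) {b b' : B} {c c' : C} (f : b ⟶ b') (g : c ⟶ c') :
    (T.obj b).obj c ⟶ (T.obj b').obj c' :=
  (T.map f).app c ≫ (T.obj b').map g

section

variable (T : B ⥤ C ⥤ D)

lemma bimap_id_right {b b' : B} (f : b ⟶ b') (c : C) : bimap T f (𝟙 c) = (T.map f).app c := by
  simp [bimap]

lemma bimap_id_left (b : B) {c c' : C} (g : c ⟶ c') : bimap T (𝟙 b) g = (T.obj b).map g := by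
  simp [bimap]

lemma bimap_comp {b b' b'' : B} {c c' c'' : C} (f : b ⟶ b') (f' : b' ⟶ b'') (g : c ⟶ c')
    (g' : c' ⟶ c'') : bimap T (f ≫ f') (g ≫ g') = bimap T f g ≫ bimap T f' g' := by
  simp [bimap]

lemma bimap_comp_left {b b' b'' : B} (f : b ⟶ b') (f' : b' ⟶ b'') (c : C) :
    bimap T (f ≫ f') (𝟙 c) = bimap T f (𝟙 c) ≫ bimap T f' (𝟙 c) := by
  simp [bimap]

lemma bimap_comp_right (b : B) {c c' c'' : C} (g : c ⟶ c') (g' : c' ⟶ c'') :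
    bimap T (𝟙 b) (g ≫ g') = bimap T (𝟙 b) g ≫ bimap T (𝟙 b) g' := by
  simp [bimap]

lemma bimap_exchange {b b' : B} {c c' : C} (f : b ⟶ b') (g : c ⟶ c') :
    bimap T (𝟙 b) g ≫ bimap T f (𝟙 c') = bimap T f (𝟙 c) ≫ bimap T (𝟙 b') g := by
  simp [bimap]

instance {b b' : B} {c c' : C} (f : b ⟶ b') (g : c ⟶ c') [IsIso f] [IsIso g] :
    IsIso (bimap T f g) := by
  unfold bimap
  infer_instance

end

lemma bimap_naturality {T T' : B ⥤ C ⥤ D} (η : T ⟶ T') {b b' : B} {c c' : C} (f : b ⟶ b')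
    (g : c ⟶ c') :
    bimap T f g ≫ (η.app b').app c' = (η.app b).app c ≫ bimap T' f g := by
  simp only [bimap, Category.assoc, NatTrans.naturality, NatTrans.naturality_app_assoc]

end

lemma isLinearCocontinuous_comp {K : Type u} [Field K]
    {V : Type v₁} [Category.{u} V] [Preadditive V] [Linear K V]
    {W : Type v} [Category.{u} W] [Preadditive W] [Linear K W]
    {E : Type w} [Category.{u} E] [Preadditive E] [Linear K E] {F : V ⥤ W} {G : W ⥤ E}
    (hF : isLinearCocontinuous K V W F) (hG : isLinearCocontinuous K W E G) :
    isLinearCocontinuous K V E (F ⋙ G) := by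
  obtain ⟨F_add, F_smul, _⟩ := hF
  obtain ⟨G_add, G_smul, _⟩ := hG
  exact ⟨fun _ _ f g => by simp [F_add, G_add], fun _ _ r f => by simp [F_smul, G_smul],
    inferInstance⟩

/-- The property of a functor of two variables to be `K`-linear and cocontinuous in each
variable. -/
structure IsBicocontinuous (K : Type u) [Field K]
    {V : Type v₁} [Category.{u} V] [Preadditive V] [Linear K V]
    {W : Type v₂} [Category.{u} W] [Preadditive W] [Linear K W]
    {E : Type w} [Category.{u} E] [Preadditive E] [Linear K E] (T : V ⥤ W ⥤ E) : Prop where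
  obj : ∀ F, isLinearCocontinuous K W E (T.obj F)
  flip_obj : ∀ G, isLinearCocontinuous K V E (T.flip.obj G)

lemma BalancedFunctor.isBicocontinuous {K : Type u} [Field K]
    {C : Type v} [Category.{u} C] [MonoidalCategory C]
    {X : Type v₁} [Category.{u} X] [Preadditive X] [Linear K X] [MonoidalRightAction C X]
    {Y : Type v₂} [Category.{u} Y] [Preadditive Y] [Linear K Y] [MonoidalLeftAction C Y]
    {E : Type w} [Category.{u} E] [Preadditive E] [Linear K E] (P : BalancedFunctor K C X Y E) :
    IsBicocontinuous K P.functor where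
  obj x := ⟨fun _ _ => P.bilinear.map_add_right x, fun _ _ => P.bilinear.map_smul_right x,
    P.cocont_right x⟩
  flip_obj y := ⟨fun _ _ f g => P.bilinear.map_add_left f g y,
    fun _ _ r f => P.bilinear.map_smul_left r f y, P.cocont_left y⟩

lemma Day.isBicocontinuous_convFunctor {K : Type u} [Field K]
    {B C D : Type u} [SmallCategory B] [SmallCategory C] [SmallCategory D]
    [Preadditive B] [Preadditive C] [Preadditive D] [Linear K B] [Linear K C] [Linear K D]
    (T : B ⥤ C ⥤ D) : IsBicocontinuous K (convFunctor K T) :=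
  ⟨isLinearCocontinuous_convFunctor_obj T, isLinearCocontinuous_convFunctor_flip_obj T⟩

namespace IsBicocontinuous

open FreeCocompletion

section

variable {K : Type u} [Field K]
variable {V : Type v₁} [Category.{u} V] [Preadditive V] [Linear K V]
variable {W : Type v₂} [Category.{u} W] [Preadditive W] [Linear K W]
variable {E : Type w} [Category.{u} E] [Preadditive E] [Linear K E]
variable {E' : Type v} [Category.{u} E'] [Preadditive E'] [Linear K E']

lemma whiskeringRight {T : V ⥤ W ⥤ E} (hT : IsBicocontinuous K T) {G : E ⥤ E'}
    (hG : isLinearCocontinuous K E E' G) :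
    IsBicocontinuous K (T ⋙ (Functor.whiskeringRight W E E').obj G) :=
  ⟨fun F => isLinearCocontinuous_comp (hT.obj F) hG,
    fun H => isLinearCocontinuous_comp (hT.flip_obj H) hG⟩

end

variable {K : Type u} [Field K]
variable {B C : Type u} [SmallCategory B] [SmallCategory C] [Preadditive B] [Preadditive C]
variable [Linear K B] [Linear K C]
variable {E : Type w} [Category.{u} E] [Preadditive E] [Linear K E]
variable {T : FreeCocompletion K B ⥤ FreeCocompletion K C ⥤ E}

lemma hom_ext (hT : IsBicocontinuous K T) {F : FreeCocompletion K B} {G : FreeCocompletion K C}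
    {e : E} {f g : (T.obj F).obj G ⟶ e}
    (h : ∀ (b : B) (s : F.sec b) (c : C) (t : G.sec c),
      bimap T (ofSec s) (ofSec t) ≫ f = bimap T (ofSec s) (ofSec t) ≫ g) : f = g := by
  refine CocontFunctor.hom_ext (H := ⟨_, hT.flip_obj G⟩) fun b s => ?_
  refine CocontFunctor.hom_ext (H := ⟨_, hT.obj (rep K b)⟩) fun c t => ?_
  have h := h b s c t
  rw [bimap, ← NatTrans.naturality, Category.assoc, Category.assoc] at h
  exact h

end IsBicocontinuous

namespace FreeCocompletion

lemma exists_whiskerRight_whiskeringLeft_yoneda_eq {K : Type u} [Field K]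
    {Z : Type u} [SmallCategory Z] [Preadditive Z] [Linear K Z]
    {E : Type w} [Category.{u} E] [Preadditive E] [Linear K E] {J : Type*} [Category* J]
    {S S' : J ⥤ FreeCocompletion K Z ⥤ E}
    (hS : ∀ j, isLinearCocontinuous K (FreeCocompletion K Z) E (S.obj j))
    [∀ j, (S'.obj j).Additive] [∀ j, (S'.obj j).Linear K]
    (τ : S ⋙ (Functor.whiskeringLeft Z (FreeCocompletion K Z) E).obj (yoneda K Z) ⟶
      S' ⋙ (Functor.whiskeringLeft Z (FreeCocompletion K Z) E).obj (yoneda K Z)) :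
    ∃ η : S ⟶ S', Functor.whiskerRight η
      ((Functor.whiskeringLeft Z (FreeCocompletion K Z) E).obj (yoneda K Z)) = τ := by
  have h (j : J) : ∃ α : S.obj j ⟶ S'.obj j, Functor.whiskerLeft (yoneda K Z) α = τ.app j :=
    CocontFunctor.exists_whiskerLeft_yoneda_eq ⟨_, hS j⟩ (S'.obj j) (τ.app j)
  choose η hη using h
  have hη (j : J) (z : Z) : (η j).app (rep K z) = (τ.app j).app z :=
    congrArg (fun σ => σ.app z) (hη j)
  refine ⟨{ app := η, naturality := fun j j' f => ?_ }, ?_⟩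
  · ext F
    refine CocontFunctor.hom_ext (H := ⟨_, hS j⟩) fun z s => ?_
    change (S.obj j).map _ ≫ (S.map f).app F ≫ (η j').app F =
      (S.obj j).map _ ≫ (η j).app F ≫ (S'.map f).app F
    have hτ : (S.map f).app (rep K z) ≫ (τ.app j').app z =
        (τ.app j).app z ≫ (S'.map f).app (rep K z) :=
      congrArg (fun σ => σ.app z) (τ.naturality f)
    rw [NatTrans.naturality_assoc, (η j').naturality, (η j).naturality_assoc, hη, hη,
      reassoc_of% hτ, NatTrans.naturality]
  · ext j z
    exact hη j z

end FreeCocompletion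

namespace IsBicocontinuous

open FreeCocompletion

variable {K : Type u} [Field K]
variable {B C : Type u} [SmallCategory B] [SmallCategory C] [Preadditive B] [Preadditive C]
variable [Linear K B] [Linear K C]
variable {E : Type w} [Category.{u} E] [Preadditive E] [Linear K E]
variable {T T' : FreeCocompletion K B ⥤ FreeCocompletion K C ⥤ E}

/-- The transformation is extended in one variable after the other. -/
lemma exists_whiskeringLeft₂_yoneda_map_eq [IsBilinear K T'] (hT : IsBicocontinuous K T)
    (τ : (((Functor.whiskeringLeft₂ E).obj (yoneda K B)).obj (yoneda K C)).obj T ⟶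
      (((Functor.whiskeringLeft₂ E).obj (yoneda K B)).obj (yoneda K C)).obj T') :
    ∃ η : T ⟶ T', (((Functor.whiskeringLeft₂ E).obj (yoneda K B)).obj (yoneda K C)).map η = τ := by
  have (b : B) : ((yoneda K B ⋙ T').obj b).Additive := IsBilinear.additive_obj K T' (rep K b)
  have (b : B) : ((yoneda K B ⋙ T').obj b).Linear K := IsBilinear.linear_obj K T' (rep K b)
  have := IsBilinear.additive_flip_obj K T'
  have := IsBilinear.linear_flip_obj K T'
  obtain ⟨σ, hσ⟩ := exists_whiskerRight_whiskeringLeft_yoneda_eq (S := yoneda K B ⋙ T)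
    (S' := yoneda K B ⋙ T') (fun b => hT.obj (rep K b)) τ
  obtain ⟨η, hη⟩ := exists_whiskerRight_whiskeringLeft_yoneda_eq (S := T.flip) (S' := T'.flip)
    hT.flip_obj ((flipFunctor _ _ _).map σ)
  refine ⟨(flipFunctor _ _ _).map η, ?_⟩
  ext b c
  have hηc : (η.app (rep K c)).app (rep K b) = (σ.app b).app (rep K c) :=
    congrArg (fun ρ => (ρ.app (rep K c)).app b) hη
  have hσc : (σ.app b).app (rep K c) = (τ.app b).app c :=
    congrArg (fun ρ => (ρ.app b).app c) hσ
  exact hηc.trans hσc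

end IsBicocontinuous

/-! ### The actions on represented presheaves -/

namespace Day

open FreeCocompletion

variable {K : Type u} [Field K]

section

variable {B₁ B₂ B₃ B₁₂ B₂₃ D : Type u} [SmallCategory B₁] [SmallCategory B₂] [SmallCategory B₃]
variable [SmallCategory B₁₂] [SmallCategory B₂₃] [SmallCategory D]
variable [Preadditive B₁] [Preadditive B₂] [Preadditive B₃] [Preadditive B₁₂] [Preadditive B₂₃]
variable [Preadditive D] [Linear K B₁] [Linear K B₂] [Linear K B₃] [Linear K B₁₂] [Linear K B₂₃]
variable [Linear K D]
variable {S : B₁ ⥤ B₂ ⥤ B₁₂} {T : B₁₂ ⥤ B₃ ⥤ D} {U : B₂ ⥤ B₃ ⥤ B₂₃} {V : B₁ ⥤ B₂₃ ⥤ D}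

lemma Assoc.repHom_comp_hom [IsBilinear K T] (a : Assoc S T U V) (b₁ : B₁) (b₂ : B₂) (b₃ : B₃) :
    repHom (K := K) T ((S.obj b₁).obj b₂) b₃ ≫ map T (repHom S b₁ b₂) (𝟙 _) ≫
      a.hom (rep K b₁) (rep K b₂) (rep K b₃) =
    ofSec (ofHom (a.iso b₁ b₂ b₃).hom) ≫ repHom V b₁ ((U.obj b₂).obj b₃) ≫
      map V (𝟙 _) (repHom U b₂ b₃) := by
  refine rep_hom_ext ?_
  simp only [app_comp, app_ofSec, app_repHom, app_map_cmk, toHom_ofHom, res_ofHom,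
    Category.id_comp, app_id, Assoc.app_hom, CategoryTheory.Functor.map_id, NatTrans.id_app]

end

section

variable {A Y : Type u} [SmallCategory A] [SmallCategory Y]
variable [Preadditive A] [Preadditive Y] [Linear K A] [Linear K Y]

lemma repHom_comp_leftUnitHom (T : A ⥤ Y ⥤ Y) [IsBilinear K T] (e : A) (l : LeftUnit T e) (y : Y) :
    repHom (K := K) T e y ≫ leftUnitHom T e l (rep K y) = ofSec (ofHom (l.iso y).hom) := by
  refine rep_hom_ext ?_
  rw [app_comp, app_repHom, app_leftUnitHom, toHom_ofHom, res_ofHom, app_ofSec, res_ofHom,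
    toHom_ofHom, T.map_id, NatTrans.id_app, Category.id_comp, Category.id_comp, Category.comp_id]

lemma repHom_comp_rightUnitHom (T : Y ⥤ A ⥤ Y) [IsBilinear K T] (e : A) (l : RightUnit T e)
    (y : Y) :
    repHom (K := K) T y e ≫ rightUnitHom T e l (rep K y) = ofSec (ofHom (l.iso y).hom) := by
  refine rep_hom_ext ?_
  rw [app_comp, app_repHom, app_rightUnitHom, toHom_ofHom, res_ofHom, app_ofSec, res_ofHom,
    toHom_ofHom, (T.obj y).map_id, Category.id_comp, Category.id_comp, Category.comp_id]

end

end Day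

namespace FreeCocompletion

open Day

variable {K : Type u} [Field K] {A X Y : Type u}
variable [SmallCategory A] [SmallCategory X] [SmallCategory Y]
variable [Preadditive A] [Preadditive X] [Preadditive Y] [Linear K A] [Linear K X] [Linear K Y]
variable [MonoidalCategory A] [MonoidalPreadditive A] [MonoidalLinear K A]

/-- The comparison of the tensor product of `A` with Day convolution, on represented presheaves. -/
noncomputable def tensorRep (a b : A) : rep K (a ⊗ b) ⟶ rep K a ⊗ rep K b :=
  repHom (curriedTensor A) a b

section

variable [MonoidalRightAction A X] [LinearRightAction K A X]

/-- The comparison of the action on a right module with Day convolution, on represented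
presheaves. -/
noncomputable def rightRep (x : X) (a : A) : rep K (x ⊙ᵣ a) ⟶ rep K x ⊙ᵣ rep K a :=
  repHom (rightActionBifunctor A X) x a

instance (x : X) (a : A) : IsIso (rightRep (K := K) x a) :=
  inferInstanceAs (IsIso (repHom (rightActionBifunctor A X) x a))

lemma rightRep_naturality {x x' : X} {a a' : A} (f : x ⟶ x') (g : a ⟶ a') :
    ofSec (ofHom (f ⊙ᵣₘ g)) ≫ rightRep (K := K) x' a' =
      rightRep x a ≫ (ofSec (ofHom f) ⊙ᵣₘ ofSec (ofHom g)) := by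
  rw [MonoidalRightAction.actionHom_def]
  exact repHom_naturality (rightActionBifunctor A X) f g

lemma rightRep_assoc (x : X) (a b : A) :
    rightRep (K := K) (x ⊙ᵣ a) b ≫ rightRep x a ⊵ᵣ rep K b ≫ (αᵣ _ _ _).inv =
      ofSec (ofHom (αᵣ x a b).inv) ≫ rightRep x (a ⊗ b) ≫ rep K x ⊴ᵣ tensorRep a b :=
  (rightAssoc A X).repHom_comp_hom x a b

lemma rightRep_unit (x : X) :
    rightRep (K := K) x (𝟙_ A) ≫ (ρᵣ (rep K x)).hom = ofSec (ofHom (ρᵣ x).hom) :=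
  repHom_comp_rightUnitHom _ _ (rightActionUnit A X) x

end

section

variable [MonoidalLeftAction A Y] [LinearLeftAction K A Y]

/-- The comparison of the action on a left module with Day convolution, on represented
presheaves. -/
noncomputable def leftRep (a : A) (y : Y) : rep K (a ⊙ₗ y) ⟶ rep K a ⊙ₗ rep K y :=
  repHom (leftActionBifunctor A Y) a y

instance (a : A) (y : Y) : IsIso (leftRep (K := K) a y) :=
  inferInstanceAs (IsIso (repHom (leftActionBifunctor A Y) a y))

lemma leftRep_naturality {a a' : A} {y y' : Y} (g : a ⟶ a') (h : y ⟶ y') :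
    ofSec (ofHom (g ⊙ₗₘ h)) ≫ leftRep (K := K) a' y' =
      leftRep a y ≫ (ofSec (ofHom g) ⊙ₗₘ ofSec (ofHom h)) := by
  rw [MonoidalLeftAction.actionHom_def]
  exact repHom_naturality (leftActionBifunctor A Y) g h

lemma leftRep_assoc (a b : A) (y : Y) :
    leftRep (K := K) (a ⊗ b) y ≫ tensorRep a b ⊵ₗ rep K y ≫ (αₗ _ _ _).hom =
      ofSec (ofHom (αₗ a b y).hom) ≫ leftRep a (b ⊙ₗ y) ≫ rep K a ⊴ₗ leftRep b y :=
  (leftAssoc A Y).repHom_comp_hom a b y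

lemma leftRep_unit (y : Y) :
    leftRep (K := K) (𝟙_ A) y ≫ (λₗ (rep K y)).hom = ofSec (ofHom (λₗ y).hom) :=
  repHom_comp_leftUnitHom _ _ (leftActionUnit A Y) y

end

end FreeCocompletion

namespace BalancedFunctor

section

variable {K : Type u} [Field K]
variable {C : Type v} [Category.{u} C] [MonoidalCategory C]
variable {X : Type v₁} [Category.{u} X] [Preadditive X] [Linear K X] [MonoidalRightAction C X]
variable {Y : Type v₂} [Category.{u} Y] [Preadditive Y] [Linear K Y] [MonoidalLeftAction C Y]
variable {E : Type w} [Category.{u} E] [Preadditive E] [Linear K E]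
variable (P : BalancedFunctor K C X Y E)

instance : IsBilinear K P.functor := P.bilinear

lemma bimap_comp_bal {x x' : X} {c c' : C} {y y' : Y} (f : x ⟶ x') (g : c ⟶ c') (h : y ⟶ y') :
    bimap P.functor (f ⊙ᵣₘ g) h ≫ (P.bal x' c' y').hom =
      (P.bal x c y).hom ≫ bimap P.functor f (g ⊙ₗₘ h) :=
  P.bal_nat f g h

lemma bimap_comp_bal_left {x x' : X} (f : x ⟶ x') (c : C) (y : Y) :
    bimap P.functor (f ⊵ᵣ c) (𝟙 y) ≫ (P.bal x' c y).hom =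
      (P.bal x c y).hom ≫ bimap P.functor f (𝟙 (c ⊙ₗ y)) := by
  simpa using P.bimap_comp_bal f (𝟙 c) (𝟙 y)

lemma bimap_comp_bal_middle (x : X) {c c' : C} (g : c ⟶ c') (y : Y) :
    bimap P.functor (x ⊴ᵣ g) (𝟙 y) ≫ (P.bal x c' y).hom =
      (P.bal x c y).hom ≫ bimap P.functor (𝟙 x) (g ⊵ₗ y) := by
  simpa using P.bimap_comp_bal (𝟙 x) g (𝟙 y)

lemma bimap_comp_bal_right (x : X) (c : C) {y y' : Y} (h : y ⟶ y') :
    bimap P.functor (𝟙 (x ⊙ᵣ c)) h ≫ (P.bal x c y').hom =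
      (P.bal x c y).hom ≫ bimap P.functor (𝟙 x) (c ⊴ₗ h) := by
  simpa using P.bimap_comp_bal (𝟙 x) (𝟙 c) h

lemma bal_pentagon (x : X) (c d : C) (y : Y) :
    (P.bal (x ⊙ᵣ c) d y).hom ≫ (P.bal x c (d ⊙ₗ y)).hom =
      bimap P.functor (αᵣ x c d).inv (𝟙 y) ≫ (P.bal x (c ⊗ d) y).hom ≫
        bimap P.functor (𝟙 x) (αₗ c d y).hom := by
  rw [bimap_id_right, bimap_id_left, P.pentagon]

lemma bal_triangle (x : X) (y : Y) :
    (P.bal x (𝟙_ C) y).hom ≫ bimap P.functor (𝟙 x) (λₗ y).hom =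
      bimap P.functor (ρᵣ x).hom (𝟙 y) := by
  rw [bimap_id_right, bimap_id_left, P.triangle]

end

open FreeCocompletion

variable {K : Type u} [Field K] {A X Y : Type u}
variable [SmallCategory A] [SmallCategory X] [SmallCategory Y]
variable [Preadditive A] [Preadditive X] [Preadditive Y] [Linear K A] [Linear K X] [Linear K Y]
variable [MonoidalCategory A] [MonoidalPreadditive A] [MonoidalLinear K A]
variable [MonoidalRightAction A X] [LinearRightAction K A X]
variable [MonoidalLeftAction A Y] [LinearLeftAction K A Y]
variable {E : Type w} [Category.{u} E] [Preadditive E] [Linear K E]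
variable (Q : BalancedFunctor K (FreeCocompletion K A) (FreeCocompletion K X)
  (FreeCocompletion K Y) E)

/-- The balancing isomorphism on represented presheaves, transported to the base categories along
`rightRep` and `leftRep`. -/
noncomputable def repBal (x : X) (a : A) (y : Y) :
    (Q.functor.obj (rep K (x ⊙ᵣ a))).obj (rep K y) ≅
      (Q.functor.obj (rep K x)).obj (rep K (a ⊙ₗ y)) :=
  asIso (bimap Q.functor (rightRep x a) (𝟙 (rep K y))) ≪≫ Q.bal (rep K x) (rep K a) (rep K y) ≪≫
    (asIso (bimap Q.functor (𝟙 (rep K x)) (leftRep a y))).symm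

lemma repBal_hom_comp (x : X) (a : A) (y : Y) :
    (Q.repBal x a y).hom ≫ bimap Q.functor (𝟙 (rep K x)) (leftRep a y) =
      bimap Q.functor (rightRep x a) (𝟙 (rep K y)) ≫
        (Q.bal (rep K x) (rep K a) (rep K y)).hom := by
  simp [repBal]

lemma repBal_naturality {x x' : X} {a a' : A} {y y' : Y} (f : x ⟶ x') (g : a ⟶ a') (h : y ⟶ y') :
    bimap Q.functor (ofSec (ofHom (f ⊙ᵣₘ g))) (ofSec (ofHom h)) ≫ (Q.repBal x' a' y').hom =
      (Q.repBal x a y).hom ≫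
        bimap Q.functor (ofSec (ofHom f)) (ofSec (ofHom (g ⊙ₗₘ h))) := by
  rw [← cancel_mono (bimap Q.functor (𝟙 (rep K x')) (leftRep a' y'))]
  calc
    _ = bimap Q.functor (ofSec (ofHom (f ⊙ᵣₘ g)) ≫ rightRep x' a') (ofSec (ofHom h) ≫ 𝟙 _) ≫
          (Q.bal _ _ _).hom := by
      rw [Category.assoc, repBal_hom_comp, bimap_comp, Category.assoc]
    _ = bimap Q.functor (rightRep x a) (𝟙 _) ≫
          bimap Q.functor (ofSec (ofHom f) ⊙ᵣₘ ofSec (ofHom g)) (ofSec (ofHom h)) ≫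
          (Q.bal _ _ _).hom := by
      rw [rightRep_naturality, Category.comp_id, ← reassoc_of% (bimap_comp Q.functor),
        Category.id_comp]
    _ = (Q.repBal x a y).hom ≫ bimap Q.functor (𝟙 _ ≫ ofSec (ofHom f))
          (leftRep a y ≫ (ofSec (ofHom g) ⊙ₗₘ ofSec (ofHom h))) := by
      rw [bimap_comp_bal, ← reassoc_of% repBal_hom_comp, bimap_comp]
    _ = _ := by
      rw [Category.id_comp, ← leftRep_naturality, Category.assoc, ← bimap_comp, Category.comp_id]

lemma repBal_pentagon (x : X) (a b : A) (y : Y) :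
    (Q.repBal (x ⊙ᵣ a) b y).hom ≫ (Q.repBal x a (b ⊙ₗ y)).hom =
      bimap Q.functor (ofSec (ofHom (αᵣ x a b).inv)) (𝟙 (rep K y)) ≫ (Q.repBal x (a ⊗ b) y).hom ≫
        bimap Q.functor (𝟙 (rep K x)) (ofSec (ofHom (αₗ a b y).hom)) := by
  rw [← cancel_mono (bimap Q.functor (𝟙 (rep K x)) (leftRep a (b ⊙ₗ y))),
    ← cancel_mono (bimap Q.functor (𝟙 (rep K x)) (rep K a ⊴ₗ leftRep b y))]
  calc
    _ = (Q.repBal (x ⊙ᵣ a) b y).hom ≫ bimap Q.functor (rightRep x a) (𝟙 _) ≫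
          bimap Q.functor (𝟙 _) (leftRep b y) ≫ (Q.bal _ _ _).hom := by
      rw [Category.assoc, Category.assoc, reassoc_of% repBal_hom_comp, bimap_comp_bal_right]
    _ = bimap Q.functor (rightRep (x ⊙ᵣ a) b) (𝟙 _) ≫
          bimap Q.functor (rightRep x a ⊵ᵣ rep K b) (𝟙 _) ≫
          (Q.bal _ _ _).hom ≫ (Q.bal _ _ _).hom := by
      rw [← reassoc_of% (bimap_exchange Q.functor), reassoc_of% repBal_hom_comp,
        ← reassoc_of% bimap_comp_bal_left]
    _ = bimap Q.functor (rightRep (x ⊙ᵣ a) b ≫ rightRep x a ⊵ᵣ rep K b ≫ (αᵣ _ _ _).inv)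
          (𝟙 _) ≫ (Q.bal _ _ _).hom ≫ bimap Q.functor (𝟙 _) (αₗ _ _ _).hom := by
      rw [bal_pentagon, bimap_comp_left, bimap_comp_left, Category.assoc, Category.assoc]
    _ = bimap Q.functor (ofSec (ofHom (αᵣ x a b).inv)) (𝟙 _) ≫ (Q.repBal x (a ⊗ b) y).hom ≫
          bimap Q.functor (𝟙 _) (leftRep (a ⊗ b) y ≫ tensorRep a b ⊵ₗ rep K y ≫
            (αₗ _ _ _).hom) := by
      rw [rightRep_assoc, bimap_comp_left, bimap_comp_left, Category.assoc, Category.assoc,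
        reassoc_of% bimap_comp_bal_middle, bimap_comp_right, bimap_comp_right,
        reassoc_of% repBal_hom_comp]
    _ = _ := by
      rw [leftRep_assoc, bimap_comp_right, bimap_comp_right, Category.assoc, Category.assoc,
        Category.assoc]

lemma repBal_triangle (x : X) (y : Y) :
    (Q.repBal x (𝟙_ A) y).hom ≫ bimap Q.functor (𝟙 (rep K x)) (ofSec (ofHom (λₗ y).hom)) =
      bimap Q.functor (ofSec (ofHom (ρᵣ x).hom)) (𝟙 (rep K y)) := by
  rw [← leftRep_unit, ← rightRep_unit, bimap_comp_right, bimap_comp_left,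
    reassoc_of% repBal_hom_comp]
  exact congrArg (_ ≫ ·) (Q.bal_triangle (rep K x) (rep K y))

end BalancedFunctor

/-! ### Restriction of balanced functors to represented presheaves -/

lemma IsBilinear.whiskeringLeft₂ {K : Type u} [Field K]
    {V : Type v₁} [Category.{u} V] [Preadditive V] [Linear K V]
    {V' : Type v₂} [Category.{u} V'] [Preadditive V'] [Linear K V']
    {W : Type v₃} [Category.{u} W] [Preadditive W] [Linear K W]
    {W' : Type v} [Category.{u} W'] [Preadditive W'] [Linear K W']
    {E : Type w} [Category.{u} E] [Preadditive E] [Linear K E] (F : V ⥤ V') (G : W ⥤ W')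
    [F.Additive] [F.Linear K] [G.Additive] [G.Linear K] (T : V' ⥤ W' ⥤ E) [IsBilinear K T] :
    IsBilinear K ((((Functor.whiskeringLeft₂ E).obj F).obj G).obj T) where
  map_add_left f g y := by simp [IsBilinear.map_add_left K]
  map_smul_left r f y := by simp [IsBilinear.map_smul_left]
  map_add_right x _ _ f g := by simp [IsBilinear.map_add_right K]
  map_smul_right x _ _ r f := by simp [IsBilinear.map_smul_right]

namespace BalancedFunctor

open FreeCocompletion

variable {K : Type u} [Field K] {A X Y : Type u}
variable [SmallCategory A] [SmallCategory X] [SmallCategory Y]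
variable [Preadditive A] [Preadditive X] [Preadditive Y] [Linear K A] [Linear K X] [Linear K Y]
variable [MonoidalCategory A] [MonoidalPreadditive A] [MonoidalLinear K A]
variable [MonoidalRightAction A X] [LinearRightAction K A X]
variable [MonoidalLeftAction A Y] [LinearLeftAction K A Y]
variable {E : Type w} [Category.{u} E] [Preadditive E] [Linear K E]

section

variable {P Q : BalancedFunctor K (FreeCocompletion K A) (FreeCocompletion K X)
  (FreeCocompletion K Y) E}

lemma comm_repBal_iff (η : P.functor ⟶ Q.functor) (x : X) (a : A) (y : Y) :
    (η.app (rep K (x ⊙ᵣ a))).app (rep K y) ≫ (Q.repBal x a y).hom =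
        (P.repBal x a y).hom ≫ (η.app (rep K x)).app (rep K (a ⊙ₗ y)) ↔
      (η.app (rep K x ⊙ᵣ rep K a)).app (rep K y) ≫ (Q.bal (rep K x) (rep K a) (rep K y)).hom =
        (P.bal (rep K x) (rep K a) (rep K y)).hom ≫
          (η.app (rep K x)).app (rep K a ⊙ₗ rep K y) := by
  rw [← cancel_mono (bimap Q.functor (𝟙 (rep K x)) (leftRep a y)), Category.assoc, Category.assoc,
    repBal_hom_comp, ← bimap_naturality, ← reassoc_of% (bimap_naturality η),
    reassoc_of% repBal_hom_comp, cancel_epi]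

lemma hom_ext_of_actionHom {F : FreeCocompletion K X} {C : FreeCocompletion K A}
    {G : FreeCocompletion K Y} {e : E} {f g : (P.functor.obj (F ⊙ᵣ C)).obj G ⟶ e}
    (h : ∀ (x : X) (s : F.sec x) (a : A) (t : C.sec a) (y : Y) (r : G.sec y),
      bimap P.functor (ofSec s ⊙ᵣₘ ofSec t) (ofSec r) ≫ f =
        bimap P.functor (ofSec s ⊙ᵣₘ ofSec t) (ofSec r) ≫ g) : f = g := by
  refine CocontFunctor.hom_ext (H := ⟨_, P.isBicocontinuous.obj (F ⊙ᵣ C)⟩) fun y r => ?_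
  refine IsBicocontinuous.hom_ext
    ((Day.isBicocontinuous_convFunctor (rightActionBifunctor A X)).whiskeringRight
      (P.isBicocontinuous.flip_obj (rep K y))) fun x s a t => ?_
  have h_map : bimap (Day.convFunctor K (rightActionBifunctor A X) ⋙
      (Functor.whiskeringRight _ _ _).obj (P.functor.flip.obj (rep K y))) (ofSec s) (ofSec t) =
      (P.functor.map (ofSec s ⊙ᵣₘ ofSec t)).app (rep K y) := by
    rw [MonoidalRightAction.actionHom_def]
    exact ((P.functor.flip.obj (rep K y)).map_comp _ _).symm
  have h := h x s a t y r
  rw [bimap, Category.assoc, Category.assoc] at h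
  rw [h_map]
  exact h

end

/-- The restriction of a balanced functor on free cocompletions to represented presheaves. -/
noncomputable def restrictObj (Q : BalancedFunctor K (FreeCocompletion K A) (FreeCocompletion K X)
    (FreeCocompletion K Y) E) : NaiveBalancedFunctor K A X Y E where
  functor := (((Functor.whiskeringLeft₂ E).obj (yoneda K X)).obj (yoneda K Y)).obj Q.functor
  bilinear := .whiskeringLeft₂ _ _ _
  bal := Q.repBal
  bal_nat := Q.repBal_naturality
  pentagon x a b y := by
    rw [Q.repBal_pentagon x a b y, bimap_id_right, bimap_id_left]
    rfl
  triangle x y := by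
    have h := Q.repBal_triangle x y
    rw [bimap_id_right, bimap_id_left] at h
    exact h

variable (K A X Y E) in
/-- Restriction of balanced functors on free cocompletions to represented presheaves. -/
noncomputable def restrict : BalancedFunctor K (FreeCocompletion K A) (FreeCocompletion K X)
    (FreeCocompletion K Y) E ⥤ NaiveBalancedFunctor K A X Y E where
  obj Q := Q.restrictObj
  map η :=
    { hom := (((Functor.whiskeringLeft₂ E).obj (yoneda K X)).obj (yoneda K Y)).map η.hom
      comm := fun x a y => (comm_repBal_iff η.hom x a y).mpr (η.comm _ _ _) }

instance : (restrict K A X Y E).Faithful where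
  map_injective {P Q η θ} h := by
    have h_rep (x : X) (y : Y) :
        (η.hom.app (rep K x)).app (rep K y) = (θ.hom.app (rep K x)).app (rep K y) :=
      congrArg (fun α => (α.hom.app x).app y) h
    refine Hom.ext ?_
    ext F G
    refine P.isBicocontinuous.hom_ext fun x s y t => ?_
    rw [bimap_naturality, bimap_naturality, h_rep]

instance : (restrict K A X Y E).Full where
  map_surjective {P Q} α := by
    obtain ⟨η, hη⟩ := P.isBicocontinuous.exists_whiskeringLeft₂_yoneda_map_eq
      (T' := Q.functor) α.hom
    have comm_rep (x : X) (a : A) (y : Y) :=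
      (comm_repBal_iff η x a y).mp (by
        have h := α.comm x a y
        rw [← hη] at h
        exact h)
    refine ⟨⟨η, fun F C G => hom_ext_of_actionHom fun x s a t y r => ?_⟩,
      NaiveBalancedFunctor.Hom.ext hη⟩
    rw [reassoc_of% (bimap_naturality η), bimap_comp_bal, reassoc_of% comm_rep,
      reassoc_of% bimap_comp_bal, bimap_naturality]

end BalancedFunctor

/-! ### Free cocompletion and the two universal properties -/

namespace Day

open FreeCocompletion

/-- Day convolution along a bilinear functor, restricted to represented presheaves. -/
noncomputable def repIso {K : Type u} [Field K] {B C D : Type u}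
    [SmallCategory B] [SmallCategory C] [SmallCategory D]
    [Preadditive B] [Preadditive C] [Preadditive D] [Linear K B] [Linear K C] [Linear K D]
    (T : B ⥤ C ⥤ D) [IsBilinear K T] :
    T ⋙ (Functor.whiskeringRight C D _).obj (yoneda K D) ≅
      (((Functor.whiskeringLeft₂ _).obj (yoneda K B)).obj
        (yoneda K C)).obj (convFunctor K T) :=
  NatIso.ofComponents
    (fun b => NatIso.ofComponents (fun c => asIso (repHom T b c)) fun {c c'} g => by
      have h := repHom_naturality (K := K) T (𝟙 b) g
      have h_id : ofSec (ofHom (K := K) (𝟙 b)) = 𝟙 _ := (yoneda K B).map_id b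
      rw [T.map_id, NatTrans.id_app, Category.id_comp, h_id] at h
      exact h)
    fun {b b'} f => by
      ext1
      ext1 c
      have h := repHom_naturality (K := K) T f (𝟙 c)
      have h_id : ofSec (ofHom (K := K) (𝟙 c)) = 𝟙 _ := (yoneda K C).map_id c
      rw [(T.obj b').map_id, Category.comp_id, h_id] at h
      exact h

end Day

namespace BalancedFunctor

open FreeCocompletion

variable {K : Type u} [Field K] {A X Y : Type u}
variable [SmallCategory A] [SmallCategory X] [SmallCategory Y]
variable [Preadditive A] [Preadditive X] [Preadditive Y] [Linear K A] [Linear K X] [Linear K Y]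
variable [MonoidalCategory A] [MonoidalPreadditive A] [MonoidalLinear K A]
variable [MonoidalRightAction A X] [LinearRightAction K A X]
variable [MonoidalLeftAction A Y] [LinearLeftAction K A Y]
variable {W : Type v} [Category.{u} W] [Preadditive W] [Linear K W]
variable {E : Type w} [Category.{u} E] [Preadditive E] [Linear K E]

lemma repBal_postcomp_hom (Q : BalancedFunctor K (FreeCocompletion K A) (FreeCocompletion K X)
    (FreeCocompletion K Y) W) (G : CocontFunctor K W E) (x : X) (a : A) (y : Y) :
    ((Q.postcomp G).repBal x a y).hom = G.obj.map (Q.repBal x a y).hom := by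
  have h_bimap {F F' : FreeCocompletion K X} {H H' : FreeCocompletion K Y} (f : F ⟶ F')
      (g : H ⟶ H') : bimap (Q.postcomp G).functor f g = G.obj.map (bimap Q.functor f g) :=
    (G.obj.map_comp _ _).symm
  refine (cancel_mono (bimap (Q.postcomp G).functor (𝟙 (rep K x)) (leftRep a y))).mp ?_
  have h := congrArg G.obj.map (Q.repBal_hom_comp x a y)
  rw [G.obj.map_comp, G.obj.map_comp, ← h_bimap, ← h_bimap] at h
  exact (repBal_hom_comp (Q.postcomp G) x a y).trans h.symm

end BalancedFunctor

namespace NaiveBalancedTensor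

open FreeCocompletion Day

variable {K : Type u} [Field K] {A X Y : Type u}
variable [SmallCategory A] [SmallCategory X] [SmallCategory Y]
variable [Preadditive A] [Preadditive X] [Preadditive Y] [Linear K A] [Linear K X] [Linear K Y]
variable [MonoidalCategory A] [MonoidalPreadditive A] [MonoidalLinear K A]
variable [MonoidalRightAction A X] [LinearRightAction K A X]
variable [MonoidalLeftAction A Y] [LinearLeftAction K A Y]

lemma repHom_incl_comp_repBal (x : X) (a : A) (y : Y) :
    repHom (K := K) (incl K A X Y) (x ⊙ᵣ a) y ≫ ((balancedConv K A X Y).repBal x a y).hom =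
      (yoneda K _).map (balIso x a y).hom ≫ repHom (incl K A X Y) x (a ⊙ₗ y) := by
  refine (cancel_mono (bimap (balancedConv K A X Y).functor (𝟙 (rep K x)) (leftRep a y))).mp ?_
  calc
    _ = repHom (incl K A X Y) (x ⊙ᵣ a) y ≫
          bimap (balancedConv K A X Y).functor (rightRep x a) (𝟙 (rep K y)) ≫
          ((balancedConv K A X Y).bal (rep K x) (rep K a) (rep K y)).hom :=
      (Category.assoc _ _ _).trans (congrArg (_ ≫ ·) (BalancedFunctor.repBal_hom_comp _ x a y))
    _ = (yoneda K _).map (balIso x a y).hom ≫ repHom (incl K A X Y) x (a ⊙ₗ y) ≫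
          bimap (balancedConv K A X Y).functor (𝟙 (rep K x)) (leftRep a y) := by
      rw [bimap_id_right, bimap_id_left]
      exact (inclAssoc K A X Y).repHom_comp_hom x a y
    _ = _ := (Category.assoc _ _ _).symm

variable (E : Type w) [Category.{u} E] [Preadditive E] [Linear K E]

variable (K A X Y) in
/-- Restricting to represented presheaves turns composition with Day convolution along `incl` into
composition with `incl`. -/
noncomputable def restrictPostcompIso :
    restrictYoneda K (NaiveBalancedTensor K A X Y) E ⋙ (balancedIncl K A X Y).postcompFunctor E ≅
      (balancedConv K A X Y).postcompFunctor E ⋙ BalancedFunctor.restrict K A X Y E :=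
  NatIso.ofComponents
    (fun G => NaiveBalancedFunctor.isoMk
      (Functor.isoWhiskerRight (repIso (K := K) (incl K A X Y))
        ((Functor.whiskeringRight _ _ _).obj G.obj))
      fun x a y =>
        (congrArg (_ ≫ ·) (BalancedFunctor.repBal_postcomp_hom _ G x a y)).trans <|
          (G.obj.map_comp _ _).symm.trans <|
            (congrArg G.obj.map (repHom_incl_comp_repBal x a y)).trans (G.obj.map_comp _ _))
    fun {G G'} η => NaiveBalancedFunctor.Hom.ext <| by
      ext x y
      exact (η.hom.naturality (repHom (incl K A X Y) x y)).symm

variable [HasColimits E]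

instance : ((balancedConv K A X Y).postcompFunctor E).IsEquivalence := by
  have : ((balancedConv K A X Y).postcompFunctor E ⋙
    BalancedFunctor.restrict K A X Y E).IsEquivalence :=
      Functor.isEquivalence_of_iso (restrictPostcompIso K A X Y E)
  have : (BalancedFunctor.restrict K A X Y E).EssSurj :=
    ⟨fun P => ⟨_, ⟨((balancedConv K A X Y).postcompFunctor E ⋙
      BalancedFunctor.restrict K A X Y E).objObjPreimageIso P⟩⟩⟩
  have : (BalancedFunctor.restrict K A X Y E).IsEquivalence := {}
  exact Functor.isEquivalence_of_comp_right _ (BalancedFunctor.restrict K A X Y E)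

variable (K A X Y) in
lemma isBalancedTensorProduct_balancedConv :
    (balancedConv K A X Y).IsBalancedTensorProduct.{u, u + 1, w} where
  cocomplete := inferInstance
  universal _ := inferInstance

end NaiveBalancedTensor

namespace CocontFunctor

variable {K : Type u} [Field K]
variable {W : Type v} [Category.{u} W] [Preadditive W] [Linear K W]
variable {W' : Type w} [Category.{u} W'] [Preadditive W'] [Linear K W']

variable (K W) in
/-- The identity, as a linear cocontinuous functor. -/
abbrev id : CocontFunctor K W W :=
  ⟨𝟭 W, fun _ _ _ _ => rfl, fun _ _ _ _ => rfl, inferInstance⟩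

/-- The composite of linear cocontinuous functors. -/
abbrev comp {W'' : Type v₁} [Category.{u} W''] [Preadditive W''] [Linear K W'']
    (G : CocontFunctor K W W') (G' : CocontFunctor K W' W'') : CocontFunctor K W W'' :=
  ⟨G.obj ⋙ G'.obj, isLinearCocontinuous_comp G.property G'.property⟩

end CocontFunctor

namespace BalancedFunctor

section Uniqueness

variable {K : Type u} [Field K]
variable {W : Type v} [Category.{u} W] [Preadditive W] [Linear K W]
variable {W' : Type w} [Category.{u} W'] [Preadditive W'] [Linear K W']
variable {C : Type v₁} [Category.{u} C] [MonoidalCategory C]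
variable {X : Type v₂} [Category.{u} X] [Preadditive X] [Linear K X] [MonoidalRightAction C X]
variable {Y : Type v₃} [Category.{u} Y] [Preadditive Y] [Linear K Y] [MonoidalLeftAction C Y]

variable (C X Y) in
/-- Composition with a linear cocontinuous functor, functorial in the balanced functor. -/
def postcomposition (G : CocontFunctor K W W') :
    BalancedFunctor K C X Y W ⥤ BalancedFunctor K C X Y W' where
  obj P := P.postcomp G
  map η :=
    { hom := Functor.whiskerRight η.hom ((Functor.whiskeringRight Y W W').obj G.obj)
      comm x c y := (G.obj.map_comp _ _).symm.trans <|
        (congrArg G.obj.map (η.comm x c y)).trans (G.obj.map_comp _ _) }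
  map_id P := Hom.ext <| by
    ext x y
    exact G.obj.map_id _
  map_comp η θ := Hom.ext <| by
    ext x y
    exact G.obj.map_comp _ _

/-- If composition with `P` is fully faithful, then linear cocontinuous functors exchanging `P`
and `Q` compose to the identity. -/
lemma nonempty_comp_iso_id (P : BalancedFunctor K C X Y W) (Q : BalancedFunctor K C X Y W')
    [(P.postcompFunctor W).Full] [(P.postcompFunctor W).Faithful]
    {G : CocontFunctor K W W'} {G' : CocontFunctor K W' W} (e : P.postcomp G ≅ Q)
    (e' : Q.postcomp G' ≅ P) : Nonempty (G.obj ⋙ G'.obj ≅ 𝟭 W) := by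
  have i : (P.postcompFunctor W).obj (G.comp G') ≅ (P.postcompFunctor W).obj (.id K W) :=
    (postcomposition C X Y G').mapIso e ≪≫ e'
  exact ⟨(ObjectProperty.ι _).mapIso ((P.postcompFunctor W).preimageIso i)⟩

lemma IsBalancedTensorProduct.exists_isEquivalence {W W' : Type v}
    [Category.{u} W] [Preadditive W] [Linear K W] [Category.{u} W'] [Preadditive W'] [Linear K W']
    {P : BalancedFunctor K C X Y W} {Q : BalancedFunctor K C X Y W'}
    (hP : IsBalancedTensorProduct.{u, v, v} P) (hQ : IsBalancedTensorProduct.{u, v, v} Q) :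
    ∃ G : CocontFunctor K W W', G.obj.IsEquivalence ∧ Nonempty (P.postcomp G ≅ Q) := by
  have := hP.cocomplete
  have := hQ.cocomplete
  have := hP.universal W
  have := hP.universal W'
  have := hQ.universal W
  have := hQ.universal W'
  let e := (P.postcompFunctor W').objObjPreimageIso Q
  let e' := (Q.postcompFunctor W).objObjPreimageIso P
  obtain ⟨i⟩ := nonempty_comp_iso_id P Q e e'
  obtain ⟨i'⟩ := nonempty_comp_iso_id Q P e' e
  exact ⟨_, (CategoryTheory.Equivalence.mk _ _ i.symm i').isEquivalence_functor, ⟨e⟩⟩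

end Uniqueness

end BalancedFunctor

end LinCat

theorem mainTheorem10 {K : Type u} [Field K] {A X Y : Type u}
    [SmallCategory A] [Preadditive A] [Linear K A]
    [MonoidalCategory A] [MonoidalPreadditive A] [MonoidalLinear K A]
    [SmallCategory X] [Preadditive X] [Linear K X]
    [MonoidalRightAction A X] [LinCat.LinearRightAction K A X]
    [SmallCategory Y] [Preadditive Y] [Linear K Y]
    [MonoidalLeftAction A Y] [LinCat.LinearLeftAction K A Y] :
    ∃ P : LinCat.BalancedFunctor K (LinCat.FreeCocompletion K A)
        (LinCat.FreeCocompletion K X) (LinCat.FreeCocompletion K Y)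
        (LinCat.FreeCocompletion K (LinCat.NaiveBalancedTensor K A X Y)),
      LinCat.BalancedFunctor.IsBalancedTensorProduct.{u, u + 1, w} P ∧
      ∀ (W : Type (u + 1)) [LargeCategory W] [Preadditive W] [Linear K W]
        (Q : LinCat.BalancedFunctor K (LinCat.FreeCocompletion K A)
          (LinCat.FreeCocompletion K X) (LinCat.FreeCocompletion K Y) W),
        LinCat.BalancedFunctor.IsBalancedTensorProduct.{u, u + 1, u + 1} Q →
          ∃ G : LinCat.CocontFunctor K
              (LinCat.FreeCocompletion K (LinCat.NaiveBalancedTensor K A X Y)) W,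
            G.obj.IsEquivalence ∧ Nonempty (P.postcomp G ≅ Q) := by
  exact ⟨LinCat.NaiveBalancedTensor.balancedConv K A X Y,
    LinCat.NaiveBalancedTensor.isBalancedTensorProduct_balancedConv K A X Y,
    fun _ _ _ _ _ hQ =>
      (LinCat.NaiveBalancedTensor.isBalancedTensorProduct_balancedConv K A X Y).exists_isEquivalence
        hQ⟩
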